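/- Notation. For integers $1\le i\le m$ let $\ell_m(i)=(m+1-i)^2$ and $\mathrm{ms}(i)=\sum_{j=i}^m \ell_m(j)$, with $\mathrm{ms}(m+1)=0$. Logarithms are in base two. For $\varepsilon\in[-1,1]$, let $\mathcal C_{n,\varepsilon}$ be the distribution of the sum of $n$ independent $\{-1,1\}$-valued coins, each equal to $1$ with probability $\frac{1+\varepsilon}{2}$. For an integer $p$ that is the sum of the entries of some $v\in\{-1,1\}^{n}$ (that is, $|p|\le n$ and $p\equiv n \bmod 2$) and $0\le\ell\le n$, let $\mathcal{H}_{n,p,\ell}$ be the hypergeometric distribution: the law of $\sum_{j\in I}v_j$, where $I$ is a uniformly random $\ell$-element subset of $\{1,\dots,n\}$ and $v\in\{-1,1\}^n$ is any vector with $\sum_j v_j=p$. Online binomial game. Let $m\ge1$, $\varepsilon\in[-1,1]$, and let $f$ be a randomized function of $(i,b,c)\in\{1,\dots,m\}\times\mathbb Z\times\mathbb Z$. In the game $G_{m,\varepsilon,f}$ the round coins $C_i\sim\mathcal C_{\ell_m(i),\varepsilon}$ ($1\le i\le m$) are independent, $S_i=\sum_{j\le i}C_j$, and the hint of round $i$ is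 $H_i=f(i,S_{i-1},C_i)$, computed with fresh randomness. Let $\delta_i(b)=\Pr[S_m\ge0\mid S_{i-1}=b]$ and $\delta_i(b,h)=\Pr[S_m\ge0\mid S_{i-1}=b,H_i=h]$; for $i\le m$ let $O_i=\delta_i(S_{i-1},H_i)$ and $O_i^-=\delta_i(S_{i-1})$, and let $O_{m+1}=O_{m+1}^-$ be $1$ if $S_m\ge0$ and $0$ otherwise. A (randomized, stateful, computationally unbounded) algorithm $B$ receives $(S_{i-1},H_i)$ in round $i$ and outputs a bit; $I$ is the first round in which it outputs $1$, and $I=m+1$ if there is none. The bias of the game is $\mathrm{bias}(G_{m,\varepsilon,f})=\sup_B\bigl|\mathbb E[O_I-O_I^-]\bigr|$, over all algorithms $B$. Hypergeometric hint. For an even integer $p\in[-2\,\mathrm{ms}(1),2\,\mathrm{ms}(1)]$, $f=f^{\mathrm{hyp}}_{m,p}$ is the randomized function that on input $(i,b,c)$ outputs $1$ with probability $\Pr_{x\sim\mathcal H_{2\mathrm{ms}(1),\,p,\,\mathrm{ms}(i+1)}}[x\ge -b-c]$, and $-1$ otherwise. Statement. For every constant $c$ there is a constant $C$ (depending only on $c$)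 such that for all integers $m\ge2$, all $\varepsilon\in[-1,1]$ and all even integers $p\in[-2\,\mathrm{ms}(1),2\,\mathrm{ms}(1)]$ with $|p|\le c\sqrt{\log m\cdot \mathrm{ms}(1)}$, $$\mathrm{bias}\bigl(G_{m,\varepsilon,f^{\mathrm{hyp}}_{m,p}}\bigr)\le C\cdot\frac{\sqrt{\log m}}{m}.$$ -/

import Mathlib

namespace OnlineBinomial

noncomputable section

/-! ### Finite probability -/

/-- The probability of the event `A` under the discrete distribution `P`. -/
def prob {α : Type} (P : PMF α) (A : Set α) : ℝ := (P.toOuterMeasure A).toReal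

/-- The conditional probability of `A` given `B` (only meaningful when `B` has positive
probability). -/
def condProb {α : Type} (P : PMF α) (A B : Set α) : ℝ := prob P (A ∩ B) / prob P B

/-- The expectation of the real function `g` under the discrete distribution `P`. -/
def mean {α : Type} (P : PMF α) (g : α → ℝ) : ℝ := ∑' a, (P a).toReal * g a

/-- The expectation of a function with values in `[-1, 1]` is in `[-1, 1]`. -/
theorem abs_mean_le_one {α : Type} (P : PMF α) (g : α → ℝ) (hg : ∀ a, |g a| ≤ 1) :
    |mean P g| ≤ 1 := by
  have hs : Summable fun a => (P a).toReal := ENNReal.summable_toReal P.tsum_coe_ne_top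
  have h1 : ∑' a, (P a).toReal = 1 := by
    rw [← ENNReal.tsum_toReal_eq (fun a => P.apply_ne_top a), P.tsum_coe]; simp
  have hle : ∀ a, ‖(P a).toReal * g a‖ ≤ (P a).toReal := fun a => by
    rw [norm_mul, Real.norm_eq_abs, Real.norm_eq_abs, abs_of_nonneg ENNReal.toReal_nonneg]
    exact mul_le_of_le_one_right ENNReal.toReal_nonneg (hg a)
  have := tsum_of_norm_bounded (h1 ▸ hs.hasSum) hle
  simpa [mean, Real.norm_eq_abs] using this

/-! ### Coins -/

/-- The number of coins `(m + 1 - i) ^ 2` tossed in round `i ∈ {1, …, m}`. -/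
def roundCoins (m i : ℕ) : ℕ := (m + 1 - i) ^ 2

/-- The total number of coins tossed in rounds `i, …, m`. -/
def coinsFrom (m i : ℕ) : ℕ := ∑ j ∈ Finset.Icc i m, roundCoins m j

/-- The `±1` coin with bias `ε`: it is `1` with probability `(1 + ε) / 2` and `-1` otherwise. -/
def coin (ε : Set.Icc (-1 : ℝ) 1) : PMF ℤ :=
  (PMF.ofFintype (fun b : Bool => ENNReal.ofReal (if b then (1 + ε) / 2 else (1 - ε) / 2)) (by
    have h1 : (0 : ℝ) ≤ (1 + ε) / 2 := by linarith [ε.2.1]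
    have h2 : (0 : ℝ) ≤ (1 - ε) / 2 := by linarith [ε.2.2]
    simp only [Fintype.sum_bool, if_true, Bool.false_eq_true, if_false]
    rw [← ENNReal.ofReal_add h1 h2, ← ENNReal.ofReal_one]
    congr 1
    ring)).map fun b => if b then 1 else -1

/-- The distribution of the sum of `n` independent `ε`-biased `±1` coins. -/
def coinSum (ε : Set.Icc (-1 : ℝ) 1) : ℕ → PMF ℤ
  | 0 => PMF.pure 0
  | n + 1 => (coinSum ε n).bind fun s => (coin ε).map fun x => s + x

/-! ### Online binomial games -/

/-- An `m`-round online binomial game: the bias `ε` of the coins, and the randomized hint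
function, which gets the index `i ∈ {1, …, m}` of the current round, the sum of the coins of the
rounds before it, and the sum of the coins of round `i`. -/
structure Game (m : ℕ) (H : Type) where
  eps : Set.Icc (-1 : ℝ) 1
  hint : ℕ → ℤ → ℤ → PMF H

namespace Game

variable {m : ℕ} {H : Type} (G : Game m H)

/-- The joint distribution of `(C₁, H₁), …, (C_k, H_k)`: in each round the coins are independent
of the past, and the hint is sampled, with fresh randomness, from the hint function. -/
def lawUpTo : (k : ℕ) → PMF (Fin k → ℤ × H)
  | 0 => PMF.pure Fin.elim0
  | k + 1 => (lawUpTo k).bind fun ω =>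
      (coinSum G.eps (roundCoins m (k + 1))).bind fun c =>
        (G.hint (k + 1) (∑ j, (ω j).1) c).map fun h =>
          Fin.snoc (α := fun _ => ℤ × H) ω (c, h)

/-- The distribution of the transcript of the whole game. Rounds are numbered from `0` here, that
is, the entry with index `i : Fin m` holds the coins and the hint of round `i + 1`. -/
def law : PMF (Fin m → ℤ × H) := G.lawUpTo m

/-- `S_k`, the sum of the coins of the first `k` rounds. -/
def partialSum (ω : Fin m → ℤ × H) (k : ℕ) : ℤ :=
  ∑ j : Fin m with j.val < k, (ω j).1

/-- The event that the outcome of the game is one. -/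
def winning (m : ℕ) (H : Type) : Set (Fin m → ℤ × H) := {ω | 0 ≤ partialSum ω m}

/-- The expected outcome given that the sum of the coins before the current round is `b`. -/
def value (i : Fin m) (b : ℤ) : ℝ :=
  condProb G.law (winning m H) {ω | partialSum ω i = b}

/-- The expected outcome given that the sum of the coins before the current round is `b` and that
the hint of the current round is `h`. -/
def valueHint (i : Fin m) (b : ℤ) (h : H) : ℝ :=
  condProb G.law (winning m H) {ω | partialSum ω i = b ∧ (ω i).2 = h}

/-- The final outcome of the game, `0` or `1`. -/
def outcome (ω : Fin m → ℤ × H) : ℝ := (winning m H).indicator (fun _ => 1) ω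

/-- The variable `O_I`; the last index stands for the case that no round was selected. -/
def withHint (ω : Fin m → ℤ × H) (I : Fin (m + 1)) : ℝ :=
  if h : I.val < m then G.valueHint ⟨I, h⟩ (partialSum ω I) (ω ⟨I, h⟩).2 else outcome ω

/-- The variable `O_I⁻`; the last index stands for the case that no round was selected. -/
def withoutHint (ω : Fin m → ℤ × H) (I : Fin (m + 1)) : ℝ :=
  if h : I.val < m then G.value ⟨I, h⟩ (partialSum ω I) else outcome ω

end Game

/-! ### Algorithms and bias -/

/-- A randomized algorithm playing a game. In each round it gets a pair (sum of the coins of the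
previous rounds, hint of the current round) and outputs a bit, which may depend on everything that
it received so far and on its own randomness: it is given by the distribution of its next output
as a function of the list of all inputs received so far (conditioned on all its earlier outputs
being zero, as only the first round in which it outputs one matters). -/
abbrev Algorithm (H : Type) : Type := List (ℤ × H) → PMF Bool

/-- The distribution of the first index at which a sequence of bits, drawn one after the other
from the distributions `q 0, q 1, …`, is one; it is the last element of `Fin (n + 1)` if all bits
are zero. -/
def firstOne : {n : ℕ} → (Fin n → PMF Bool) → PMF (Fin (n + 1))
  | 0, _ => PMF.pure 0
  | _ + 1, q => (q 0).bind fun z =>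
      if z then PMF.pure 0 else (firstOne fun i => q i.succ).map Fin.succ

namespace Game

variable {m : ℕ} {H : Type} (G : Game m H)

/-- The inputs received by the algorithm up to and including the round with index `i`. -/
def inputs (ω : Fin m → ℤ × H) (i : Fin m) : List (ℤ × H) :=
  List.ofFn fun j : Fin (i.val + 1) => (partialSum ω j, (ω (Fin.castLE i.isLt j)).2)

/-- The joint distribution of the transcript and of the first round in which the algorithm `B`
outputs one. -/
def play (B : Algorithm H) : PMF ((Fin m → ℤ × H) × Fin (m + 1)) :=
  G.law.bind fun ω => (firstOne fun i => B (inputs ω i)).map fun I => (ω, I)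

/-- The bias `|E[O_I - O_I⁻]|` that the algorithm `B` gains in the game. -/
def biasOf (B : Algorithm H) : ℝ :=
  |mean (G.play B) fun x => G.withHint x.1 x.2 - G.withoutHint x.1 x.2|

/-- The bias of the game: the supremum, over all algorithms, of the bias gained. -/
def bias : ℝ := ⨆ B : Algorithm H, G.biasOf B

end Game

/-- Conditional probabilities are in `[0, 1]`. -/
theorem condProb_mem {α : Type} (P : PMF α) (A B : Set α) :
    0 ≤ condProb P A B ∧ condProb P A B ≤ 1 := by
  have hB : P.toOuterMeasure B ≠ ⊤ := by
    refine ne_top_of_le_ne_top ENNReal.one_ne_top ?_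
    rw [PMF.toOuterMeasure_apply, ← P.tsum_coe]
    exact ENNReal.tsum_le_tsum fun a => Set.indicator_le_self B P a
  refine ⟨div_nonneg ENNReal.toReal_nonneg ENNReal.toReal_nonneg,
    div_le_one_of_le₀ ?_ ENNReal.toReal_nonneg⟩
  exact ENNReal.toReal_mono hB (MeasureTheory.measure_mono Set.inter_subset_right)

/-- The bias gained by an algorithm is at most one. -/
theorem Game.biasOf_le_one {m : ℕ} {H : Type} (G : Game m H) (B : Algorithm H) : G.biasOf B ≤ 1 := by
  refine abs_mean_le_one _ _ fun x => ?_
  by_cases h : x.2.val < m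
  · simp only [Game.withHint, Game.withoutHint, h, dite_true, Game.valueHint, Game.value]
    exact abs_sub_le_iff.2
      ⟨by linarith [(condProb_mem G.law (Game.winning m H)
          {ω | Game.partialSum ω x.2 = Game.partialSum x.1 x.2 ∧
            (ω ⟨x.2, h⟩).2 = (x.1 ⟨x.2, h⟩).2}).2,
        (condProb_mem G.law (Game.winning m H) {ω | Game.partialSum ω x.2 = Game.partialSum x.1 x.2}).1],
      by linarith [(condProb_mem G.law (Game.winning m H)
          {ω | Game.partialSum ω x.2 = Game.partialSum x.1 x.2 ∧
            (ω ⟨x.2, h⟩).2 = (x.1 ⟨x.2, h⟩).2}).1,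
        (condProb_mem G.law (Game.winning m H) {ω | Game.partialSum ω x.2 = Game.partialSum x.1 x.2}).2]⟩
  · simp [Game.withHint, Game.withoutHint, h]

/-- The supremum that defines the bias of a game is over a bounded set. -/
theorem Game.bddAbove_biasOf {m : ℕ} {H : Type} (G : Game m H) :
    BddAbove (Set.range fun B : Algorithm H => G.biasOf B) :=
  ⟨1, by rintro _ ⟨B, rfl⟩; exact G.biasOf_le_one B⟩

/-! ### The hypergeometric hint -/

/-- The weight (the sum of the entries) of a `±1` vector. -/
def weight {n : ℕ} (v : Fin n → ℤˣ) : ℤ := ∑ j, (v j : ℤ)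

/-- The hypergeometric distribution: the weight of the restriction of the `±1` vector `v` to a
uniformly random set of `l` coordinates. It depends on `v` only through its length and weight. -/
def hypergeometric {n : ℕ} (v : Fin n → ℤˣ) (l : ℕ) (hl : l ≤ n) : PMF ℤ :=
  (PMF.uniformOfFinset (Finset.powersetCard l (Finset.univ : Finset (Fin n)))
    (Finset.powersetCard_nonempty.2 (by simpa using hl))).map fun I => ∑ j ∈ I, (v j : ℤ)

theorem coinsFrom_succ_le (m i : ℕ) : coinsFrom m (i + 1) ≤ 2 * coinsFrom m 1 := by
  have : coinsFrom m (i + 1) ≤ coinsFrom m 1 :=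
    Finset.sum_le_sum_of_subset (Finset.Icc_subset_Icc_left (by omega))
  omega

/-- The hypergeometric hint: on input `(i, b, c)` it is `1` with the probability that a sample
`x` of the hypergeometric distribution, with as many coordinates as there are coins left after
round `i`, satisfies `x ≥ -b - c`, and it is `-1` otherwise. -/
def hypHint (m : ℕ) (v : Fin (2 * coinsFrom m 1) → ℤˣ) (i : ℕ) (b c : ℤ) : PMF ℤˣ :=
  (hypergeometric v (coinsFrom m (i + 1)) (coinsFrom_succ_le m i)).map fun x =>
    if -b - c ≤ x then 1 else -1

/-- The `m`-round online binomial game with coins of bias `ε` and the hypergeometric hint. -/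
def hypGame (m : ℕ) (ε : Set.Icc (-1 : ℝ) 1) (v : Fin (2 * coinsFrom m 1) → ℤˣ) : Game m ℤˣ where
  eps := ε
  hint := hypHint m v

end

end OnlineBinomial

/-! Write Λ = log m and let V, of order m³, be the total number of coins. When r rounds remain, the
current one included, that round has r² coins and is followed by n coins, with n of order r³.

By Bayes' rule a hint h moves the value of a round by Cov(F, g) / η. Here F(c) is the probability
that the coin sum c of the round produces h, g(c) is the winning probability after c, and η = E F is
the probability of h. Hints with η < m⁻² and coin sums more than 16√(r²Λ) from their mean are
discarded; over all m rounds this costs O(1/m).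

While r is at least of order Λ², F is a tail of a hypergeometric law with standard deviation of
order √n. The hazard rate of such a law is O(√Λ/√n) up to O(√(nΛ)) above its mean, so F is Lipschitz
on the likely window with constant O(η √Λ/√n), relative to its own mean
(`Bell.abs_tailSum_sub_le_mul`). The function g is a binomial tail, Lipschitz with constant
O(1/√(1+μ²+n)), where μ is the expected final sum (`abs_binTail_sub_le`). The variance of the round
is at most r², so the change is O(√Λ · r²/(√n √(1+μ²+n))). Since r² = O(n^(2/3)), this is O(√Λ
(1+y²+n)^(-1/3)), where y is the expected final sum after the round.

The key point is that such a bound need not be maximized or summed over rounds. By Jensen's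
inequality it is at most the conditional expectation of (1+S_m²)^(-1/3), which is a martingale, so
by optional stopping (`Game.bias_le`) an arbitrary stopping rule gains at most O(√Λ) ·
E(1+S_m²)^(-1/3) = O(√Λ · V^(-1/3)) = O(√Λ/m).

In the last polylogarithmically many rounds the game is either practically decided or its final sum
is likely to be polylogarithmic; there the trivial bound 1 is paid by √m · E[(1+S_m²)⁻¹ | present],
whose mean is O(√m · V^(-1/2)) = O(1/m). If the coins are strongly biased, the outcome is
practically decided throughout. Small m are absorbed by the constant. -/

namespace OnlineBinomial

noncomputable section

/-- A real function is bounded. -/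
def IsBdd {α : Type} (g : α → ℝ) : Prop := ∃ M, ∀ a, |g a| ≤ M

/-! ### Closure properties of bounded functions -/

namespace IsBdd

variable {α β : Type} {f g : α → ℝ}

theorem of_mem_Icc (h : ∀ a, 0 ≤ f a ∧ f a ≤ 1) : IsBdd f :=
  ⟨1, fun a => abs_le.2 ⟨by linarith [(h a).1], (h a).2⟩⟩

theorem const (c : ℝ) : IsBdd fun _ : α => c := ⟨|c|, fun _ => le_rfl⟩

theorem add (hf : IsBdd f) (hg : IsBdd g) : IsBdd fun a => f a + g a := by
  obtain ⟨M, hM⟩ := hf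
  obtain ⟨N, hN⟩ := hg
  exact ⟨M + N, fun a => (abs_add_le _ _).trans (add_le_add (hM a) (hN a))⟩

theorem mul (hf : IsBdd f) (hg : IsBdd g) : IsBdd fun a => f a * g a := by
  obtain ⟨M, hM⟩ := hf
  obtain ⟨N, hN⟩ := hg
  refine ⟨M * N, fun a => ?_⟩
  rw [abs_mul]
  exact mul_le_mul (hM a) (hN a) (abs_nonneg _) ((abs_nonneg _).trans (hM a))

theorem const_mul (c : ℝ) (hf : IsBdd f) : IsBdd fun a => c * f a := (const c).mul hf

theorem neg (hf : IsBdd f) : IsBdd fun a => -f a := by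
  obtain ⟨M, hM⟩ := hf
  exact ⟨M, fun a => by rw [abs_neg]; exact hM a⟩

theorem abs (hf : IsBdd f) : IsBdd fun a => |f a| := by
  obtain ⟨M, hM⟩ := hf
  exact ⟨M, fun a => by rw [abs_abs]; exact hM a⟩

theorem comp (hf : IsBdd f) (φ : β → α) : IsBdd fun b => f (φ b) := by
  obtain ⟨M, hM⟩ := hf
  exact ⟨M, fun b => hM _⟩

theorem ite (p : α → Prop) [DecidablePred p] : IsBdd fun a => if p a then (1 : ℝ) else 0 :=
  of_mem_Icc fun a => by split_ifs <;> norm_num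

theorem sum {ι : Type} (s : Finset ι) {F : ι → α → ℝ} (h : ∀ i ∈ s, IsBdd (F i)) :
    IsBdd fun a => ∑ i ∈ s, F i a := by
  classical
  induction s using Finset.induction_on with
  | empty => simpa using const (0 : ℝ)
  | insert i s hi ih =>
    simp only [Finset.sum_insert hi]
    exact (h i (by simp)).add (ih fun j hj => h j (by simp [hj]))

end IsBdd

/-! ### Expectations of bounded functions under discrete distributions -/

section Mean

variable {α β : Type}

theorem summable_toReal (P : PMF α) : Summable fun a => (P a).toReal :=
  ENNReal.summable_toReal P.tsum_coe_ne_top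

theorem tsum_toReal (P : PMF α) : ∑' a, (P a).toReal = 1 := by
  rw [← ENNReal.tsum_toReal_eq (fun a => P.apply_ne_top a), P.tsum_coe]; simp

theorem summable_mean (P : PMF α) {g : α → ℝ} (hg : IsBdd g) :
    Summable fun a => (P a).toReal * g a := by
  obtain ⟨M, hM⟩ := hg
  refine Summable.of_norm_bounded ((summable_toReal P).mul_right M) fun a => ?_
  rw [norm_mul, Real.norm_eq_abs, Real.norm_eq_abs, abs_of_nonneg ENNReal.toReal_nonneg]
  exact mul_le_mul_of_nonneg_left (hM a) ENNReal.toReal_nonneg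

theorem mean_const (P : PMF α) (c : ℝ) : mean P (fun _ => c) = c := by
  rw [mean, tsum_mul_right, tsum_toReal, one_mul]

theorem mean_add (P : PMF α) {f g : α → ℝ} (hf : IsBdd f) (hg : IsBdd g) :
    mean P (fun a => f a + g a) = mean P f + mean P g := by
  simp only [mean, mul_add]
  exact (summable_mean P hf).tsum_add (summable_mean P hg)

theorem mean_const_mul (P : PMF α) (c : ℝ) (f : α → ℝ) :
    mean P (fun a => c * f a) = c * mean P f := by
  rw [mean, mean, ← tsum_mul_left]
  exact tsum_congr fun a => by ring

theorem mean_mul_const (P : PMF α) (c : ℝ) (f : α → ℝ) :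
    mean P (fun a => f a * c) = mean P f * c := by
  simpa [mul_comm] using mean_const_mul P c f

theorem mean_mono (P : PMF α) {f g : α → ℝ} (hf : IsBdd f) (hg : IsBdd g)
    (h : ∀ a, f a ≤ g a) : mean P f ≤ mean P g :=
  (summable_mean P hf).tsum_le_tsum
    (fun a => mul_le_mul_of_nonneg_left (h a) ENNReal.toReal_nonneg) (summable_mean P hg)

theorem mean_nonneg (P : PMF α) {f : α → ℝ} (h : ∀ a, 0 ≤ f a) : 0 ≤ mean P f :=
  tsum_nonneg fun a => mul_nonneg ENNReal.toReal_nonneg (h a)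

theorem mean_le_const (P : PMF α) {f : α → ℝ} (hf : IsBdd f) {c : ℝ} (h : ∀ a, f a ≤ c) :
    mean P f ≤ c :=
  (mean_mono P hf (IsBdd.const c) h).trans_eq (mean_const P c)

theorem abs_mean_le (P : PMF α) {f : α → ℝ} (hf : IsBdd f) :
    |mean P f| ≤ mean P fun a => |f a| := by
  rw [abs_le]
  constructor
  · have := mean_mono P hf.abs.neg hf fun a => neg_abs_le (f a)
    have h2 := mean_const_mul P (-1) fun a => |f a|
    simp only [neg_mul, one_mul] at h2
    linarith
  · exact mean_mono P hf hf.abs fun a => le_abs_self _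

theorem mean_sum (P : PMF α) {ι : Type} (s : Finset ι) {F : ι → α → ℝ}
    (h : ∀ i ∈ s, IsBdd (F i)) :
    mean P (fun a => ∑ i ∈ s, F i a) = ∑ i ∈ s, mean P (F i) := by
  classical
  induction s using Finset.induction_on with
  | empty => simpa using mean_const P 0
  | insert i s hi ih =>
    simp only [Finset.sum_insert hi]
    rw [mean_add P (h i (by simp)) (IsBdd.sum s fun j hj => h j (by simp [hj])),
      ih fun j hj => h j (by simp [hj])]

theorem mean_fintype [Fintype α] (P : PMF α) (f : α → ℝ) :
    mean P f = ∑ a, (P a).toReal * f a := tsum_fintype _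

theorem IsBdd.mean {P : β → PMF α} {g : β → α → ℝ} (hg : ∃ M, ∀ b a, |g b a| ≤ M) :
    IsBdd fun b => mean (P b) (g b) := by
  obtain ⟨M, hM⟩ := hg
  exact ⟨M, fun b => (abs_mean_le _ ⟨M, hM b⟩).trans
    (mean_le_const _ (IsBdd.abs ⟨M, hM b⟩) (hM b))⟩

theorem mean_pure (a : α) (g : α → ℝ) : mean (PMF.pure a) g = g a := by
  classical
  rw [mean, tsum_eq_single a]
  · simp
  · intro b hb
    simp [PMF.pure_apply, hb]

theorem mean_bind (P : PMF α) (f : α → PMF β) {g : β → ℝ} (hg : IsBdd g) :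
    mean (P.bind f) g = mean P fun a => mean (f a) g := by
  obtain ⟨M, hM⟩ := hg
  -- The joint law has total mass one, which gives the absolute summability needed to exchange the
  -- two sums.
  have hs : Summable fun x : α × β => (P x.1).toReal * (f x.1 x.2).toReal := by
    have : ∑' x : α × β, P x.1 * f x.1 x.2 ≠ ⊤ := by
      rw [ENNReal.tsum_prod' (f := fun x : α × β => P x.1 * f x.1 x.2)]
      simp [ENNReal.tsum_mul_left, PMF.tsum_coe]
    simpa [ENNReal.toReal_mul] using ENNReal.summable_toReal this
  have hs2 : Summable (Function.uncurry fun (a : α) (b : β) =>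
      (P a).toReal * (f a b).toReal * g b) := by
    refine Summable.of_norm_bounded (hs.mul_right M) fun x => ?_
    rw [Function.uncurry, norm_mul, Real.norm_eq_abs, Real.norm_eq_abs,
      abs_of_nonneg (by positivity)]
    exact mul_le_mul_of_nonneg_left (hM _) (by positivity)
  have h1 : ∀ b, ((P.bind f) b).toReal * g b
      = ∑' a, (P a).toReal * (f a b).toReal * g b := fun b => by
    rw [PMF.bind_apply, ENNReal.tsum_toReal_eq, tsum_mul_right]
    · simp [ENNReal.toReal_mul]
    · exact fun a => ENNReal.mul_ne_top (P.apply_ne_top a) ((f a).apply_ne_top b)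
  simp only [mean, h1]
  rw [hs2.tsum_comm]
  refine tsum_congr fun a => ?_
  rw [← tsum_mul_left]
  exact tsum_congr fun b => by ring

theorem mean_map (P : PMF α) (f : α → β) {g : β → ℝ} (hg : IsBdd g) :
    mean (P.map f) g = mean P fun a => g (f a) := by
  rw [PMF.map, mean_bind _ _ hg]
  simp [mean_pure]

theorem prob_eq_mean (P : PMF α) (A : Set α) [DecidablePred (· ∈ A)] :
    prob P A = mean P fun a => if a ∈ A then 1 else 0 := by
  rw [prob, PMF.toOuterMeasure_apply, ENNReal.tsum_toReal_eq, mean]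
  · refine tsum_congr fun a => ?_
    by_cases h : a ∈ A <;> simp [h]
  · intro a
    exact ne_top_of_le_ne_top (P.apply_ne_top a) (Set.indicator_le_self A P a)

theorem toReal_apply_eq_mean [DecidableEq α] (P : PMF α) (x : α) :
    (P x).toReal = mean P fun a => if a = x then 1 else 0 := by
  rw [mean, tsum_eq_single x]
  · simp
  · intro b hb
    simp [hb]

end Mean

/-! ### Sums of coins -/

/-- The binomial weight: the probability of `k` successes among `n` independent trials. -/
def binWeight (p : ℝ) (n k : ℕ) : ℝ := n.choose k * p ^ k * (1 - p) ^ (n - k)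

theorem binWeight_nonneg {p : ℝ} (h0 : 0 ≤ p) (h1 : p ≤ 1) (n k : ℕ) : 0 ≤ binWeight p n k :=
  mul_nonneg (mul_nonneg (Nat.cast_nonneg _) (pow_nonneg h0 _)) (pow_nonneg (by linarith) _)

theorem binWeight_of_lt {p : ℝ} {n k : ℕ} (h : n < k) : binWeight p n k = 0 := by
  simp [binWeight, Nat.choose_eq_zero_of_lt h]

theorem sum_binWeight (p : ℝ) (n : ℕ) : ∑ k ∈ Finset.range (n + 1), binWeight p n k = 1 := by
  have := add_pow p (1 - p) n
  rw [add_sub_cancel, one_pow] at this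
  rw [this]
  exact Finset.sum_congr rfl fun k _ => by rw [binWeight]; ring

/-- Conditioning on one of the trials, that is, Pascal's rule. The moment and exponential moment
computations are inductions on this recursion. -/
theorem sum_binWeight_succ (p : ℝ) (n : ℕ) (G : ℕ → ℝ) :
    ∑ k ∈ Finset.range (n + 2), binWeight p (n + 1) k * G k
      = ∑ k ∈ Finset.range (n + 1), binWeight p n k * (p * G (k + 1) + (1 - p) * G k) := by
  have h : ∀ k, binWeight p (n + 1) (k + 1) = p * binWeight p n k + (1 - p) * binWeight p n (k + 1) := by
    intro k
    rcases lt_or_ge k n with hk | hk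
    · obtain ⟨d, rfl⟩ : ∃ d, n = k + 1 + d := ⟨n - (k + 1), by omega⟩
      simp only [binWeight, Nat.choose_succ_succ, Nat.cast_add]
      rw [show k + 1 + d + 1 - (k + 1) = d + 1 by omega, show k + 1 + d - k = d + 1 by omega,
        show k + 1 + d - (k + 1) = d by omega]
      ring
    · rw [binWeight_of_lt (show n < k + 1 by omega)]
      simp only [binWeight, Nat.choose_succ_succ, Nat.cast_add,
        Nat.choose_eq_zero_of_lt (show n < k + 1 by omega)]
      rw [show n + 1 - (k + 1) = n - k by omega]
      push_cast
      ring
  have h0 : binWeight p (n + 1) 0 = (1 - p) * binWeight p n 0 := by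
    simp [binWeight, pow_succ']
  rw [Finset.sum_range_succ']
  simp only [h, h0, mul_add, add_mul, Finset.sum_add_distrib]
  have h3 : ∑ k ∈ Finset.range (n + 1), (1 - p) * binWeight p n (k + 1) * G (k + 1)
      + (1 - p) * binWeight p n 0 * G 0
      = ∑ k ∈ Finset.range (n + 1), binWeight p n k * ((1 - p) * G k) := by
    rw [← Finset.sum_range_succ' (fun k => (1 - p) * binWeight p n k * G k),
      Finset.sum_range_succ, binWeight_of_lt (Nat.lt_succ_self n)]
    simp only [mul_zero, zero_mul, add_zero]
    exact Finset.sum_congr rfl fun k _ => by ring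
  rw [add_assoc, h3]
  congr 1
  exact Finset.sum_congr rfl fun k _ => by ring

/-- The success probability of a `±1` coin of bias `ε`. -/
def headProb (ε : Set.Icc (-1 : ℝ) 1) : ℝ := (1 + ε) / 2

theorem headProb_nonneg (ε : Set.Icc (-1 : ℝ) 1) : 0 ≤ headProb ε := by
  have := ε.2.1
  rw [headProb]; linarith

theorem headProb_le_one (ε : Set.Icc (-1 : ℝ) 1) : headProb ε ≤ 1 := by
  have := ε.2.2
  rw [headProb]; linarith

theorem mean_coin (ε : Set.Icc (-1 : ℝ) 1) {g : ℤ → ℝ} (hg : IsBdd g) :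
    mean (coin ε) g = headProb ε * g 1 + (1 - headProb ε) * g (-1) := by
  have h1 : (0 : ℝ) ≤ (1 + ε) / 2 := by linarith [ε.2.1]
  have h2 : (0 : ℝ) ≤ (1 - ε) / 2 := by linarith [ε.2.2]
  rw [coin, mean_map _ _ hg, mean_fintype, Fintype.sum_bool]
  simp only [PMF.ofFintype_apply, if_true, Bool.false_eq_true, if_false,
    ENNReal.toReal_ofReal h1, ENNReal.toReal_ofReal h2, headProb]
  ring

theorem mean_coinSum (ε : Set.Icc (-1 : ℝ) 1) (n : ℕ) {g : ℤ → ℝ} (hg : IsBdd g) :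
    mean (coinSum ε n) g
      = ∑ k ∈ Finset.range (n + 1), binWeight (headProb ε) n k * g (2 * k - n) := by
  induction n generalizing g with
  | zero => simp [coinSum, mean_pure, binWeight]
  | succ n ih =>
    rw [coinSum, mean_bind _ _ hg]
    have h : ∀ s : ℤ, mean ((coin ε).map fun x => s + x) g
        = headProb ε * g (s + 1) + (1 - headProb ε) * g (s - 1) := fun s => by
      rw [mean_map _ _ hg, mean_coin _ (hg.comp fun x => s + x)]
      rfl
    simp only [h]
    rw [ih (((hg.comp fun s => s + 1).const_mul _).add ((hg.comp fun s => s - 1).const_mul _)),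
      sum_binWeight_succ]
    refine Finset.sum_congr rfl fun k _ => ?_
    rw [show (2 * (k : ℤ) - n + 1) = 2 * ((k + 1 : ℕ) : ℤ) - ((n + 1 : ℕ) : ℤ) by push_cast; ring,
      show (2 * (k : ℤ) - n - 1) = 2 * (k : ℤ) - ((n + 1 : ℕ) : ℤ) by push_cast; ring]

theorem mean_coinSum_add (ε : Set.Icc (-1 : ℝ) 1) (a b : ℕ) {g : ℤ → ℝ} (hg : IsBdd g) :
    mean (coinSum ε (a + b)) g = mean (coinSum ε a) fun x => mean (coinSum ε b) fun y => g (x + y) := by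
  induction b generalizing g with
  | zero => simp [coinSum, mean_pure]
  | succ b ih =>
    have h : ∀ s : ℤ, ∀ n : ℕ, mean (coinSum ε (n + 1)) (fun x => g (s + x))
        = mean (coinSum ε n) fun x => mean (coin ε) fun y => g (s + x + y) := fun s n => by
      rw [coinSum, mean_bind _ _ (hg.comp fun x => s + x)]
      congr 1
      funext x
      rw [mean_map _ _ (hg.comp fun x => s + x)]
      simp only [add_assoc]
    have h0 := h 0 (a + b)
    simp only [zero_add] at h0
    have hb : IsBdd fun x : ℤ => mean (coin ε) fun y => g (x + y) := by
      obtain ⟨M, hM⟩ := hg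
      exact IsBdd.mean ⟨M, fun _ _ => hM _⟩
    rw [← add_assoc, h0, ih hb]
    simp only [h]

/-! ### Moments of binomial weights -/

theorem sum_binWeight_mul_sub (p : ℝ) (n : ℕ) :
    ∑ k ∈ Finset.range (n + 1), binWeight p n k * (k - n * p) = 0 := by
  induction n with
  | zero => simp [binWeight]
  | succ n ih =>
    rw [sum_binWeight_succ p n fun k => (k : ℝ) - (n + 1 : ℕ) * p, ← ih]
    refine Finset.sum_congr rfl fun k _ => ?_
    push_cast
    ring

theorem sum_binWeight_mul_sub_sq (p : ℝ) (n : ℕ) :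
    ∑ k ∈ Finset.range (n + 1), binWeight p n k * (k - n * p) ^ 2 = n * p * (1 - p) := by
  induction n with
  | zero => simp [binWeight]
  | succ n ih =>
    rw [sum_binWeight_succ p n fun k => ((k : ℝ) - (n + 1 : ℕ) * p) ^ 2]
    have : ∀ k : ℕ, binWeight p n k * (p * (((k + 1 : ℕ) : ℝ) - (n + 1 : ℕ) * p) ^ 2
        + (1 - p) * ((k : ℝ) - (n + 1 : ℕ) * p) ^ 2)
        = binWeight p n k * (k - n * p) ^ 2 + binWeight p n k * (p * (1 - p)) := fun k => by
      push_cast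
      ring
    simp only [this, Finset.sum_add_distrib]
    rw [ih, ← Finset.sum_mul, sum_binWeight]
    push_cast
    ring

/-- The linear term disappears in the mean of a centred variable, which leaves a sub-Gaussian bound.
-/
theorem exp_le_add_exp_sq (x : ℝ) : Real.exp x ≤ x + Real.exp (x ^ 2) := by
  have h2 := Real.add_one_le_exp (x ^ 2)
  rcases le_or_gt |x| 1 with h | h
  · have := (abs_le.1 (Real.abs_exp_sub_one_sub_id_le h)).2
    linarith
  · rcases lt_abs.1 h with h | h
    · have : Real.exp x ≤ Real.exp (x ^ 2) := Real.exp_le_exp.2 (by nlinarith)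
      linarith
    · have : Real.exp x ≤ 1 := Real.exp_le_one_iff.2 (by linarith)
      nlinarith

theorem coin_exp_le {p : ℝ} (h0 : 0 ≤ p) (h1 : p ≤ 1) (s : ℝ) :
    p * Real.exp (2 * s * (1 - p)) + (1 - p) * Real.exp (2 * s * (-p)) ≤ Real.exp (4 * s ^ 2) := by
  have a1 := exp_le_add_exp_sq (2 * s * (1 - p))
  have a2 := exp_le_add_exp_sq (2 * s * (-p))
  have b1 : Real.exp ((2 * s * (1 - p)) ^ 2) ≤ Real.exp (4 * s ^ 2) :=
    Real.exp_le_exp.2 (by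
      have : (1 - p) ^ 2 ≤ 1 := by nlinarith
      nlinarith [sq_nonneg s, mul_nonneg (sq_nonneg s) (sub_nonneg.2 this)])
  have b2 : Real.exp ((2 * s * (-p)) ^ 2) ≤ Real.exp (4 * s ^ 2) :=
    Real.exp_le_exp.2 (by
      have : p ^ 2 ≤ 1 := by nlinarith
      nlinarith [sq_nonneg s, mul_nonneg (sq_nonneg s) (sub_nonneg.2 this)])
  have c1 := mul_le_mul_of_nonneg_left (a1.trans (add_le_add_right b1 _)) h0
  have c2 := mul_le_mul_of_nonneg_left (a2.trans (add_le_add_right b2 _)) (sub_nonneg.2 h1)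
  nlinarith

theorem sum_binWeight_mul_exp_le {p : ℝ} (h0 : 0 ≤ p) (h1 : p ≤ 1) (s : ℝ) (n : ℕ) :
    ∑ k ∈ Finset.range (n + 1), binWeight p n k * Real.exp (2 * s * (k - n * p))
      ≤ Real.exp (4 * s ^ 2 * n) := by
  induction n with
  | zero => simp [binWeight]
  | succ n ih =>
    rw [sum_binWeight_succ p n fun k => Real.exp (2 * s * ((k : ℝ) - (n + 1 : ℕ) * p))]
    have h : ∀ k : ℕ, binWeight p n k * (p * Real.exp (2 * s * (((k + 1 : ℕ) : ℝ) - (n + 1 : ℕ) * p))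
        + (1 - p) * Real.exp (2 * s * ((k : ℝ) - (n + 1 : ℕ) * p)))
        = binWeight p n k * Real.exp (2 * s * (k - n * p))
          * (p * Real.exp (2 * s * (1 - p)) + (1 - p) * Real.exp (2 * s * (-p))) := fun k => by
      rw [show 2 * s * (((k + 1 : ℕ) : ℝ) - (n + 1 : ℕ) * p)
          = 2 * s * (k - n * p) + 2 * s * (1 - p) by push_cast; ring,
        show 2 * s * ((k : ℝ) - (n + 1 : ℕ) * p)
          = 2 * s * (k - n * p) + 2 * s * (-p) by push_cast; ring, Real.exp_add, Real.exp_add]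
      ring
    simp only [h]
    rw [← Finset.sum_mul, show 4 * s ^ 2 * ((n + 1 : ℕ) : ℝ) = 4 * s ^ 2 * n + 4 * s ^ 2 by
      push_cast; ring, Real.exp_add]
    refine mul_le_mul ih (coin_exp_le h0 h1 s) ?_ (Real.exp_nonneg _)
    have := sub_nonneg.2 h1
    positivity

theorem sum_binWeight_tail_le {p : ℝ} (h0 : 0 ≤ p) (h1 : p ≤ 1) {n : ℕ} {V t : ℝ} (hV : 0 < V)
    (hn : n ≤ V) (ht : 0 ≤ t) :
    ∑ k ∈ Finset.range (n + 1), binWeight p n k * (if t ≤ |2 * ((k : ℝ) - n * p)| then 1 else 0)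
      ≤ 2 * Real.exp (-(t ^ 2 / (16 * V))) := by
  -- The minimizer of the Chernoff exponent 4s²V - st.
  set s := t / (8 * V) with hs
  have hs0 : 0 ≤ s := by positivity
  have key : ∀ k : ℕ, (if t ≤ |2 * ((k : ℝ) - n * p)| then (1 : ℝ) else 0)
      ≤ (Real.exp (2 * s * (k - n * p)) + Real.exp (2 * (-s) * (k - n * p)))
        * Real.exp (-(s * t)) := fun k => by
    split_ifs with h
    · rw [add_mul, ← Real.exp_add, ← Real.exp_add]
      rcases le_abs.1 h with h | h
      · have : 1 ≤ Real.exp (2 * s * (k - n * p) + -(s * t)) :=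
          Real.one_le_exp (by nlinarith)
        linarith [Real.exp_nonneg (2 * (-s) * (k - n * p) + -(s * t))]
      · have : 1 ≤ Real.exp (2 * (-s) * (k - n * p) + -(s * t)) :=
          Real.one_le_exp (by nlinarith)
        linarith [Real.exp_nonneg (2 * s * (k - n * p) + -(s * t))]
    · positivity
  have e1 := sum_binWeight_mul_exp_le h0 h1 s n
  have e2 := sum_binWeight_mul_exp_le h0 h1 (-s) n
  have e3 : Real.exp (4 * s ^ 2 * n) ≤ Real.exp (4 * s ^ 2 * V) :=
    Real.exp_le_exp.2 (mul_le_mul_of_nonneg_left hn (by positivity))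
  rw [neg_sq] at e2
  calc _ ≤ ∑ k ∈ Finset.range (n + 1), binWeight p n k *
        ((Real.exp (2 * s * (k - n * p)) + Real.exp (2 * (-s) * (k - n * p)))
        * Real.exp (-(s * t))) :=
        Finset.sum_le_sum fun k _ =>
          mul_le_mul_of_nonneg_left (key k) (binWeight_nonneg h0 h1 n k)
    _ = (∑ k ∈ Finset.range (n + 1), binWeight p n k * Real.exp (2 * s * (k - n * p))
        + ∑ k ∈ Finset.range (n + 1), binWeight p n k * Real.exp (2 * (-s) * (k - n * p)))
        * Real.exp (-(s * t)) := by
        rw [← Finset.sum_add_distrib, Finset.sum_mul]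
        exact Finset.sum_congr rfl fun k _ => by ring
    _ ≤ (2 * Real.exp (4 * s ^ 2 * V)) * Real.exp (-(s * t)) :=
        mul_le_mul_of_nonneg_right (by linarith) (Real.exp_nonneg _)
    _ = 2 * Real.exp (-(t ^ 2 / (16 * V))) := by
        rw [mul_assoc, ← Real.exp_add]
        congr 2
        rw [hs]
        field_simp
        ring

theorem sum_binWeight_mul_shift_sq {p : ℝ} (n : ℕ) (s : ℝ) :
    ∑ k ∈ Finset.range (n + 1), binWeight p n k * (s + (2 * k - n)) ^ 2
      = (s + (2 * p - 1) * n) ^ 2 + 4 * (n * p * (1 - p)) := by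
  have : ∀ k : ℕ, binWeight p n k * (s + (2 * k - n)) ^ 2
      = 4 * (binWeight p n k * (k - n * p) ^ 2)
        + 4 * (s + (2 * p - 1) * n) * (binWeight p n k * (k - n * p))
        + (s + (2 * p - 1) * n) ^ 2 * binWeight p n k := fun k => by ring
  simp only [this, Finset.sum_add_distrib, ← Finset.mul_sum, sum_binWeight,
    sum_binWeight_mul_sub, sum_binWeight_mul_sub_sq]
  ring

/-- Here x ^ (-β) = exp (-β log x), a convex increasing function of a convex one. -/
theorem convexOn_rpow_neg {β : ℝ} (hβ : 0 ≤ β) :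
    ConvexOn ℝ (Set.Ioi 0) fun x : ℝ => x ^ (-β) := by
  refine ⟨convex_Ioi 0, fun x hx y hy a b ha hb hab => ?_⟩
  have hx' : 0 < x := hx
  have hy' : 0 < y := hy
  have hxy : 0 < a • x + b • y := (convex_Ioi (0 : ℝ)) hx hy ha hb hab
  have hlog := strictConcaveOn_log_Ioi.concaveOn.2 hx hy ha hb hab
  have hexp := convexOn_exp.2 (Set.mem_univ (Real.log x * -β)) (Set.mem_univ (Real.log y * -β))
    ha hb hab
  simp only [smul_eq_mul] at *
  rw [Real.rpow_def_of_pos hx', Real.rpow_def_of_pos hy', Real.rpow_def_of_pos hxy]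
  refine le_trans (Real.exp_le_exp.2 ?_) hexp
  nlinarith

/-- Jensen's inequality for a negative power of `1 + y ^ 2` under a shifted binomial law. -/
theorem rpow_le_sum_binWeight {p : ℝ} (h0 : 0 ≤ p) (h1 : p ≤ 1) {β : ℝ} (hβ : 0 ≤ β) (n : ℕ)
    (s : ℝ) : (1 + (s + (2 * p - 1) * n) ^ 2 + n) ^ (-β)
      ≤ ∑ k ∈ Finset.range (n + 1), binWeight p n k * (1 + (s + (2 * k - n)) ^ 2) ^ (-β) := by
  have hJ := (convexOn_rpow_neg hβ).map_sum_le (t := Finset.range (n + 1))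
    (w := binWeight p n) (p := fun k : ℕ => 1 + (s + (2 * (k : ℝ) - n)) ^ 2)
    (fun k _ => binWeight_nonneg h0 h1 n k) (sum_binWeight p n)
    (fun k _ => by show (0 : ℝ) < _; positivity)
  simp only [smul_eq_mul] at hJ
  refine le_trans ?_ hJ
  have : ∑ k ∈ Finset.range (n + 1), binWeight p n k * (1 + (s + (2 * (k : ℝ) - n)) ^ 2)
      = 1 + ((s + (2 * p - 1) * n) ^ 2 + 4 * (n * p * (1 - p))) := by
    simp only [mul_add, mul_one, Finset.sum_add_distrib, sum_binWeight]
    rw [← sum_binWeight_mul_shift_sq]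
  rw [this]
  -- The variance satisfies 4np(1-p) ≤ n, and the negative power is decreasing.
  have hp : 0 ≤ p * (1 - p) := mul_nonneg h0 (by linarith)
  have hn : (0 : ℝ) ≤ n := Nat.cast_nonneg n
  refine Real.rpow_le_rpow_of_nonpos ?_ ?_ (by linarith)
  · have : 0 ≤ (n : ℝ) * p * (1 - p) := by rw [mul_assoc]; exact mul_nonneg hn hp
    nlinarith [sq_nonneg (s + (2 * p - 1) * n)]
  · nlinarith [sq_nonneg (2 * p - 1), mul_nonneg hn (sq_nonneg (2 * p - 1))]

/-! ### Bell-shaped sequences -/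

/-- A probability vector on `{0, …, n}` whose consecutive ratios behave like those of a binomial
distribution with mean `k₀` and variance of order `n`. -/
structure Bell (f : ℕ → ℝ) (n : ℕ) (k₀ K : ℝ) : Prop where
  pos : 0 < n
  center_nonneg : 0 ≤ k₀
  center_le : k₀ ≤ n
  const_pos : 0 < K
  nonneg : ∀ k, 0 ≤ f k
  zero : ∀ k, n < k → f k = 0
  sum_one : ∑ k ∈ Finset.range (n + 1), f k = 1
  up : ∀ k : ℕ, (k : ℝ) + 1 ≤ k₀ → f k ≤ f (k + 1)
  down : ∀ k : ℕ, k₀ ≤ k → f (k + 1) ≤ (1 - (k - k₀) / n) * f k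
  slow : ∀ k : ℕ, k₀ - 1 ≤ k → (1 - K * (k - k₀ + 2) / n) * f k ≤ f (k + 1)

/-- The probability that `2 k - n` is at least `y`, where `k` has distribution `f`. -/
def tailSum (f : ℕ → ℝ) (n : ℕ) (y : ℤ) : ℝ :=
  ∑ k ∈ Finset.range (n + 1), if y ≤ 2 * (k : ℤ) - n then f k else 0

namespace Bell

variable {f : ℕ → ℝ} {n : ℕ} {k₀ K : ℝ}

theorem sum_le_one (h : Bell f n k₀ K) {s : Finset ℕ} (hs : ∀ k ∈ s, k ≤ n) :
    ∑ k ∈ s, f k ≤ 1 := by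
  rw [← h.sum_one]
  exact Finset.sum_le_sum_of_subset_of_nonneg
    (fun k hk => Finset.mem_range.2 (Nat.lt_succ_of_le (hs k hk))) fun k _ _ => h.nonneg k

theorem le_one (h : Bell f n k₀ K) (k : ℕ) : f k ≤ 1 := by
  rcases le_or_gt k n with hk | hk
  · simpa using h.sum_le_one (s := {k}) (by simpa using hk)
  · rw [h.zero k hk]; exact zero_le_one

theorem succ_le (h : Bell f n k₀ K) {k : ℕ} (hk : k₀ ≤ k) : f (k + 1) ≤ f k := by
  refine (h.down k hk).trans ?_
  have : 0 ≤ ((k : ℝ) - k₀) / n := div_nonneg (by linarith) (Nat.cast_nonneg n)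
  nlinarith [h.nonneg k]

/-- To the right of the centre the sequence decreases, so the values at the roughly k - k₀ points
from the centre to k are all at least f k, and they sum to at most one. -/
theorem mul_sub_le (h : Bell f n k₀ K) (k : ℕ) : f k * (k - k₀) ≤ 1 := by
  rcases le_or_gt (k : ℝ) k₀ with hk | hk
  · nlinarith [h.nonneg k]
  rcases lt_or_ge n k with hn | hn
  · rw [h.zero k hn]; simp
  have hmono : ∀ j ∈ Finset.Icc ⌈k₀⌉₊ k, f k ≤ f j := by
    intro j hj
    obtain ⟨h1, h2⟩ := Finset.mem_Icc.1 hj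
    have h1' : k₀ ≤ j := (Nat.le_ceil k₀).trans (by exact_mod_cast h1)
    induction k, h2 using Nat.le_induction with
    | base => exact le_rfl
    | succ i hi ih =>
      have hji : (j : ℝ) ≤ i := by exact_mod_cast hi
      rcases eq_or_lt_of_le (h1'.trans hji) with he | hl
      · exact (h.succ_le he.le).trans
          (by
            have : j = i := by
              have : (i : ℝ) ≤ j := by linarith
              exact le_antisymm hi (by exact_mod_cast this)
            rw [this])
      · exact (h.succ_le hl.le).trans
          (ih hl (by omega) (Finset.mem_Icc.2 ⟨h1, hi⟩))
  have hs := (Finset.card_nsmul_le_sum _ _ _ hmono).trans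
    (h.sum_le_one fun j hj => (Finset.mem_Icc.1 hj).2.trans hn)
  rw [nsmul_eq_mul, Nat.card_Icc] at hs
  have hc := Nat.ceil_lt_add_one h.center_nonneg
  have hck : ⌈k₀⌉₊ ≤ k := Nat.ceil_le.2 hk.le
  rw [Nat.cast_sub (by omega)] at hs
  push_cast at hs
  nlinarith [h.nonneg k]

theorem mul_sub_le' (h : Bell f n k₀ K) (k : ℕ) : f k * (k₀ - k) ≤ 1 := by
  rcases le_or_gt k₀ (k : ℝ) with hk | hk
  · nlinarith [h.nonneg k]
  have hkf : k ≤ ⌊k₀⌋₊ := Nat.le_floor hk.le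
  have hfn : ⌊k₀⌋₊ ≤ n := Nat.floor_le_of_le h.center_le
  have hmono : ∀ j ∈ Finset.Icc k ⌊k₀⌋₊, f k ≤ f j := by
    intro j hj
    obtain ⟨h1, h2⟩ := Finset.mem_Icc.1 hj
    have h2' : (j : ℝ) ≤ k₀ := (Nat.cast_le.2 h2).trans (Nat.floor_le h.center_nonneg)
    clear h2 hj
    induction j, h1 using Nat.le_induction with
    | base => exact le_rfl
    | succ i hi ih =>
      push_cast at h2'
      exact (ih (by linarith)).trans (h.up i h2')
  have hs := (Finset.card_nsmul_le_sum _ _ _ hmono).trans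
    (h.sum_le_one fun j hj => (Finset.mem_Icc.1 hj).2.trans hfn)
  rw [nsmul_eq_mul, Nat.card_Icc, Nat.cast_sub (by omega)] at hs
  have hc := Nat.lt_floor_add_one k₀
  push_cast at hs
  nlinarith [h.nonneg k]

theorem mul_abs_sub_le (h : Bell f n k₀ K) (k : ℕ) : f k * |k - k₀| ≤ 1 := by
  rcases abs_cases ((k : ℝ) - k₀) with ⟨e, _⟩ | ⟨e, _⟩ <;> rw [e]
  · exact h.mul_sub_le k
  · have := h.mul_sub_le' k
    rwa [neg_sub]

/-- The hazard rate is at most `2 / J` in the range where the ratios are at least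
`1 - 1 / (2 J)`. -/
theorem mul_le_two_mul_sum (h : Bell f n k₀ K) {T : ℝ} {J : ℕ} (hT : 0 ≤ T)
    (hJ : K * (T + J + 2) * J ≤ n / 2) {k : ℕ} (hk : k ≤ k₀ + T) :
    J * f k ≤ 2 * ∑ j ∈ Finset.range (n + 1), if k ≤ j then f j else 0 := by
  have hn : (0 : ℝ) < n := by exact_mod_cast h.pos
  have hK := h.const_pos
  set ρ := K * (T + J + 2) / n with hρ
  have hρ0 : 0 ≤ ρ := by positivity
  have hJρ : J * ρ ≤ 1 / 2 := by
    rw [hρ, mul_div_assoc', div_le_iff₀ hn]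
    linarith
  -- Bernoulli's inequality for a product of ratios, each at least 1 - ρ: below the centre the
  -- sequence increases, above it `slow` applies.
  have hstep : ∀ i : ℕ, i ≤ J → (1 - i * ρ) * f k ≤ f (k + i) := by
    intro i
    induction i with
    | zero => simp
    | succ i ih =>
      intro hi
      have hi' : (i : ℝ) + 1 ≤ J := by exact_mod_cast hi
      have hρ1 : ρ ≤ 1 / 2 := by nlinarith [Nat.cast_nonneg (α := ℝ) i]
      have h1 : (1 - ρ) * f (k + i) ≤ f (k + i + 1) := by
        rcases le_or_gt (((k + i : ℕ) : ℝ) + 1) k₀ with hc | hc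
        · exact le_trans (by nlinarith [h.nonneg (k + i)]) (h.up _ hc)
        · refine le_trans (mul_le_mul_of_nonneg_right ?_ (h.nonneg _))
            (h.slow (k + i) (by linarith))
          rw [hρ]
          push_cast
          have : K * ((k : ℝ) + i - k₀ + 2) / n ≤ K * (T + J + 2) / n := by
            gcongr
            linarith
          linarith
      have h2 := mul_le_mul_of_nonneg_left (ih (by omega)) (show 0 ≤ 1 - ρ by linarith)
      have h3 := mul_nonneg (mul_nonneg (Nat.cast_nonneg (α := ℝ) i) (mul_nonneg hρ0 hρ0))
        (h.nonneg k)
      rw [← add_assoc]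
      push_cast
      nlinarith
  -- Since Jρ ≤ 1/2, the tail from k contains J terms that are at least half of f k.
  have hhalf : ∀ i ∈ Finset.range J, f k / 2 ≤ f (k + i) := by
    intro i hi
    have hi' := (Finset.mem_range.1 hi).le
    have : (i : ℝ) ≤ J := by exact_mod_cast hi'
    refine le_trans ?_ (hstep i hi')
    nlinarith [h.nonneg k, mul_le_mul_of_nonneg_right this hρ0]
  have hsum := Finset.card_nsmul_le_sum _ _ _ hhalf
  rw [nsmul_eq_mul, Finset.card_range] at hsum
  have hsub : ∑ i ∈ Finset.range J, f (k + i)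
      ≤ ∑ j ∈ Finset.range (n + 1), if k ≤ j then f j else 0 := by
    rw [← Finset.sum_filter, ← Finset.sum_image (f := f) (s := Finset.range J) (g := fun i => k + i)
      (by intro a _ b _ hab; simpa using hab),
      ← Finset.sum_filter_add_sum_filter_not _ (fun j => j ≤ n)]
    have hz : ∑ j ∈ ((Finset.range J).image fun i => k + i) with ¬ j ≤ n, f j = 0 :=
      Finset.sum_eq_zero fun j hj => h.zero j (by simpa using (Finset.mem_filter.1 hj).2)
    rw [hz, add_zero]
    refine Finset.sum_le_sum_of_subset_of_nonneg ?_ fun j _ _ => h.nonneg j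
    intro j hj
    simp only [Finset.mem_filter, Finset.mem_image, Finset.mem_range] at hj ⊢
    omega
  linarith

/-- Beyond k₀ + T/2 every ratio is at most 1 - T/(2n) ≤ exp(-T/(2n)), and at least T/4 steps
separate that point from k. -/
theorem le_exp (h : Bell f n k₀ K) {T : ℝ} (hT : 4 ≤ T) {k : ℕ} (hk : k₀ + T ≤ k) :
    f k ≤ Real.exp (-(T ^ 2 / (8 * n))) := by
  have hn : (0 : ℝ) < n := by exact_mod_cast h.pos
  set j := ⌈k₀ + T / 2⌉₊ with hj
  have hj1 : k₀ + T / 2 ≤ j := Nat.le_ceil _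
  have hj2 : (j : ℝ) < k₀ + T / 2 + 1 :=
    Nat.ceil_lt_add_one (by linarith [h.center_nonneg])
  have hi : ∀ i : ℕ, f (j + i) ≤ Real.exp (-(i * (T / (2 * n)))) := by
    intro i
    induction i with
    | zero => simpa using h.le_one j
    | succ i ih =>
      rw [← add_assoc]
      refine (h.down (j + i) (by push_cast; linarith [Nat.cast_nonneg (α := ℝ) i])).trans ?_
      have h1 : 1 - (((j + i : ℕ) : ℝ) - k₀) / n ≤ Real.exp (-(T / (2 * n))) := by
        refine le_trans ?_ (Real.one_sub_le_exp_neg _)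
        have : T / (2 * n) ≤ (((j + i : ℕ) : ℝ) - k₀) / n := by
          rw [div_le_div_iff₀ (by positivity) hn]
          push_cast
          nlinarith [Nat.cast_nonneg (α := ℝ) i]
        linarith
      calc _ ≤ Real.exp (-(T / (2 * n))) * Real.exp (-(i * (T / (2 * n)))) :=
            mul_le_mul h1 ih (h.nonneg _) (Real.exp_nonneg _)
        _ = _ := by rw [← Real.exp_add]; congr 1; push_cast; ring
  have hjk : j ≤ k := by
    have : (j : ℝ) ≤ k := by linarith
    exact_mod_cast this
  have := hi (k - j)
  rw [Nat.add_sub_cancel' hjk, Nat.cast_sub hjk] at this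
  refine this.trans (Real.exp_le_exp.2 (neg_le_neg ?_))
  -- Rounding j up costs at most 1 ≤ T/4; this is where 4 ≤ T is needed.
  have h4 : T / 4 ≤ (k : ℝ) - j := by linarith
  calc T ^ 2 / (8 * n) = T / 4 * (T / (2 * n)) := by field_simp; ring
    _ ≤ _ := mul_le_mul_of_nonneg_right h4 (by positivity)

theorem tailSum_le_exp (h : Bell f n k₀ K) {T : ℝ} (hT : 4 ≤ T) {y : ℤ}
    (hy : 2 * (k₀ + T) - n ≤ y) :
    tailSum f n y ≤ (n + 1) * Real.exp (-(T ^ 2 / (8 * n))) := by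
  have : ∀ k ∈ Finset.range (n + 1),
      (if y ≤ 2 * (k : ℤ) - n then f k else 0) ≤ Real.exp (-(T ^ 2 / (8 * n))) := by
    intro k _
    split_ifs with hk
    · refine h.le_exp hT ?_
      have : (y : ℝ) ≤ 2 * k - n := by exact_mod_cast hk
      linarith
    · positivity
  have := Finset.sum_le_card_nsmul _ _ _ this
  rw [nsmul_eq_mul, Finset.card_range, Nat.cast_succ] at this
  exact this

/-- All probabilities are at most of order `1 / √n`. -/
theorem mul_le_two (h : Bell f n k₀ K) {J : ℕ} (hJ : K * (J + J + 2) * J ≤ n / 2) (k : ℕ) :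
    J * f k ≤ 2 := by
  -- Up to J above the centre the hazard bound applies and the tail is at most one; farther out
  -- `mul_sub_le` suffices.
  rcases le_or_gt (k : ℝ) (k₀ + J) with hk | hk
  · refine (h.mul_le_two_mul_sum (Nat.cast_nonneg J) hJ hk).trans ?_
    rw [← Finset.sum_filter]
    have := h.sum_le_one (s := (Finset.range (n + 1)).filter fun j => k ≤ j)
      (by simp; omega)
    linarith
  · have := h.mul_sub_le k
    nlinarith [h.nonneg k]

end Bell

section TailSum

variable {f : ℕ → ℝ} {n : ℕ}

theorem tailSum_anti (hf : ∀ k, 0 ≤ f k) {y z : ℤ} (h : y ≤ z) : tailSum f n z ≤ tailSum f n y := by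
  refine Finset.sum_le_sum fun k _ => ?_
  have := hf k
  split_ifs <;> first | omega | simp_all

theorem tailSum_nonneg (hf : ∀ k, 0 ≤ f k) (y : ℤ) : 0 ≤ tailSum f n y :=
  Finset.sum_nonneg fun k _ => by have := hf k; split_ifs <;> simp_all

theorem tailSum_le_one (hf : ∀ k, 0 ≤ f k) (h1 : ∑ k ∈ Finset.range (n + 1), f k = 1) (y : ℤ) :
    tailSum f n y ≤ 1 := by
  rw [← h1]
  refine Finset.sum_le_sum fun k _ => ?_
  have := hf k
  split_ifs <;> simp_all

/-- Moving the threshold by one loses a single atom, or nothing when z has the wrong parity or is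
out of range. -/
theorem tailSum_sub_succ_le {z : ℤ} {c : ℝ} (hc : 0 ≤ c)
    (h : ∀ k : ℕ, k ≤ n → 2 * (k : ℤ) - n = z → f k ≤ c) :
    tailSum f n z - tailSum f n (z + 1) ≤ c := by
  rw [tailSum, tailSum, ← Finset.sum_sub_distrib]
  by_cases hz : ∃ k : ℕ, k ≤ n ∧ 2 * (k : ℤ) - n = z
  · obtain ⟨k, hk, hkz⟩ := hz
    rw [Finset.sum_eq_single_of_mem k (Finset.mem_range.2 (by omega))]
    · rw [if_pos (by omega), if_neg (by omega), sub_zero]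
      exact h k hk hkz
    · intro j _ hj
      split_ifs <;> first | omega | simp
  · push Not at hz
    rw [Finset.sum_eq_zero]
    · exact hc
    · intro j hj
      have := hz j (by simpa [Nat.lt_succ_iff] using hj)
      split_ifs <;> first | omega | simp

theorem tailSum_sub_le {y : ℤ} {c : ℝ} (d : ℕ)
    (h : ∀ i : ℕ, i < d → tailSum f n (y + i) - tailSum f n (y + i + 1) ≤ c) :
    tailSum f n y - tailSum f n (y + d) ≤ d * c := by
  induction d with
  | zero => simp
  | succ d ih =>
    have h1 := ih fun i hi => h i (by omega)
    have h2 := h d (by omega)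
    push_cast
    rw [← add_assoc]
    linarith

/-- The tail sums are Lipschitz where the probabilities are small. -/
theorem abs_tailSum_sub_le (hf : ∀ k, 0 ≤ f k) {c : ℝ} (hc : 0 ≤ c) {lo hi y z : ℤ}
    (hy : y ∈ Set.Icc lo hi) (hz : z ∈ Set.Icc lo hi)
    (h : ∀ k : ℕ, k ≤ n → 2 * (k : ℤ) - n ∈ Set.Icc lo hi → f k ≤ c) :
    |tailSum f n y - tailSum f n z| ≤ |(y : ℝ) - z| * c := by
  wlog hyz : y ≤ z generalizing y z
  · rw [abs_sub_comm, abs_sub_comm (y : ℝ)]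
    exact this hz hy (by omega)
  obtain ⟨d, rfl⟩ : ∃ d : ℕ, z = y + d := ⟨(z - y).toNat, by omega⟩
  rw [abs_of_nonneg (sub_nonneg.2 (tailSum_anti hf hyz))]
  have := tailSum_sub_le (f := f) (n := n) (y := y) d fun i hi =>
    tailSum_sub_succ_le hc fun k hk hkz => h k hk (by
      rw [hkz]; exact ⟨by have := hy.1; omega, by have := hz.2; omega⟩)
  refine this.trans_eq ?_
  push_cast
  rw [show (y : ℝ) - (y + d) = -d by ring, abs_neg, Nat.abs_cast]

/-- Each atom lost is at most 2/J times the tail starting at it, hence at most 2/J times the tail at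
y. Being relative to the tail, the bound survives division by the probability of a hint. -/
theorem Bell.tailSum_sub_le_mul {k₀ K : ℝ} (h : Bell f n k₀ K) {T : ℝ} {J : ℕ} (hT : 0 ≤ T)
    (hJ0 : 0 < J) (hJ : K * (T + J + 2) * J ≤ n / 2) {y z : ℤ} (hyz : y ≤ z)
    (hz : z ≤ 2 * (k₀ + T) - n) :
    tailSum f n y - tailSum f n z ≤ (z - y) * (2 / J * tailSum f n y) := by
  obtain ⟨d, rfl⟩ : ∃ d : ℕ, z = y + d := ⟨(z - y).toNat, by omega⟩
  have hJ' : (0 : ℝ) < J := by exact_mod_cast hJ0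
  have h0 := tailSum_nonneg (n := n) h.nonneg y
  have := tailSum_sub_le (f := f) (n := n) (y := y) (c := 2 / J * tailSum f n y) d
    fun i hi => tailSum_sub_succ_le (by positivity) fun k hk hkz => by
      have hkT : (k : ℝ) ≤ k₀ + T := by
        have h2 : 2 * (k : ℤ) - n ≤ y + d := by omega
        have h3 : 2 * (k : ℝ) - n ≤ ((y + d : ℤ) : ℝ) := by exact_mod_cast h2
        linarith
      have h4 := h.mul_le_two_mul_sum hT hJ hkT
      have h5 : ∑ j ∈ Finset.range (n + 1), (if k ≤ j then f j else 0) ≤ tailSum f n y := by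
        refine Finset.sum_le_sum fun j _ => ?_
        have := h.nonneg j
        split_ifs <;> first | omega | simp_all
      rw [div_mul_eq_mul_div, le_div_iff₀ hJ']
      linarith
  refine this.trans_eq ?_
  push_cast
  ring

end TailSum

/-! ### Binomial and hypergeometric weights are bell-shaped -/

/-- With the ratio f(k+1)/f(k) = 1 - E/D cleared of denominators, the conditions become polynomial
inequalities in D and E. The denominator may fail to be positive where f vanishes, so positivity is
asked only on the support or above the centre. -/
theorem Bell.of_ratio {f : ℕ → ℝ} {n : ℕ} {k₀ K : ℝ} (D E : ℕ → ℝ) (pos : 0 < n)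
    (center_nonneg : 0 ≤ k₀) (center_le : k₀ ≤ n) (const_pos : 0 < K) (nonneg : ∀ k, 0 ≤ f k)
    (zero : ∀ k, n < k → f k = 0) (sum_one : ∑ k ∈ Finset.range (n + 1), f k = 1)
    (ratio : ∀ k ≤ n, f (k + 1) * D k = f k * (D k - E k))
    (hD : ∀ k ≤ n, f k ≠ 0 ∨ k₀ ≤ (k : ℝ) → 0 < D k)
    (up : ∀ k ≤ n, (k : ℝ) + 1 ≤ k₀ → E k ≤ 0)
    (down : ∀ k < n, k₀ ≤ (k : ℝ) → (k - k₀) * D k ≤ n * E k)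
    (slow : ∀ k ≤ n, k₀ - 1 ≤ (k : ℝ) → n * E k ≤ K * (k - k₀ + 2) * D k) : Bell f n k₀ K where
  pos := pos
  center_nonneg := center_nonneg
  center_le := center_le
  const_pos := const_pos
  nonneg := nonneg
  zero := zero
  sum_one := sum_one
  up k hk := by
    by_cases h0 : f k = 0
    · rw [h0]; exact nonneg _
    have hkn : k ≤ n := by by_contra h; exact h0 (zero k (by omega))
    have hd := hD k hkn (Or.inl h0)
    refine le_of_mul_le_mul_right ?_ hd
    rw [ratio k hkn]
    exact mul_le_mul_of_nonneg_left (by linarith [up k hkn hk]) (nonneg k)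
  down k hk := by
    rcases lt_or_ge n k with hnk | hkn
    · rw [zero k hnk, mul_zero, zero _ (by omega)]
    have hn : (0 : ℝ) < n := by exact_mod_cast pos
    have hd := hD k hkn (Or.inr hk)
    rcases eq_or_lt_of_le hkn with rfl | hlt
    -- At the last point k = n the left side vanishes, and the factor on the right is nonnegative
    -- because k₀ ≥ 0.
    · rw [zero _ (Nat.lt_succ_self _)]
      refine mul_nonneg ?_ (nonneg _)
      rw [sub_nonneg, div_le_one hn]
      linarith
    refine le_of_mul_le_mul_right ?_ hd
    rw [ratio k hkn, mul_right_comm, mul_comm]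
    refine mul_le_mul_of_nonneg_right ?_ (nonneg k)
    have := down k hlt hk
    rw [sub_mul, one_mul, div_mul_eq_mul_div]
    have := (div_le_iff₀' hn).2 this
    linarith
  slow k hk := by
    by_cases h0 : f k = 0
    · rw [h0, mul_zero]; exact nonneg _
    have hkn : k ≤ n := by by_contra h; exact h0 (zero k (by omega))
    have hn : (0 : ℝ) < n := by exact_mod_cast pos
    have hd := hD k hkn (Or.inl h0)
    refine le_of_mul_le_mul_right ?_ hd
    rw [ratio k hkn, mul_right_comm, mul_comm (f k)]
    refine mul_le_mul_of_nonneg_right ?_ (nonneg k)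
    have := slow k hkn hk
    rw [sub_mul, one_mul, div_mul_eq_mul_div]
    have := (le_div_iff₀' hn).2 this
    linarith

/-- The ratio is (n-k)p / ((k+1)(1-p)). From one step below the centre on, k+1 ≥ np ≥ n/4 and 1-p ≥
1/4, so the denominator is at least n/16, whence the constant. -/
theorem bell_binWeight {p : ℝ} (h0 : 1 / 4 ≤ p) (h1 : p ≤ 3 / 4) {n : ℕ} (hn : 0 < n) :
    Bell (binWeight p n) n (n * p) 16 := by
  have hn' : (0 : ℝ) < n := by exact_mod_cast hn
  refine Bell.of_ratio (fun k => (k + 1) * (1 - p)) (fun k => k - n * p + (1 - p)) hn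
    (by positivity) (by nlinarith) (by norm_num)
    (binWeight_nonneg (by linarith) (by linarith) n) (fun k hk => binWeight_of_lt hk)
    (sum_binWeight p n) ?_ ?_ ?_ ?_ ?_
  · intro k hk
    rcases eq_or_lt_of_le hk with rfl | hlt
    · rw [binWeight_of_lt (Nat.lt_succ_self _)]
      ring
    · have hc : (n.choose (k + 1) : ℝ) * (k + 1) = n.choose k * (n - k) := by
        have := Nat.choose_succ_right_eq n k
        rw [← Nat.cast_sub hk]
        exact_mod_cast this
      obtain ⟨d, rfl⟩ : ∃ d, n = k + 1 + d := ⟨n - (k + 1), by omega⟩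
      simp only [binWeight]
      rw [show k + 1 + d - (k + 1) = d by omega, show k + 1 + d - k = d + 1 by omega,
        pow_succ, pow_succ]
      push_cast at hc ⊢
      linear_combination (p ^ k * p * (1 - p) ^ d * (1 - p)) * hc
  · intro k _ _
    have : 0 < 1 - p := by linarith
    positivity
  · intro k _ hk
    linarith
  · intro k hk hu
    have hk' : (k : ℝ) + 1 ≤ n := by exact_mod_cast hk
    have hd : ((k : ℝ) + 1) * (1 - p) ≤ n := by nlinarith
    have := mul_le_mul_of_nonneg_left hd (sub_nonneg.2 hu)
    nlinarith
  · intro k _ hu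
    have hD : (n : ℝ) ≤ 16 * ((k + 1) * (1 - p)) := by nlinarith
    have h2 : (0 : ℝ) ≤ k - n * p + 2 := by linarith
    have := mul_le_mul_of_nonneg_left hD h2
    nlinarith

/-- The hypergeometric weight: the probability that a random `l`-element subset of a set of size
`a + b` has exactly `k` elements in a fixed subset of size `a`. -/
def hypWeight (a b l k : ℕ) : ℝ :=
  if k ≤ l then (a.choose k * b.choose (l - k) : ℝ) / (a + b).choose l else 0

theorem hypWeight_nonneg (a b l k : ℕ) : 0 ≤ hypWeight a b l k := by
  unfold hypWeight
  split_ifs <;> positivity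

theorem hypWeight_of_lt {a b l k : ℕ} (h : l < k) : hypWeight a b l k = 0 :=
  if_neg (by omega)

/-- The symmetry exchanging the two colours; it reduces the hint -1 to an upper tail. -/
theorem hypWeight_sub {a b l k : ℕ} (h : k ≤ l) : hypWeight a b l (l - k) = hypWeight b a l k := by
  rw [hypWeight, hypWeight, if_pos h, if_pos (Nat.sub_le _ _), Nat.sub_sub_self h, mul_comm,
    add_comm a b]

theorem sum_hypWeight {a b l : ℕ} (h : l ≤ a + b) :
    ∑ k ∈ Finset.range (l + 1), hypWeight a b l k = 1 := by
  have hV := Nat.add_choose_eq a b l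
  rw [Finset.Nat.sum_antidiagonal_eq_sum_range_succ fun i j => a.choose i * b.choose j] at hV
  have hpos : (0 : ℝ) < (a + b).choose l := by exact_mod_cast Nat.choose_pos h
  have : ∀ k ∈ Finset.range (l + 1), hypWeight a b l k
      = ((a.choose k * b.choose (l - k) : ℕ) : ℝ) / (a + b).choose l := fun k hk => by
    rw [hypWeight, if_pos (by simpa [Nat.lt_succ_iff] using hk)]
    push_cast
    rfl
  rw [Finset.sum_congr rfl this, ← Finset.sum_div, ← Nat.cast_sum, ← hV, div_self hpos.ne']

/-- The ratio is (a-k)(l-k) / ((k+1)(b-l+k+1)). Sampling at most half of the population, with each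
colour at least a quarter of it, makes the two factors of the denominator near the centre at least
l/4 and (a+b)/8, hence the constant 32. -/
theorem bell_hypWeight {a b l : ℕ} (hl : 0 < l) (hlN : 2 * l ≤ a + b) (ha : a + b ≤ 4 * a)
    (hb : a + b ≤ 4 * b) : Bell (hypWeight a b l) l (l * a / (a + b)) 32 := by
  have hl' : (0 : ℝ) < l := by exact_mod_cast hl
  have hlN' : 2 * (l : ℝ) ≤ a + b := by exact_mod_cast hlN
  have ha' : (a : ℝ) + b ≤ 4 * a := by exact_mod_cast ha
  have hb' : (a : ℝ) + b ≤ 4 * b := by exact_mod_cast hb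
  have hN : (0 : ℝ) < a + b := by linarith
  have hN2 : (2 : ℝ) ≤ a + b := by
    have : 2 ≤ a + b := by omega
    exact_mod_cast this
  set k₀ : ℝ := l * a / (a + b) with hk₀
  have hk₀N : k₀ * (a + b) = l * a := by rw [hk₀]; field_simp
  have hk₀4 : (l : ℝ) / 4 ≤ k₀ := by
    rw [hk₀, le_div_iff₀ hN]; nlinarith
  have hk₀l : k₀ ≤ l := by
    rw [hk₀, div_le_iff₀ hN]; nlinarith
  have hk₀a : k₀ ≤ a := by
    rw [hk₀, div_le_iff₀ hN]; nlinarith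
  have hbk : ((a : ℝ) + b) / 8 ≤ b - l + k₀ := by
    have : ((b : ℝ) - l + k₀) * (a + b) = b * (a + b - l) := by linear_combination hk₀N
    have h2 : ((a : ℝ) + b) / 8 * (a + b) ≤ (b - l + k₀) * (a + b) := by
      rw [this]; nlinarith
    exact le_of_mul_le_mul_right h2 hN
  refine Bell.of_ratio (fun k => (k + 1) * (b - l + k + 1))
    (fun k => (k - k₀) * (a + b) + 2 * k + 1 + b - l) hl
    (by linarith) hk₀l (by norm_num)
    (hypWeight_nonneg a b l) (fun k hk => hypWeight_of_lt hk)
    (sum_hypWeight (by omega)) ?_ ?_ ?_ ?_ ?_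
  · intro k hk
    have hDE : ((k : ℝ) + 1) * (b - l + k + 1) - ((k - k₀) * (a + b) + 2 * k + 1 + b - l)
        = (a - k) * (l - k) := by linear_combination hk₀N
    rw [hDE]
    rcases eq_or_lt_of_le hk with rfl | hlt
    · rw [hypWeight_of_lt (Nat.lt_succ_self _)]
      ring
    · have hc : (a.choose (k + 1) : ℝ) * (k + 1) = a.choose k * (a - k) := by
        rcases lt_or_ge a k with h | h
        · rw [Nat.choose_eq_zero_of_lt h, Nat.choose_eq_zero_of_lt (by omega)]; simp
        · have := Nat.choose_succ_right_eq a k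
          rw [← Nat.cast_sub h]
          exact_mod_cast this
      obtain ⟨d, rfl⟩ : ∃ d, l = k + 1 + d := ⟨l - (k + 1), by omega⟩
      have hc' : (b.choose (d + 1) : ℝ) * (d + 1) = b.choose d * (b - d) := by
        rcases lt_or_ge b d with h | h
        · rw [Nat.choose_eq_zero_of_lt h, Nat.choose_eq_zero_of_lt (by omega)]; simp
        · have := Nat.choose_succ_right_eq b d
          rw [← Nat.cast_sub h]
          exact_mod_cast this
      rw [hypWeight, hypWeight, if_pos (by omega), if_pos (by omega),
        show k + 1 + d - (k + 1) = d by omega, show k + 1 + d - k = d + 1 by omega,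
        div_mul_eq_mul_div, div_mul_eq_mul_div]
      congr 1
      push_cast
      linear_combination ((b.choose d : ℝ) * (b - d)) * hc
        - ((a.choose k : ℝ) * (a - k)) * hc'
  · intro k hk h
    -- If this fails, the sample would need more than b elements of the second colour, so the weight
    -- is zero.
    have : (0 : ℝ) < b - l + k + 1 := by
      rcases h with h | h
      · by_contra hneg
        push Not at hneg
        refine h ?_
        have : b + k + 1 ≤ l := by
          have : (b : ℝ) + k + 1 ≤ l := by linarith
          exact_mod_cast this
        rw [hypWeight, if_pos hk, Nat.choose_eq_zero_of_lt (show b < l - k by omega)]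
        simp
      · linarith
    positivity
  · intro k _ hk
    have : ((k : ℝ) - k₀) * (a + b) ≤ (-1) * (a + b) :=
      mul_le_mul_of_nonneg_right (by linarith) hN.le
    linarith
  · intro k hk hu
    have hk' : (k : ℝ) + 1 ≤ l := by exact_mod_cast hk
    have hd : ((k : ℝ) + 1) * (b - l + k + 1) ≤ l * (a + b) :=
      mul_le_mul hk' (by linarith) (by linarith) hl'.le
    have := mul_le_mul_of_nonneg_left hd (sub_nonneg.2 hu)
    nlinarith
  · intro k hk hu
    have hk' : (k : ℝ) ≤ l := by exact_mod_cast hk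
    have hD : (l : ℝ) / 4 * ((a + b) / 8) ≤ (k + 1) * (b - l + k + 1) :=
      mul_le_mul (by linarith) (by linarith) (by linarith) (by linarith)
    have h2 : (0 : ℝ) ≤ k - k₀ + 2 := by linarith
    have h3 := mul_le_mul_of_nonneg_left hD h2
    have h4 : ((k : ℝ) - k₀) * (a + b) + 2 * k + 1 + b - l ≤ (k - k₀ + 2) * (a + b) := by
      nlinarith
    have h5 := mul_le_mul_of_nonneg_left h4 hl'.le
    nlinarith

/-! ### The hypergeometric distribution -/

theorem card_powersetCard_inter {α : Type} [Fintype α] [DecidableEq α] (A : Finset α) {l k : ℕ}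
    (hk : k ≤ l) :
    (((Finset.univ : Finset α).powersetCard l).filter fun I => (I ∩ A).card = k).card
      = A.card.choose k * Aᶜ.card.choose (l - k) := by
  rw [← Finset.card_powersetCard, ← Finset.card_powersetCard, ← Finset.card_product]
  refine Finset.card_nbij' (fun I => (I ∩ A, I ∩ Aᶜ)) (fun x => x.1 ∪ x.2) ?_ ?_ ?_ ?_
  · intro I hI
    simp only [Finset.coe_filter, Finset.mem_powersetCard, Set.mem_ofPred_eq, Finset.subset_univ,
      true_and] at hI
    have : (I ∩ A).card + (I ∩ Aᶜ).card = I.card := by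
      rw [← Finset.sdiff_eq_inter_compl, Finset.card_inter_add_card_sdiff]
    simp only [Finset.coe_product, Set.mem_prod, Finset.mem_coe, Finset.mem_powersetCard,
      Finset.inter_subset_right, true_and]
    omega
  · rintro ⟨X, Y⟩ h
    simp only [Finset.coe_product, Set.mem_prod, Finset.mem_coe, Finset.mem_powersetCard] at h
    obtain ⟨⟨h1, h2⟩, h3, h4⟩ := h
    have hd : Disjoint X Y := Finset.disjoint_of_subset_left h1
      (Finset.disjoint_of_subset_right h3 disjoint_compl_right)
    have hY : Y ∩ A = ∅ := Finset.disjoint_iff_inter_eq_empty.1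
      (Finset.disjoint_of_subset_left h3 disjoint_compl_left)
    simp only [Finset.coe_filter, Finset.mem_powersetCard, Set.mem_ofPred_eq, Finset.subset_univ,
      true_and]
    rw [Finset.card_union_of_disjoint hd, Finset.union_inter_distrib_right, hY,
      Finset.inter_eq_left.2 h1, Finset.union_empty]
    omega
  · intro I _
    simp only
    rw [← Finset.inter_union_distrib_left, Finset.union_compl, Finset.inter_univ]
  · rintro ⟨X, Y⟩ h
    simp only [Finset.coe_product, Set.mem_prod, Finset.mem_coe, Finset.mem_powersetCard] at h
    obtain ⟨⟨h1, -⟩, h3, -⟩ := h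
    have hY : Y ∩ A = ∅ := Finset.disjoint_iff_inter_eq_empty.1
      (Finset.disjoint_of_subset_left h3 disjoint_compl_left)
    have hX : X ∩ Aᶜ = ∅ := Finset.disjoint_iff_inter_eq_empty.1
      (Finset.disjoint_of_subset_left h1 disjoint_compl_right)
    simp only [Finset.union_inter_distrib_right, hX, hY, Finset.inter_eq_left.2 h1,
      Finset.inter_eq_left.2 h3, Finset.union_empty, Finset.empty_union]

/-- The number of entries of a `±1` vector that are `1`. -/
def plusCount {n : ℕ} (v : Fin n → ℤˣ) : ℕ := (Finset.univ.filter fun j => v j = 1).card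

theorem plusCount_le {n : ℕ} (v : Fin n → ℤˣ) : plusCount v ≤ n := by
  exact (Finset.card_le_univ _).trans_eq (Fintype.card_fin n)

theorem sum_sign_eq {n : ℕ} (v : Fin n → ℤˣ) (I : Finset (Fin n)) :
    ∑ j ∈ I, (v j : ℤ) = 2 * ((I ∩ Finset.univ.filter fun j => v j = 1).card : ℤ) - I.card := by
  have h : ∀ j, (v j : ℤ) = 2 * (if v j = 1 then 1 else 0) - 1 := fun j => by
    rcases Int.units_eq_one_or (v j) with h | h <;> rw [h] <;> simp
  rw [Finset.sum_congr rfl fun j _ => h j, Finset.sum_sub_distrib, ← Finset.mul_sum,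
    ← Finset.sum_filter, Finset.sum_const, Finset.sum_const, Finset.inter_filter,
    Finset.inter_univ]
  simp

theorem weight_eq {n : ℕ} (v : Fin n → ℤˣ) : weight v = 2 * (plusCount v : ℤ) - n := by
  rw [weight, sum_sign_eq, Finset.univ_inter, plusCount, Finset.card_univ, Fintype.card_fin]

theorem mean_hypergeometric {n : ℕ} (v : Fin n → ℤˣ) (l : ℕ) (hl : l ≤ n) {g : ℤ → ℝ}
    (hg : IsBdd g) :
    mean (hypergeometric v l hl) g
      = ∑ k ∈ Finset.range (l + 1),
          hypWeight (plusCount v) (n - plusCount v) l k * g (2 * k - l) := by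
  set A := Finset.univ.filter fun j => v j = 1 with hA
  have hAc : Aᶜ.card = n - plusCount v := by
    rw [Finset.card_compl, Fintype.card_fin]; rfl
  set S := Finset.powersetCard l (Finset.univ : Finset (Fin n)) with hS
  have hScard : S.card = n.choose l := by simp [hS]
  rw [hypergeometric, mean_map _ _ hg, mean, tsum_eq_sum (s := S)]
  · have h1 : ∀ I ∈ S, ((PMF.uniformOfFinset S (Finset.powersetCard_nonempty.2 (by simpa using hl)))
        I).toReal * g (∑ j ∈ I, (v j : ℤ))
        = (n.choose l : ℝ)⁻¹ * g (2 * ((I ∩ A).card : ℤ) - l) := fun I hI => by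
      rw [PMF.uniformOfFinset_apply, if_pos hI, hScard, sum_sign_eq,
        (Finset.mem_powersetCard.1 hI).2]
      simp [hA]
    rw [Finset.sum_congr rfl h1, ← Finset.sum_fiberwise_of_maps_to (t := Finset.range (l + 1))
      (g := fun I => (I ∩ A).card)]
    · refine Finset.sum_congr rfl fun k hk => ?_
      have hkl : k ≤ l := by simpa [Nat.lt_succ_iff] using hk
      rw [Finset.sum_congr rfl (g := fun _ => (n.choose l : ℝ)⁻¹ * g (2 * (k : ℤ) - l))
        fun I hI => by rw [(Finset.mem_filter.1 hI).2], Finset.sum_const,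
        card_powersetCard_inter A hkl, hAc, hypWeight, if_pos hkl,
        Nat.add_sub_cancel' (plusCount_le v), nsmul_eq_mul]
      rw [show A.card = plusCount v from rfl]
      push_cast
      ring
    · intro I hI
      have := Finset.card_le_card (Finset.inter_subset_left (s₁ := I) (s₂ := A))
      rw [(Finset.mem_powersetCard.1 hI).2] at this
      exact Finset.mem_range.2 (by omega)
  · intro I hI
    rw [PMF.uniformOfFinset_apply, if_neg hI]
    simp

/-! ### Reduction of the bias to one-round estimates -/

theorem firstOne_apply_zero {n : ℕ} (q : Fin (n + 1) → PMF Bool) : firstOne q 0 = q 0 true := by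
  simp [firstOne, PMF.bind_apply, tsum_fintype, PMF.map_apply, (Fin.succ_ne_zero _).symm]

theorem firstOne_apply_succ {n : ℕ} (q : Fin (n + 1) → PMF Bool) (i : Fin (n + 1)) :
    firstOne q i.succ = q 0 false * firstOne (fun j => q j.succ) i := by
  simp [firstOne, PMF.bind_apply, tsum_fintype, PMF.map_apply, Fin.succ_ne_zero]

/-- Stopping at i is decided by the bits up to i: the first round with output one is a stopping
time. -/
theorem firstOne_congr {n : ℕ} {q q' : Fin n → PMF Bool} {i : Fin n} (h : ∀ j ≤ i, q j = q' j) :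
    firstOne q i.castSucc = firstOne q' i.castSucc := by
  induction n with
  | zero => exact i.elim0
  | succ n ih =>
    induction i using Fin.cases with
    | zero => rw [Fin.castSucc_zero, firstOne_apply_zero, firstOne_apply_zero, h 0 le_rfl]
    | succ i =>
      rw [← Fin.succ_castSucc, firstOne_apply_succ, firstOne_apply_succ, h 0 (Fin.zero_le _),
        ih fun j hj => h j.succ (Fin.succ_le_succ_iff.2 hj)]

theorem coinsFrom_eq_add {m i : ℕ} (hi : i < m) :
    coinsFrom m (i + 1) = roundCoins m (i + 1) + coinsFrom m (i + 1 + 1) := by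
  rw [coinsFrom, coinsFrom, ← Finset.add_sum_Ioc_eq_sum_Icc (by omega : i + 1 ≤ m),
    ← Order.succ_eq_add_one (i + 1), Finset.Icc_succ_left_eq_Ioc]

/-- The restriction of a transcript to the first `i` rounds. -/
def restrictTo {α : Type} {i k : ℕ} (h : i ≤ k) (ω : Fin k → α) : Fin i → α :=
  fun j => ω (Fin.castLE h j)

namespace Game

variable {m : ℕ} {H : Type} (G : Game m H)

/-- The sum of all the coins of a transcript. -/
def total {k : ℕ} (ω : Fin k → ℤ × H) : ℤ := ∑ j, (ω j).1

/-- The expectation of `Φ` at the final sum, given that the sum after `i` rounds is `s`. -/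
def future (Φ : ℤ → ℝ) (i : ℕ) (s : ℤ) : ℝ :=
  mean (coinSum G.eps (coinsFrom m (i + 1))) fun x => Φ (s + x)

variable {G} in
theorem isBdd_future {Φ : ℤ → ℝ} (hΦ : IsBdd Φ) (i : ℕ) : IsBdd (G.future Φ i) := by
  obtain ⟨M, hM⟩ := hΦ
  exact IsBdd.mean ⟨M, fun _ _ => hM _⟩

/-- The martingale property of the conditional expectations of Φ at the final sum. -/
theorem future_succ {Φ : ℤ → ℝ} (hΦ : IsBdd Φ) {i : ℕ} (hi : i < m) (s : ℤ) :
    G.future Φ i s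
      = mean (coinSum G.eps (roundCoins m (i + 1))) fun c => G.future Φ (i + 1) (s + c) := by
  rw [future, coinsFrom_eq_add hi, mean_coinSum_add _ _ _ (hΦ.comp fun x => s + x)]
  simp only [future, add_assoc]

theorem mean_lawUpTo_succ (k : ℕ) {u : (Fin (k + 1) → ℤ × H) → ℝ} (hu : IsBdd u) :
    mean (G.lawUpTo (k + 1)) u = mean (G.lawUpTo k) fun ω =>
      mean (coinSum G.eps (roundCoins m (k + 1))) fun c =>
        mean (G.hint (k + 1) (total ω) c) fun h =>
          u (Fin.snoc (α := fun _ => ℤ × H) ω (c, h)) := by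
  rw [lawUpTo, mean_bind _ _ hu]
  congr 1
  funext ω
  rw [mean_bind _ _ hu]
  congr 1
  funext c
  rw [mean_map _ _ hu]
  rfl

/-- The Markov property. Later coins do not depend on the past, and later hints integrate out
because only the total is observed after round i. -/
theorem mean_lawUpTo_restrictTo {i k : ℕ} (hik : i ≤ k) {u : (Fin i → ℤ × H) → ℝ} (hu : IsBdd u)
    {Φ : ℤ → ℝ} (hΦ : IsBdd Φ) :
    mean (G.lawUpTo k) (fun ω => u (restrictTo hik ω) * Φ (total ω))
      = mean (G.lawUpTo i) fun ω => u ω *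
          mean (coinSum G.eps (∑ j ∈ Finset.Icc (i + 1) k, roundCoins m j)) fun x =>
            Φ (total ω + x) := by
  induction k, hik using Nat.le_induction generalizing Φ with
  | base =>
    rw [Finset.Icc_eq_empty (by omega)]
    simp only [Finset.sum_empty, coinSum, mean_pure, add_zero]
    rfl
  | succ k hik ih =>
    have hres : ∀ (ω : Fin k → ℤ × H) (x : ℤ × H),
        restrictTo (hik.trans (Nat.le_succ k)) (Fin.snoc (α := fun _ => ℤ × H) ω x)
          = restrictTo hik ω := fun ω x => by
      funext j
      exact Fin.snoc_castSucc (α := fun _ => ℤ × H) x ω (Fin.castLE hik j)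
    have htot : ∀ (ω : Fin k → ℤ × H) (x : ℤ × H),
        total (Fin.snoc (α := fun _ => ℤ × H) ω x) = total ω + x.1 := fun ω x => by
      simp [total, Fin.sum_univ_castSucc]
    have hΦ' : IsBdd fun s => mean (coinSum G.eps (roundCoins m (k + 1))) fun c => Φ (s + c) := by
      obtain ⟨M, hM⟩ := hΦ
      exact IsBdd.mean ⟨M, fun _ _ => hM _⟩
    rw [mean_lawUpTo_succ _ _ ((hu.comp _).mul (hΦ.comp _))]
    simp only [hres, htot, mean_const, mean_const_mul]
    rw [ih hΦ', Finset.sum_Icc_succ_top (by omega)]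
    congr 1
    funext ω
    rw [mean_coinSum_add _ _ _ (hΦ.comp fun x => total ω + x)]
    simp only [add_assoc]

theorem mean_law_restrictTo {i : ℕ} (hi : i ≤ m) {u : (Fin i → ℤ × H) → ℝ} (hu : IsBdd u)
    {Φ : ℤ → ℝ} (hΦ : IsBdd Φ) :
    mean G.law (fun ω => u (restrictTo hi ω) * Φ (total ω))
      = mean (G.lawUpTo i) fun ω => u ω * G.future Φ i (total ω) :=
  G.mean_lawUpTo_restrictTo hi hu hΦ

theorem mean_law_restrictTo' {i : ℕ} (hi : i ≤ m) {u : (Fin i → ℤ × H) → ℝ} (hu : IsBdd u) :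
    mean G.law (fun ω => u (restrictTo hi ω)) = mean (G.lawUpTo i) u := by
  have := G.mean_law_restrictTo hi hu (IsBdd.const 1)
  simpa [future, mean_const] using this

theorem partialSum_eq_total {i : ℕ} (hi : i ≤ m) (ω : Fin m → ℤ × H) :
    partialSum ω i = total (restrictTo hi ω) := by
  have : (Finset.univ.filter fun j : Fin m => j.val < i) = Finset.univ.map (Fin.castLEEmb hi) := by
    ext j
    simp only [Finset.mem_filter, Finset.mem_univ, true_and, Finset.mem_map]
    exact ⟨fun h => ⟨⟨j, h⟩, rfl⟩, by rintro ⟨a, rfl⟩; exact a.2⟩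
  rw [partialSum, this, Finset.sum_map]
  rfl

theorem partialSum_self (ω : Fin m → ℤ × H) : partialSum ω m = total ω :=
  partialSum_eq_total le_rfl ω

/-- The indicator of a non-negative final sum. -/
def win (y : ℤ) : ℝ := if 0 ≤ y then 1 else 0

theorem isBdd_win : IsBdd win := IsBdd.ite _

theorem mem_winning (ω : Fin m → ℤ × H) : ω ∈ winning m H ↔ 0 ≤ total ω := by
  rw [← partialSum_self]; rfl

/-- The event on the past factors out of both numerator and denominator. Its probability must be
nonzero, since otherwise the quotient is zero by convention. -/
theorem value_eq (i : Fin m) (b : ℤ)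
    (hb : mean (G.lawUpTo i) (fun ω => if total ω = b then 1 else 0) ≠ 0) :
    G.value i b = G.future win i b := by
  classical
  have hi : (i : ℕ) ≤ m := i.2.le
  have hu : IsBdd fun ω : Fin i → ℤ × H => if total ω = b then (1 : ℝ) else 0 := IsBdd.ite _
  have h1 : prob G.law {ω | partialSum ω i = b}
      = mean (G.lawUpTo i) fun ω => if total ω = b then 1 else 0 := by
    rw [prob_eq_mean, ← G.mean_law_restrictTo' hi hu]
    simp only [Set.mem_ofPred_eq, partialSum_eq_total hi]
  have h2 : prob G.law (winning m H ∩ {ω | partialSum ω i = b})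
      = mean (G.lawUpTo i) (fun ω => if total ω = b then 1 else 0) * G.future win i b := by
    rw [prob_eq_mean, ← mean_mul_const]
    have : ∀ ω : Fin i → ℤ × H, (if total ω = b then (1 : ℝ) else 0) * G.future win i b
        = (if total ω = b then (1 : ℝ) else 0) * G.future win i (total ω) := fun ω => by
      split_ifs with h
      · rw [h]
      · simp
    simp only [this]
    rw [← G.mean_law_restrictTo hi hu isBdd_win]
    congr 1
    funext ω
    simp only [Set.mem_inter_iff, mem_winning, Set.mem_ofPred_eq, partialSum_eq_total hi, win]
    by_cases h3 : 0 ≤ total ω <;> by_cases h4 : total (restrictTo hi ω) = b <;> simp [h3, h4]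
  rw [value, condProb, h1, h2, mul_div_cancel_left₀ _ hb]

theorem restrictTo_last {i : ℕ} (hi : i < m) (ω : Fin m → ℤ × H) :
    restrictTo (show i + 1 ≤ m from hi) ω (Fin.last i) = ω ⟨i, hi⟩ := rfl

theorem total_init_restrictTo {i : ℕ} (hi : i < m) (ω : Fin m → ℤ × H) :
    total (Fin.init (α := fun _ => ℤ × H) (restrictTo (show i + 1 ≤ m from hi) ω))
      = partialSum ω i := by
  rw [partialSum_eq_total hi.le]; rfl

theorem abs_valueHint_sub_value_le_one (i : Fin m) (b : ℤ) (h : H) :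
    |G.valueHint i b h - G.value i b| ≤ 1 := by
  have h1 := condProb_mem G.law (winning m H) {ω | partialSum ω i = b ∧ (ω i).2 = h}
  have h2 := condProb_mem G.law (winning m H) {ω | partialSum ω i = b}
  rw [valueHint, value, abs_le]
  constructor <;> linarith [h1.1, h1.2, h2.1, h2.2]

variable [DecidableEq H]

/-- Observing the sum b and the hint h weights each coin value c by the probability that it produces
h: the numerator of Bayes' rule. -/
theorem mean_lawUpTo_hint (i : ℕ) (b : ℤ) (h : H) {Ψ : ℤ → ℝ} (hΨ : IsBdd Ψ) :
    mean (G.lawUpTo (i + 1)) (fun η =>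
        (if total (Fin.init (α := fun _ => ℤ × H) η) = b ∧ (η (Fin.last i)).2 = h then 1 else 0)
          * Ψ (total η))
      = mean (G.lawUpTo i) (fun ω => if total ω = b then 1 else 0)
        * mean (coinSum G.eps (roundCoins m (i + 1))) fun c =>
            (G.hint (i + 1) b c h).toReal * Ψ (b + c) := by
  rw [mean_lawUpTo_succ _ _ ((IsBdd.ite _).mul (hΨ.comp _)), ← mean_mul_const]
  congr 1
  funext ω
  have htot : ∀ x : ℤ × H,
      total (Fin.snoc (α := fun _ => ℤ × H) ω x) = total ω + x.1 := fun x => by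
    simp [total, Fin.sum_univ_castSucc]
  simp only [Fin.init_snoc, Fin.snoc_last, htot]
  by_cases hb : total ω = b
  · simp only [hb, true_and, if_true, one_mul]
    congr 1
    funext c
    rw [toReal_apply_eq_mean, mean_mul_const]
  · simp [hb, mean_const]

/-- Bayes' rule. It is an equality when b has positive probability; otherwise both values are 0/0 =
0 and the inequality still holds. -/
theorem abs_valueHint_sub_value_le (i : Fin m) (b : ℤ) (h : H) :
    |G.valueHint i b h - G.value i b|
      ≤ |mean (coinSum G.eps (roundCoins m (i + 1)))
          (fun c => (G.hint (i + 1) b c h).toReal * G.future win (i + 1) (b + c))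
          / mean (coinSum G.eps (roundCoins m (i + 1)))
            (fun c => (G.hint (i + 1) b c h).toReal)
        - mean (coinSum G.eps (roundCoins m (i + 1)))
            (fun c => G.future win (i + 1) (b + c))| := by
  classical
  have hi : (i : ℕ) + 1 ≤ m := i.2
  have hu : IsBdd fun η : Fin (i + 1) → ℤ × H =>
      if total (Fin.init (α := fun _ => ℤ × H) η) = b ∧ (η (Fin.last i)).2 = h
        then (1 : ℝ) else 0 := IsBdd.ite _
  have h1 : prob G.law {ω | partialSum ω i = b ∧ (ω i).2 = h}
      = mean (G.lawUpTo i) (fun ω => if total ω = b then 1 else 0)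
        * mean (coinSum G.eps (roundCoins m (i + 1))) fun c => (G.hint (i + 1) b c h).toReal := by
    have := G.mean_lawUpTo_hint i b h (IsBdd.const 1)
    simp only [mul_one] at this
    rw [← this, ← G.mean_law_restrictTo' hi hu, prob_eq_mean]
    simp only [Set.mem_ofPred_eq, total_init_restrictTo i.2, restrictTo_last i.2]
  have h2 : prob G.law (winning m H ∩ {ω | partialSum ω i = b ∧ (ω i).2 = h})
      = mean (G.lawUpTo i) (fun ω => if total ω = b then 1 else 0)
        * mean (coinSum G.eps (roundCoins m (i + 1))) fun c =>
            (G.hint (i + 1) b c h).toReal * G.future win (i + 1) (b + c) := by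
    rw [← G.mean_lawUpTo_hint i b h (isBdd_future isBdd_win (i + 1)),
      ← G.mean_law_restrictTo hi hu isBdd_win, prob_eq_mean]
    simp only [Set.mem_inter_iff, mem_winning, Set.mem_ofPred_eq, total_init_restrictTo i.2,
      restrictTo_last i.2, win]
    congr 1
    funext ω
    by_cases h3 : 0 ≤ total ω <;> by_cases h4 : partialSum ω i = b ∧ (ω i).2 = h <;>
      simp [h3, h4]
  by_cases hb : mean (G.lawUpTo i) (fun ω => if total ω = b then 1 else 0) = 0
  · have e1 : G.valueHint i b h = 0 := by
      rw [valueHint, condProb, h1, hb, zero_mul, div_zero]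
    have e2 : G.value i b = 0 := by
      have hi' : (i : ℕ) ≤ m := i.2.le
      have : prob G.law {ω | partialSum ω i = b} = 0 := by
        rw [← hb, prob_eq_mean, ← G.mean_law_restrictTo' hi' (IsBdd.ite _)]
        simp only [Set.mem_ofPred_eq, partialSum_eq_total hi']
      rw [value, condProb, this, div_zero]
    rw [e1, e2, sub_zero, abs_zero]
    exact abs_nonneg _
  · rw [G.value_eq i b hb, valueHint, condProb, h1, h2, mul_div_mul_left _ _ hb,
      G.future_succ isBdd_win i.2]

end Game

/-! ### Stopping probabilities and optional stopping -/

namespace Game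

variable {m : ℕ} {H : Type} (G : Game m H)

/-- The probability that `B` stops in the round with index `i`, given the transcript. -/
def stopProb (B : Algorithm H) (ω : Fin m → ℤ × H) (i : Fin m) : ℝ :=
  (firstOne (fun j => B (inputs ω j)) i.castSucc).toReal

theorem stopProb_nonneg (B : Algorithm H) (ω : Fin m → ℤ × H) (i : Fin m) :
    0 ≤ stopProb B ω i := ENNReal.toReal_nonneg

theorem sum_stopProb_le_one (B : Algorithm H) (ω : Fin m → ℤ × H) :
    ∑ i, stopProb B ω i ≤ 1 := by
  have := tsum_toReal (firstOne fun j => B (inputs ω j))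
  rw [tsum_fintype, Fin.sum_univ_castSucc] at this
  rw [← this]
  exact le_add_of_nonneg_right ENNReal.toReal_nonneg

theorem stopProb_le_one (B : Algorithm H) (ω : Fin m → ℤ × H) (i : Fin m) :
    stopProb B ω i ≤ 1 :=
  (Finset.single_le_sum (fun j _ => stopProb_nonneg B ω j) (Finset.mem_univ i)).trans
    (sum_stopProb_le_one B ω)

theorem stopProb_congr (B : Algorithm H) {ω ω' : Fin m → ℤ × H} {i : Fin m}
    (h : ∀ j ≤ i, ω j = ω' j) : stopProb B ω i = stopProb B ω' i := by
  rw [stopProb, stopProb, firstOne_congr]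
  intro j hj
  have hS : ∀ k : ℕ, k ≤ i → partialSum ω k = partialSum ω' k := fun k hk =>
    Finset.sum_congr rfl fun l hl => by
      rw [h l (Fin.le_def.2 ((Finset.mem_filter.1 hl).2.le.trans hk))]
  simp only [inputs]
  congr 2
  funext k
  have hk : (k : ℕ) ≤ i := (Nat.lt_succ_iff.1 k.2).trans hj
  rw [hS k hk, h (Fin.castLE j.2 k) (Fin.le_def.2 hk)]

/-- Extend a partial transcript by a default value. -/
def extendFrom [Inhabited H] {i : ℕ} (η : Fin i → ℤ × H) : Fin m → ℤ × H :=
  fun j => if h : j.val < i then η ⟨j, h⟩ else default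

/-- Exhibits the stopping probability as a function of the restricted transcript, the form that the
Markov property requires. -/
theorem stopProb_extendFrom [Inhabited H] (B : Algorithm H) (ω : Fin m → ℤ × H) (i : Fin m) :
    stopProb B (extendFrom (restrictTo (show i.val + 1 ≤ m from i.2) ω)) i = stopProb B ω i :=
  stopProb_congr B fun j hj => by
    have : j.val < i.val + 1 := Nat.lt_succ_of_le hj
    simp [extendFrom, this, restrictTo]

/-- Split according to the selected round; selecting none contributes nothing because the two
outcome variables then agree. -/
theorem biasOf_le (B : Algorithm H) :
    G.biasOf B ≤ mean G.law fun ω => ∑ i, stopProb B ω i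
      * |G.valueHint i (partialSum ω i) (ω i).2 - G.value i (partialSum ω i)| := by
  have hbdd : ∀ x : (Fin m → ℤ × H) × Fin (m + 1),
      |G.withHint x.1 x.2 - G.withoutHint x.1 x.2| ≤ 1 := fun x => by
    unfold withHint withoutHint
    split_ifs with h
    · exact G.abs_valueHint_sub_value_le_one _ _ _
    · simp
  have hb : IsBdd fun x : (Fin m → ℤ × H) × Fin (m + 1) =>
      G.withHint x.1 x.2 - G.withoutHint x.1 x.2 := ⟨1, hbdd⟩
  refine (abs_mean_le _ hb).trans_eq ?_
  rw [play, mean_bind _ _ hb.abs]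
  congr 1
  funext ω
  rw [mean_map _ _ hb.abs, mean_fintype, Fin.sum_univ_castSucc]
  simp [withHint, withoutHint, stopProb]

/-- Optional stopping: if, outside of unlikely events, the hint of each round changes the value by
at most the conditional expectation of `Φ` at the final sum, then the bias is at most the
expectation of `Φ`, up to the error terms. -/
theorem bias_le [Inhabited H] {Φ : ℤ → ℝ} (hΦ : IsBdd Φ) (hΦ0 : ∀ y, 0 ≤ Φ y) {τ τ' : ℝ}
    (hτ : 0 ≤ τ) (bad : Fin m → ℤ → ℤ → H → Prop) [∀ i b c h, Decidable (bad i b c h)]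
    (hgood : ∀ i b c h, ¬ bad i b c h →
      |G.valueHint i b h - G.value i b| ≤ G.future Φ (i + 1) (b + c) + τ)
    (hbad : ∀ i : Fin m, mean (G.lawUpTo i) (fun ω =>
      mean (coinSum G.eps (roundCoins m (i + 1))) fun c =>
        mean (G.hint (i + 1) (total ω) c) fun h => if bad i (total ω) c h then 1 else 0) ≤ τ') :
    G.bias ≤ mean (coinSum G.eps (coinsFrom m 1)) Φ + m * (τ + τ') := by
  have : Nonempty (Algorithm H) := ⟨fun _ => PMF.pure true⟩
  refine ciSup_le fun B => (G.biasOf_le B).trans ?_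
  have hs : ∀ i, IsBdd fun ω : Fin m → ℤ × H => stopProb B ω i := fun i =>
    IsBdd.of_mem_Icc fun ω => ⟨stopProb_nonneg B ω i, stopProb_le_one B ω i⟩
  have hfut0 : ∀ i s, 0 ≤ G.future Φ i s := fun i s => mean_nonneg _ fun x => hΦ0 _
  -- On a bad event the change is bounded by one.
  have hpt : ∀ (i : Fin m) (ω : Fin m → ℤ × H), stopProb B ω i
      * |G.valueHint i (partialSum ω i) (ω i).2 - G.value i (partialSum ω i)|
      ≤ stopProb B ω i * G.future Φ (i + 1) (partialSum ω i + (ω i).1)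
        + (τ + if bad i (partialSum ω i) (ω i).1 (ω i).2 then 1 else 0) := fun i ω => by
    have h0 := stopProb_nonneg B ω i
    have h1 := stopProb_le_one B ω i
    have hf := hfut0 (i + 1) (partialSum ω i + (ω i).1)
    split_ifs with h
    · have := mul_le_mul h1
        (G.abs_valueHint_sub_value_le_one i (partialSum ω i) (ω i).2) (abs_nonneg _) zero_le_one
      nlinarith
    · have := mul_le_mul_of_nonneg_left (hgood i _ _ _ h) h0
      nlinarith
  have htot : ∀ (i : Fin m) (ω : Fin m → ℤ × H), partialSum ω i + (ω i).1
      = total (restrictTo (show i.val + 1 ≤ m from i.2) ω) := fun i ω => by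
    rw [← total_init_restrictTo i.2, total, total, Fin.sum_univ_castSucc]
    rfl
  -- The decision to stop is made from the transcript up to this round, so the conditional
  -- expectation of Φ can be replaced by Φ at the final sum.
  have hpay : ∀ i : Fin m, mean G.law (fun ω => stopProb B ω i
      * G.future Φ (i + 1) (partialSum ω i + (ω i).1))
      = mean G.law fun ω => stopProb B ω i * Φ (total ω) := fun i => by
    have hi : i.val + 1 ≤ m := i.2
    have hu : IsBdd fun η : Fin (i.val + 1) → ℤ × H =>
      stopProb (m := m) B (extendFrom η) i := (hs i).comp _
    have e1 := G.mean_law_restrictTo hi hu hΦ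
    have e2 := G.mean_law_restrictTo' hi
      (hu.mul ((isBdd_future (G := G) hΦ (i + 1)).comp total))
    simp only [stopProb_extendFrom] at e1 e2
    simp only [htot]
    rw [e1, e2]
  have hbad' : ∀ i : Fin m, mean G.law (fun ω =>
      if bad i (partialSum ω i) (ω i).1 (ω i).2 then (1 : ℝ) else 0) ≤ τ' := fun i => by
    refine le_trans (le_of_eq ?_) (hbad i)
    have hi : i.val + 1 ≤ m := i.2
    have hu : IsBdd fun η : Fin (i.val + 1) → ℤ × H =>
      if bad i (total (Fin.init (α := fun _ => ℤ × H) η)) (η (Fin.last i)).1 (η (Fin.last i)).2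
        then (1 : ℝ) else 0 := IsBdd.ite _
    have e2 := G.mean_law_restrictTo' hi hu
    rw [mean_lawUpTo_succ _ _ hu] at e2
    simp only [Fin.init_snoc, Fin.snoc_last, total_init_restrictTo i.2, restrictTo_last i.2] at e2
    exact e2
  have hfb : ∀ i : Fin m, IsBdd fun ω : Fin m → ℤ × H =>
      stopProb B ω i * G.future Φ (i + 1) (partialSum ω i + (ω i).1) := fun i =>
    (hs i).mul ((isBdd_future (G := G) hΦ (i + 1)).comp _)
  have hdb : ∀ i : Fin m, IsBdd fun ω : Fin m → ℤ × H => stopProb B ω i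
      * |G.valueHint i (partialSum ω i) (ω i).2 - G.value i (partialSum ω i)| := fun i =>
    (hs i).mul (IsBdd.of_mem_Icc fun ω =>
      ⟨abs_nonneg _, G.abs_valueHint_sub_value_le_one _ _ _⟩)
  have hbb : ∀ i : Fin m, IsBdd fun ω : Fin m → ℤ × H =>
      if bad i (partialSum ω i) (ω i).1 (ω i).2 then (1 : ℝ) else 0 := fun i => IsBdd.ite _
  have hround : ∀ i : Fin m, mean G.law (fun ω => stopProb B ω i
      * |G.valueHint i (partialSum ω i) (ω i).2 - G.value i (partialSum ω i)|)
      ≤ mean G.law (fun ω => stopProb B ω i * Φ (total ω)) + (τ + τ') := fun i => by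
    refine (mean_mono _ (hdb i) ((hfb i).add ((IsBdd.const τ).add (hbb i))) (hpt i)).trans ?_
    rw [mean_add _ (hfb i) ((IsBdd.const τ).add (hbb i)), mean_add _ (IsBdd.const τ) (hbb i),
      mean_const, hpay i]
    linarith [hbad' i]
  rw [mean_sum _ _ fun i _ => hdb i]
  refine (Finset.sum_le_sum fun i _ => hround i).trans ?_
  rw [Finset.sum_add_distrib, Finset.sum_const, Finset.card_univ, Fintype.card_fin, nsmul_eq_mul,
    ← mean_sum _ _ fun i _ => (hs i).mul (hΦ.comp total)]
  refine add_le_add_left ?_ _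
  have hfinal : mean G.law (fun ω => Φ (total ω)) = mean (coinSum G.eps (coinsFrom m 1)) Φ := by
    have := G.mean_law_restrictTo (Nat.zero_le m) (IsBdd.const 1) hΦ
    simp only [one_mul] at this
    rw [this, lawUpTo, mean_pure]
    simp [future, total]
  rw [← hfinal]
  -- At most one round is selected, so Φ is paid only once for all the rounds together.
  refine mean_mono _ (IsBdd.sum _ fun i _ => (hs i).mul (hΦ.comp total)) (hΦ.comp total) fun ω => ?_
  rw [← Finset.sum_mul]
  exact mul_le_of_le_one_left (hΦ0 _) (sum_stopProb_le_one B ω)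

end Game

/-! ### The effect of a single hint -/

section Covariance

variable {ι : Type} {s : Finset ι} {w F g : ι → ℝ}

/-- Twice the covariance is the mean product of differences over two independent copies; this makes
Lipschitz bounds applicable. -/
theorem sum_mul_sub_mul_sub (hw : ∑ i ∈ s, w i = 1) (F g : ι → ℝ) :
    ∑ i ∈ s, ∑ j ∈ s, w i * w j * ((F i - F j) * (g i - g j))
      = 2 * (∑ i ∈ s, w i * (F i * g i) - (∑ i ∈ s, w i * F i) * ∑ i ∈ s, w i * g i) := by
  have h : ∀ i j, w i * w j * ((F i - F j) * (g i - g j))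
      = (w i * (F i * g i)) * w j - (w i * F i) * (w j * g j)
        - (w i * g i) * (w j * F j) + w i * (w j * (F j * g j)) := fun i j => by ring
  simp only [h, Finset.sum_add_distrib, Finset.sum_sub_distrib, ← Finset.mul_sum,
    ← Finset.sum_mul, hw]
  ring

/-- Two functions that are Lipschitz on a likely window have a small covariance. -/
theorem abs_covariance_le (hw0 : ∀ i, 0 ≤ w i) (hw : ∑ i ∈ s, w i = 1)
    (hF : ∀ i, F i ∈ Set.Icc (0 : ℝ) 1) (hg : ∀ i, g i ∈ Set.Icc (0 : ℝ) 1) {X : ι → ℝ}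
    {W : ι → Prop} [DecidablePred W] {A B c v τ : ℝ} (hA : 0 ≤ A) (hB : 0 ≤ B)
    (hFW : ∀ i j, W i → W j → |F i - F j| ≤ B * |X i - X j|)
    (hgW : ∀ i j, W i → W j → |g i - g j| ≤ A * |X i - X j|)
    (hv : ∑ i ∈ s, w i * (X i - c) ^ 2 ≤ v)
    (hτ : ∑ i ∈ s, w i * (if W i then 0 else 1) ≤ τ) :
    |∑ i ∈ s, w i * (F i * g i) - (∑ i ∈ s, w i * F i) * ∑ i ∈ s, w i * g i|
      ≤ A * B * v + τ := by
  have hpt : ∀ i j, |(F i - F j) * (g i - g j)|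
      ≤ A * B * ((X i - X j) * (X i - X j))
        + ((if W i then 0 else 1) + (if W j then 0 else 1)) := fun i j => by
    have h1 : |F i - F j| ≤ 1 := abs_le.2
      ⟨by linarith [(hF i).1, (hF j).2], by linarith [(hF i).2, (hF j).1]⟩
    have h2 : |g i - g j| ≤ 1 := abs_le.2
      ⟨by linarith [(hg i).1, (hg j).2], by linarith [(hg i).2, (hg j).1]⟩
    have h3 : 0 ≤ A * B * ((X i - X j) * (X i - X j)) :=
      mul_nonneg (mul_nonneg hA hB) (mul_self_nonneg _)
    rw [abs_mul]
    have h4 : |F i - F j| * |g i - g j| ≤ 1 :=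
      mul_le_one₀ h1 (abs_nonneg _) h2
    by_cases hi : W i
    · by_cases hj : W j
      · simp only [hi, hj, if_true, add_zero]
        refine (mul_le_mul (hFW i j hi hj) (hgW i j hi hj) (abs_nonneg _)
          (by positivity)).trans_eq ?_
        rw [← abs_mul_abs_self (X i - X j)]
        ring
      · simp only [hi, hj, if_true, if_false]
        linarith
    · have : (0 : ℝ) ≤ if W j then 0 else 1 := by split_ifs <;> norm_num
      simp only [hi, if_false]
      linarith
  have hsum := sum_mul_sub_mul_sub hw F g
  -- The same identity turns the squared differences back into twice the variance of X, which is at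
  -- most 2v.
  have hX := sum_mul_sub_mul_sub hw (fun i => X i - c) fun i => X i - c
  have hle : |∑ i ∈ s, ∑ j ∈ s, w i * w j * ((F i - F j) * (g i - g j))|
      ≤ ∑ i ∈ s, ∑ j ∈ s, w i * w j * (A * B * ((X i - X j) * (X i - X j))
        + ((if W i then 0 else 1) + (if W j then 0 else 1))) := by
    refine (Finset.abs_sum_le_sum_abs _ _).trans (Finset.sum_le_sum fun i _ => ?_)
    refine (Finset.abs_sum_le_sum_abs _ _).trans (Finset.sum_le_sum fun j _ => ?_)
    rw [abs_mul, abs_of_nonneg (mul_nonneg (hw0 i) (hw0 j))]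
    exact mul_le_mul_of_nonneg_left (hpt i j) (mul_nonneg (hw0 i) (hw0 j))
  have hright : ∑ i ∈ s, ∑ j ∈ s, w i * w j * (A * B * ((X i - X j) * (X i - X j))
        + ((if W i then 0 else 1) + (if W j then 0 else 1)))
      = A * B * ∑ i ∈ s, ∑ j ∈ s, w i * w j * ((X i - c - (X j - c)) * (X i - c - (X j - c)))
        + 2 * ∑ i ∈ s, w i * (if W i then 0 else 1) := by
    have h : ∀ i j, w i * w j * (A * B * ((X i - X j) * (X i - X j))
        + ((if W i then 0 else 1) + (if W j then 0 else 1)))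
        = A * B * (w i * w j * ((X i - c - (X j - c)) * (X i - c - (X j - c))))
          + ((w i * (if W i then 0 else 1)) * w j + w i * (w j * (if W j then 0 else 1))) :=
      fun i j => by ring
    simp only [h, Finset.sum_add_distrib, ← Finset.mul_sum, ← Finset.sum_mul, hw]
    ring
  rw [hright, hX, hsum, abs_mul, abs_two] at hle
  have hv' : ∑ i ∈ s, w i * ((X i - c) * (X i - c)) ≤ v := by
    simpa only [sq] using hv
  have hsq := mul_self_nonneg (∑ i ∈ s, w i * (X i - c))
  have hAB := mul_nonneg hA hB
  have := mul_le_mul_of_nonneg_left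
    (show ∑ i ∈ s, w i * ((X i - c) * (X i - c))
      - (∑ i ∈ s, w i * (X i - c)) * ∑ i ∈ s, w i * (X i - c) ≤ v by linarith) hAB
  linarith

theorem sum_weight_mem_Icc (hw0 : ∀ i, 0 ≤ w i) (hw : ∑ i ∈ s, w i = 1)
    (hF : ∀ i, F i ∈ Set.Icc (0 : ℝ) 1) : ∑ i ∈ s, w i * F i ∈ Set.Icc (0 : ℝ) 1 :=
  ⟨Finset.sum_nonneg fun i _ => mul_nonneg (hw0 i) (hF i).1, by
    rw [← hw]
    exact Finset.sum_le_sum fun i _ => mul_le_of_le_one_right (hw0 i) (hF i).2⟩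

/-- Conditioning on an event of probability `η` increases a probability `q` to at most `q / η`,
and likewise for the complement. -/
theorem abs_sub_le_of_decided (hw0 : ∀ i, 0 ≤ w i) (hw : ∑ i ∈ s, w i = 1)
    (hF : ∀ i, F i ∈ Set.Icc (0 : ℝ) 1) (hg : ∀ i, g i ∈ Set.Icc (0 : ℝ) 1) {q : ℝ}
    (hη : 0 < ∑ i ∈ s, w i * F i)
    (hq : ∑ i ∈ s, w i * g i ≤ q ∨ 1 - ∑ i ∈ s, w i * g i ≤ q) :
    |(∑ i ∈ s, w i * (F i * g i)) / (∑ i ∈ s, w i * F i) - ∑ i ∈ s, w i * g i|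
      ≤ q / ∑ i ∈ s, w i * F i := by
  have hF1 := (sum_weight_mem_Icc hw0 hw hF).2
  have hg1 := sum_weight_mem_Icc hw0 hw hg
  have hFg0 : 0 ≤ ∑ i ∈ s, w i * (F i * g i) :=
    Finset.sum_nonneg fun i _ => mul_nonneg (hw0 i) (mul_nonneg (hF i).1 (hg i).1)
  have hFgg : ∑ i ∈ s, w i * (F i * g i) ≤ ∑ i ∈ s, w i * g i :=
    Finset.sum_le_sum fun i _ => mul_le_mul_of_nonneg_left
      (mul_le_of_le_one_left (hg i).1 (hF i).2) (hw0 i)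
  have hFgF : ∑ i ∈ s, w i * (F i * g i) ≤ ∑ i ∈ s, w i * F i :=
    Finset.sum_le_sum fun i _ => mul_le_mul_of_nonneg_left
      (mul_le_of_le_one_right (hF i).1 (hg i).2) (hw0 i)
  -- The losing probability together with the event is at most the losing probability.
  have hcomp : ∑ i ∈ s, w i * F i - ∑ i ∈ s, w i * (F i * g i) ≤ 1 - ∑ i ∈ s, w i * g i := by
    rw [← hw, ← Finset.sum_sub_distrib, ← Finset.sum_sub_distrib]
    refine Finset.sum_le_sum fun i _ => ?_
    have := mul_le_mul_of_nonneg_left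
      (mul_le_of_le_one_left (sub_nonneg.2 (hg i).2) (hF i).2) (hw0 i)
    linarith
  set η := ∑ i ∈ s, w i * F i
  set a := ∑ i ∈ s, w i * g i
  set b := ∑ i ∈ s, w i * (F i * g i)
  have : b / η - a = (b - η * a) / η := by field_simp
  rw [this, abs_div, abs_of_pos hη]
  refine div_le_div_of_nonneg_right ?_ hη.le
  have ha0 := hg1.1
  have ha1 := hg1.2
  rw [abs_le]
  rcases hq with hq | hq
  · constructor <;> nlinarith
  · constructor <;> nlinarith

end Covariance

/-! ### Lipschitz bounds on windows -/

section Window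

variable {ι : Type} {s : Finset ι} {w : ι → ℝ}

/-- A tail probability of a bell-shaped distribution, as a function of a random threshold, is
Lipschitz on a likely window, relative to its expectation, unless the latter is tiny. -/
theorem Bell.abs_tailSum_sub_le_mul {f : ℕ → ℝ} {n : ℕ} {k₀ K : ℝ} (h : Bell f n k₀ K)
    (hw0 : ∀ i, 0 ≤ w i) (hw : ∑ i ∈ s, w i = 1) {Y : ι → ℤ} {W : ι → Prop} [DecidablePred W]
    {T ω τ y₁ : ℝ} {J : ℕ} (hT : 4 ≤ T) (hJ0 : 0 < J)
    (hJ : K * (2 * T + J + 2) * J ≤ n / 2) (hωT : ω ≤ T) (hωJ : 8 * ω ≤ J)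
    (hY : ∀ i, W i → |(Y i : ℝ) - y₁| ≤ ω)
    (hτ : ∑ i ∈ s, w i * (if W i then 0 else 1) ≤ τ) (hτ' : τ ≤ 1 / 2)
    (hη : (n + 1) * Real.exp (-(T ^ 2 / (8 * n))) + τ < ∑ i ∈ s, w i * tailSum f n (Y i))
    {i j : ι} (hi : W i) (hj : W j) :
    |tailSum f n (Y i) - tailSum f n (Y j)|
      ≤ 8 * (∑ i ∈ s, w i * tailSum f n (Y i)) / J * |(Y i : ℝ) - Y j| := by
  have hJ' : (0 : ℝ) < J := by exact_mod_cast hJ0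
  set lo := ⌈y₁ - ω⌉ with hlo
  have hlo1 : y₁ - ω ≤ lo := Int.le_ceil _
  set t := tailSum f n lo with ht
  have ht0 : 0 ≤ t := tailSum_nonneg h.nonneg _
  have hYlo : ∀ i, W i → lo ≤ Y i := fun i hi => by
    have := (abs_le.1 (hY i hi)).1
    exact Int.ceil_le.2 (by linarith)
  have hYhi : ∀ i, W i → (Y i : ℝ) ≤ y₁ + ω := fun i hi => by
    have := (abs_le.1 (hY i hi)).2
    linarith
  have hW : ∑ i ∈ s, w i * (if W i then (1 : ℝ) else 0)
      = 1 - ∑ i ∈ s, w i * (if W i then (0 : ℝ) else 1) := by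
    rw [eq_sub_iff_add_eq, ← Finset.sum_add_distrib]
    refine (Finset.sum_congr rfl fun i _ => ?_).trans hw
    split_ifs <;> ring
  have hηt : ∑ i ∈ s, w i * tailSum f n (Y i) ≤ t + τ := by
    have : ∀ i ∈ s, w i * tailSum f n (Y i)
        ≤ w i * t + w i * (if W i then 0 else 1) := fun i _ => by
      rw [← mul_add]
      refine mul_le_mul_of_nonneg_left ?_ (hw0 i)
      split_ifs with hi
      · rw [add_zero]
        exact tailSum_anti h.nonneg (hYlo i hi)
      · have := tailSum_le_one (n := n) h.nonneg h.sum_one (Y i)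
        linarith
    refine (Finset.sum_le_sum this).trans ?_
    rw [Finset.sum_add_distrib, ← Finset.sum_mul, hw, one_mul]
    linarith
  -- Otherwise even the largest tail t on the window would be tiny, contradicting the lower bound on
  -- the mean.
  have hlo2 : (lo : ℝ) < 2 * (k₀ + T) - n := by
    by_contra hc
    push Not at hc
    have := h.tailSum_le_exp hT hc
    linarith
  -- The window has width at most 2ω ≤ 2T, so it stays below 2(k₀ + 2T) - n; hence the 2T in the
  -- condition on J.
  have hbound : ∀ y z : ℤ, lo ≤ y → y ≤ z → (z : ℝ) ≤ y₁ + ω →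
      tailSum f n y - tailSum f n z ≤ (z - y) * (2 / J * t) := fun y z h1 h2 h3 => by
    refine (h.tailSum_sub_le_mul (T := 2 * T) (by linarith) hJ0 hJ h2 (by linarith)).trans ?_
    have h4 : (0 : ℝ) ≤ z - y := by
      have : (y : ℝ) ≤ z := by exact_mod_cast h2
      linarith
    refine mul_le_mul_of_nonneg_left (mul_le_mul_of_nonneg_left ?_ (by positivity)) h4
    exact tailSum_anti h.nonneg h1
  -- Across a width of 2ω ≤ J/4 the tail loses at most half of t. As the window carries at least
  -- half of the weight, t is at most four times the mean.
  have hhalf : ∀ i, W i → t / 2 ≤ tailSum f n (Y i) := fun i hi => by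
    have h1 := hbound lo (Y i) le_rfl (hYlo i hi) (hYhi i hi)
    have h2 : ((Y i : ℝ) - lo) * (2 / J * t) ≤ (J / 4) * (2 / J * t) :=
      mul_le_mul_of_nonneg_right (by linarith [hYhi i hi]) (by positivity)
    have h3 : (J : ℝ) / 4 * (2 / J * t) = t / 2 := by field_simp; norm_num
    linarith
  have ht4 : t / 4 ≤ ∑ i ∈ s, w i * tailSum f n (Y i) := by
    have h1 : ∀ i ∈ s, t / 2 * (w i * (if W i then 1 else 0)) ≤ w i * tailSum f n (Y i) :=
      fun i _ => by
        have h0 := tailSum_nonneg (n := n) h.nonneg (Y i)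
        split_ifs with hi
        · nlinarith [hw0 i, hhalf i hi]
        · simpa using mul_nonneg (hw0 i) h0
    have h2 := Finset.sum_le_sum h1
    rw [← Finset.mul_sum, hW] at h2
    nlinarith
  set η := ∑ i ∈ s, w i * tailSum f n (Y i)
  have hfin : ∀ i j, W i → W j → Y i ≤ Y j →
      |tailSum f n (Y i) - tailSum f n (Y j)| ≤ 8 * η / J * |(Y i : ℝ) - Y j| := by
    intro i j hi hj hij
    rw [abs_of_nonneg (sub_nonneg.2 (tailSum_anti h.nonneg hij)), abs_sub_comm]
    have hij' : (0 : ℝ) ≤ Y j - Y i := by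
      have : (Y i : ℝ) ≤ Y j := by exact_mod_cast hij
      linarith
    rw [abs_of_nonneg hij']
    refine (hbound _ _ (hYlo i hi) hij (hYhi j hj)).trans ?_
    rw [mul_comm]
    refine mul_le_mul_of_nonneg_right ?_ hij'
    rw [div_mul_eq_mul_div]
    exact div_le_div_of_nonneg_right (by linarith) hJ'.le
  rcases le_total (Y i) (Y j) with hij | hij
  · exact hfin i j hi hj hij
  · rw [abs_sub_comm, abs_sub_comm (Y i : ℝ)]
    exact hfin j i hj hi hij

end Window

theorem binWeight_le_div_sqrt {p : ℝ} (h0 : 1 / 4 ≤ p) (h1 : p ≤ 3 / 4) {n : ℕ} (hn : 0 < n)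
    (k : ℕ) : binWeight p n k ≤ 48 / √n := by
  have hB := bell_binWeight h0 h1 hn
  have hn' : (0 : ℝ) < n := by exact_mod_cast hn
  have hs : 0 < √(n : ℝ) := Real.sqrt_pos.2 hn'
  have hsq : √(n : ℝ) * √n = n := Real.mul_self_sqrt hn'.le
  rw [le_div_iff₀ hs]
  rcases lt_or_ge (√(n : ℝ)) 12 with h | h
  · nlinarith [hB.le_one k, hB.nonneg k]
  -- For J ≥ 1 this gives 16(2J+2)J ≤ 64J² ≤ n/2, while √n < 12(J+1) ≤ 24J produces the constant 48.
  set J := ⌊√(n : ℝ) / 12⌋₊ with hJ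
  have hJ1 : (J : ℝ) ≤ √n / 12 := Nat.floor_le (by positivity)
  have hJ2 : √(n : ℝ) / 12 < J + 1 := Nat.lt_floor_add_one _
  have hJ3 : (1 : ℝ) ≤ J := by
    have : 1 ≤ J := Nat.le_floor (by push_cast; linarith)
    exact_mod_cast this
  have := hB.mul_le_two (J := J) (by nlinarith) k
  nlinarith [hB.nonneg k]

/-- The tail of a binomial distribution is Lipschitz on a window, with a constant that decays with
the distance of the window from the mean. -/
theorem abs_binTail_sub_le {p : ℝ} (h0 : 1 / 4 ≤ p) (h1 : p ≤ 3 / 4) {n : ℕ} (hn : 0 < n)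
    {y₁ ω μ : ℝ} (hω : 2 * ω ≤ √n) (hμ : μ = (2 * p - 1) * n - y₁) {y z : ℤ}
    (hy : |(y : ℝ) - y₁| ≤ ω) (hz : |(z : ℝ) - y₁| ≤ ω) :
    |tailSum (binWeight p n) n y - tailSum (binWeight p n) n z|
      ≤ 96 / √(1 + μ ^ 2 + n) * |(y : ℝ) - z| := by
  have hB := bell_binWeight h0 h1 hn
  have hn' : (0 : ℝ) < n := by exact_mod_cast hn
  have hn1 : (1 : ℝ) ≤ n := by exact_mod_cast hn
  have hs : 0 < √(n : ℝ) := Real.sqrt_pos.2 hn'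
  have hsq : √(n : ℝ) ^ 2 = n := Real.sq_sqrt hn'.le
  set Z := √(1 + μ ^ 2 + n) with hZ
  have hZ0 : 0 < Z := Real.sqrt_pos.2 (by positivity)
  have hZsq : Z ^ 2 = 1 + μ ^ 2 + n := Real.sq_sqrt (by positivity)
  rw [mul_comm]
  have hc0 : 0 ≤ 96 / Z := by positivity
  refine abs_tailSum_sub_le hB.nonneg hc0 (lo := ⌈y₁ - ω⌉) (hi := ⌊y₁ + ω⌋) ?_ ?_ ?_
  · have := abs_le.1 hy
    exact ⟨Int.ceil_le.2 (by linarith), Int.le_floor.2 (by linarith)⟩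
  · have := abs_le.1 hz
    exact ⟨Int.ceil_le.2 (by linarith), Int.le_floor.2 (by linarith)⟩
  · intro k _ hk
    have hk1 : y₁ - ω ≤ 2 * k - n := by
      have := Int.ceil_le.1 hk.1
      push_cast at this
      linarith
    have hk2 : 2 * (k : ℝ) - n ≤ y₁ + ω := by
      have := Int.le_floor.1 hk.2
      push_cast at this
      linarith
    rw [le_div_iff₀ hZ0]
    have hf := hB.nonneg k
    -- Near the mean the uniform bound 48/√n on atoms is used; far from it, an atom at k is at most
    -- 1/|k - np| and the window is too narrow to approach the mean.
    rcases le_or_gt |μ| (√n) with hc | hc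
    · have hZ2 : Z ≤ 2 * √n := by
        refine abs_le_of_sq_le_sq' ?_ (by positivity) |>.2
        have : μ ^ 2 ≤ √n ^ 2 := sq_le_sq.2 (by rwa [abs_of_pos hs])
        nlinarith
      have := binWeight_le_div_sqrt h0 h1 hn k
      rw [le_div_iff₀ hs] at this
      nlinarith
    · have hμ0 : 0 < |μ| := hs.trans hc
      have hZ2 : Z ≤ 2 * |μ| := by
        refine abs_le_of_sq_le_sq' ?_ (by positivity) |>.2
        have : √n ^ 2 ≤ |μ| ^ 2 := pow_le_pow_left₀ hs.le hc.le 2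
        rw [mul_pow, sq_abs] at *
        nlinarith
      have hd : |μ| / 4 ≤ |(k : ℝ) - n * p| := by
        have h2 : |μ| ≤ |2 * ((k : ℝ) - n * p)| + ω := by
          have h3 : |μ + 2 * ((k : ℝ) - n * p)| ≤ ω := abs_le.2 ⟨by rw [hμ]; linarith, by
            rw [hμ]; linarith⟩
          have h4 := abs_sub_abs_le_abs_sub μ (-(2 * ((k : ℝ) - n * p)))
          rw [abs_neg, sub_neg_eq_add] at h4
          linarith
        rw [abs_mul, abs_two] at h2
        linarith
      have := hB.mul_abs_sub_le k
      nlinarith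

theorem six_mul_coinsFrom {m i r : ℕ} (h : m = i + r) :
    6 * coinsFrom m (i + 1) = r * (r + 1) * (2 * r + 1) := by
  induction r generalizing i with
  | zero => simp [coinsFrom, h]
  | succ r ih =>
    rw [coinsFrom_eq_add (by omega), mul_add, ih (by omega), roundCoins,
      show m + 1 - (i + 1) = r + 1 by omega]
    ring

/-! ### The expected payoff functions -/

theorem card_filter_natAbs_le_two (V j : ℕ) :
    ((Finset.range (V + 1)).filter fun k : ℕ => (2 * (k : ℤ) - V).natAbs = j).card ≤ 2 := by
  refine (Finset.card_le_card (t := {(V + j) / 2, (V - j) / 2}) fun k hk => ?_).trans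
    Finset.card_le_two
  simp only [Finset.mem_filter, Finset.mem_range, Finset.mem_insert, Finset.mem_singleton] at hk ⊢
  omega

/-- Far values contribute at most B. Each near absolute value j comes from at most two k, of
probability at most q each. -/
theorem sum_mul_natAbs_le {f : ℕ → ℝ} {V : ℕ} (hf : ∀ k, 0 ≤ f k)
    (h1 : ∑ k ∈ Finset.range (V + 1), f k = 1) {q : ℝ} (hq : ∀ k, f k ≤ q) {h : ℕ → ℝ}
    (hh : ∀ j, 0 ≤ h j) {M : ℕ} {B : ℝ} (hB0 : 0 ≤ B) (hB : ∀ j, M < j → j ≤ V → h j ≤ B) :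
    ∑ k ∈ Finset.range (V + 1), f k * h (2 * (k : ℤ) - V).natAbs
      ≤ B + 2 * q * ∑ j ∈ Finset.range (M + 1), h j := by
  have hq0 : 0 ≤ q := (hf 0).trans (hq 0)
  have hterm : ∀ k ∈ Finset.range (V + 1), f k * h (2 * (k : ℤ) - V).natAbs
      ≤ f k * B + q * if (2 * (k : ℤ) - V).natAbs < M + 1 then h (2 * (k : ℤ) - V).natAbs else 0 := by
    intro k hk
    split_ifs with hc
    · have := mul_le_mul_of_nonneg_right (hq k) (hh (2 * (k : ℤ) - V).natAbs)
      have := mul_nonneg (hf k) hB0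
      linarith
    · rw [mul_zero, add_zero]
      refine mul_le_mul_of_nonneg_left (hB _ (by omega) ?_) (hf k)
      have := Finset.mem_range.1 hk
      omega
  refine (Finset.sum_le_sum hterm).trans ?_
  rw [Finset.sum_add_distrib, ← Finset.sum_mul, h1, one_mul, ← Finset.mul_sum, ← Finset.sum_filter]
  have hfib : ∑ k ∈ (Finset.range (V + 1)).filter (fun k : ℕ => (2 * (k : ℤ) - V).natAbs < M + 1),
      h (2 * (k : ℤ) - V).natAbs ≤ ∑ j ∈ Finset.range (M + 1), 2 * h j := by
    rw [← Finset.sum_fiberwise_of_maps_to (t := Finset.range (M + 1))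
      (g := fun k : ℕ => (2 * (k : ℤ) - V).natAbs)
      fun k hk => Finset.mem_range.2 (Finset.mem_filter.1 hk).2]
    refine Finset.sum_le_sum fun j _ => ?_
    rw [Finset.sum_congr rfl (g := fun _ => h j) fun k hk => by rw [(Finset.mem_filter.1 hk).2],
      Finset.sum_const, nsmul_eq_mul]
    refine mul_le_mul_of_nonneg_right ?_ (hh j)
    have := (Finset.card_le_card (Finset.filter_subset_filter
      (fun k : ℕ => (2 * (k : ℤ) - V).natAbs = j) (Finset.filter_subset
      (fun k : ℕ => (2 * (k : ℤ) - V).natAbs < M + 1) (Finset.range (V + 1))))).trans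
      (card_filter_natAbs_le_two V j)
    exact ((Nat.cast_le (α := ℝ)).2 this).trans_eq (by norm_num)
  rw [← Finset.mul_sum] at hfib
  have := mul_le_mul_of_nonneg_left hfib hq0
  linarith

/-- Comparison with the integral of x^(-2/3): consecutive cube roots B ≤ A satisfy A³ - B³ = 1, so A
- B ≥ 1/(3A²), and the sum telescopes. -/
theorem sum_rpow_neg_third_le (M : ℕ) :
    ∑ j ∈ Finset.range (M + 1), (1 + (j : ℝ) ^ 2) ^ (-(1 / 3) : ℝ)
      ≤ 1 + 3 * (M : ℝ) ^ (1 / 3 : ℝ) := by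
  induction M with
  | zero => simp
  | succ M ih =>
    rw [Finset.sum_range_succ]
    set A := ((M + 1 : ℕ) : ℝ) ^ (1 / 3 : ℝ) with hA
    set B := (M : ℝ) ^ (1 / 3 : ℝ) with hB
    have hA3 : A ^ 3 = M + 1 := by
      rw [hA, ← Real.rpow_natCast, ← Real.rpow_mul (by positivity)]
      norm_num
    have hB3 : B ^ 3 = M := by
      rw [hB, ← Real.rpow_natCast, ← Real.rpow_mul (by positivity)]
      norm_num
    have hB0 : 0 ≤ B := by positivity
    have hA0 : 0 < A := by positivity
    have hBA : B ≤ A := Real.rpow_le_rpow (by positivity) (by push_cast; linarith) (by norm_num)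
    have h1 : (1 + ((M + 1 : ℕ) : ℝ) ^ 2) ^ (-(1 / 3) : ℝ) ≤ (A ^ 2)⁻¹ := by
      have e : A ^ 2 = (((M + 1 : ℕ) : ℝ) ^ 2) ^ (1 / 3 : ℝ) := by
        rw [hA, ← Real.rpow_natCast, ← Real.rpow_natCast, ← Real.rpow_mul (by positivity),
          ← Real.rpow_mul (by positivity), mul_comm]
      rw [Real.rpow_neg (by positivity), e]
      refine inv_anti₀ (by positivity) (Real.rpow_le_rpow (by positivity) (by linarith) (by norm_num))
    have h2 : (A ^ 2)⁻¹ ≤ 3 * (A - B) := by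
      rw [inv_eq_one_div, div_le_iff₀ (by positivity)]
      have hd : 0 ≤ A - B := by linarith
      nlinarith [mul_nonneg hd hA0.le, mul_nonneg hd hB0, mul_nonneg hd hd]
    linarith

theorem sum_rpow_neg_one_le (M : ℕ) :
    ∑ j ∈ Finset.range (M + 1), (1 + (j : ℝ) ^ 2) ^ (-1 : ℝ) ≤ 4 := by
  have : ∑ j ∈ Finset.range (M + 1), (1 + (j : ℝ) ^ 2) ^ (-1 : ℝ) ≤ 4 - 2 / ((M : ℝ) + 1) := by
    induction M with
    | zero => norm_num
    | succ M ih =>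
      rw [Finset.sum_range_succ, Real.rpow_neg_one]
      have : (1 + ((M + 1 : ℕ) : ℝ) ^ 2)⁻¹ ≤ 2 / ((M : ℝ) + 1) - 2 / ((M + 1 : ℕ) + 1) := by
        have hM : (0 : ℝ) ≤ M := Nat.cast_nonneg M
        push_cast
        rw [inv_eq_one_div, div_sub_div _ _ (by positivity) (by positivity),
          div_le_div_iff₀ (by positivity) (by positivity)]
        nlinarith
      linarith
  have h2 : (0 : ℝ) ≤ 2 / (M + 1) := by positivity
  linarith

/-- The function whose conditional expectations dominate the effect of the hints. -/
def payoff (β : ℝ) (y : ℤ) : ℝ := (1 + (y : ℝ) ^ 2) ^ (-β)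

theorem payoff_nonneg (β : ℝ) (y : ℤ) : 0 ≤ payoff β y := by unfold payoff; positivity

theorem isBdd_payoff {β : ℝ} (hβ : 0 ≤ β) : IsBdd (payoff β) :=
  IsBdd.of_mem_Icc fun y => ⟨payoff_nonneg β y,
    Real.rpow_le_one_of_one_le_of_nonpos (by nlinarith [sq_nonneg (y : ℝ)]) (by linarith)⟩

theorem payoff_eq (β : ℝ) (y : ℤ) : payoff β y = (1 + (y.natAbs : ℝ) ^ 2) ^ (-β) := by
  rw [payoff, Nat.cast_natAbs, Int.cast_abs, sq_abs]

/-! ### Mean payoffs under the law of the final sum -/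

section Expectation

variable {ε : Set.Icc (-1 : ℝ) 1} {m V : ℕ}

/-- Cut at √V. Beyond it the payoff is at most V^(-1/3); below it the atoms are O(V^(-1/2)) and the
payoffs sum to O(V^(1/6)). Both parts are O(V^(-1/3)) = O(1/m). -/
theorem mean_payoff_third_le (h0 : 1 / 4 ≤ headProb ε) (h1 : headProb ε ≤ 3 / 4) (hm : 0 < m)
    (hV : m ^ 3 ≤ 8 * V) : mean (coinSum ε V) (payoff (1 / 3)) ≤ 770 / m := by
  have hm' : (0 : ℝ) < m := by exact_mod_cast hm
  have hV' : (m : ℝ) ^ 3 ≤ 8 * V := by exact_mod_cast hV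
  have hm3 : (0 : ℝ) < (m : ℝ) ^ 3 := by positivity
  have hV0' : (0 : ℝ) < V := by linarith
  have hV0 : 0 < V := by exact_mod_cast hV0'
  rw [mean_coinSum _ _ (isBdd_payoff (by norm_num))]
  simp only [payoff_eq]
  set x := (V : ℝ) ^ (1 / 6 : ℝ) with hx
  have hx0 : 0 < x := by positivity
  have hx6 : x ^ 6 = V := by
    rw [hx, ← Real.rpow_natCast, ← Real.rpow_mul (by positivity)]
    norm_num
  have hx3 : x ^ 3 = √V := by
    rw [eq_comm, Real.sqrt_eq_iff_mul_self_eq (by positivity) (by positivity), ← hx6]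
    ring
  have hx2 : (V : ℝ) ^ (-(1 / 3) : ℝ) = (x ^ 2)⁻¹ := by
    rw [Real.rpow_neg (by positivity), hx, ← Real.rpow_natCast, ← Real.rpow_mul (by positivity)]
    norm_num
  have hxm : (m : ℝ) / 2 ≤ x ^ 2 := by
    refine le_of_pow_le_pow_left₀ (n := 3) (by norm_num) (by positivity) ?_
    rw [← pow_mul, hx6, div_pow]
    linarith
  have hmain := sum_mul_natAbs_le (f := binWeight (headProb ε) V) (V := V)
    (binWeight_nonneg (by linarith) (by linarith) V) (sum_binWeight _ V)
    (binWeight_le_div_sqrt h0 h1 hV0) (h := fun j => (1 + (j : ℝ) ^ 2) ^ (-(1 / 3) : ℝ))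
    (fun j => by positivity) (M := Nat.sqrt V) (B := (V : ℝ) ^ (-(1 / 3) : ℝ)) (by positivity)
    (fun j hj _ => by
      refine Real.rpow_le_rpow_of_nonpos hV0' ?_ (by norm_num)
      have : V < j ^ 2 := (Nat.lt_succ_sqrt' V).trans_le (Nat.pow_le_pow_left hj 2)
      have : (V : ℝ) < (j : ℝ) ^ 2 := by exact_mod_cast this
      linarith)
  refine hmain.trans ?_
  have hM : ((Nat.sqrt V : ℕ) : ℝ) ^ (1 / 3 : ℝ) ≤ x := by
    have h2 : ((Nat.sqrt V : ℕ) : ℝ) ≤ x ^ 3 := by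
      rw [hx3]
      exact Real.nat_sqrt_le_real_sqrt
    refine (Real.rpow_le_rpow (by positivity) h2 (by norm_num)).trans_eq ?_
    rw [← Real.rpow_natCast, ← Real.rpow_mul hx0.le]
    norm_num
  have hx1 : 1 ≤ x := Real.one_le_rpow (by exact_mod_cast hV0) (by norm_num)
  have hS := (sum_rpow_neg_third_le (Nat.sqrt V)).trans
    (show _ ≤ 4 * x by linarith)
  have hinv : (x ^ 2)⁻¹ ≤ 2 / m := by
    rw [inv_eq_one_div, div_le_div_iff₀ (by positivity) hm']
    linarith
  calc _ ≤ (x ^ 2)⁻¹ + 2 * (48 / x ^ 3) * (4 * x) := by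
        rw [hx2, ← hx3]
        gcongr
    _ = 385 * (x ^ 2)⁻¹ := by field_simp; norm_num
    _ ≤ 385 * (2 / m) := by gcongr
    _ = 770 / m := by ring

/-- This payoff is summable over the integers, so its mean is O(V^(-1/2)) = O(m^(-3/2)), which
leaves room for the factor √m. -/
theorem mean_payoff_one_le (h0 : 1 / 4 ≤ headProb ε) (h1 : headProb ε ≤ 3 / 4) (hm : 0 < m)
    (hV : m ^ 3 ≤ 8 * V) : √m * mean (coinSum ε V) (payoff 1) ≤ 1152 / m := by
  have hm' : (0 : ℝ) < m := by exact_mod_cast hm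
  have hV' : (m : ℝ) ^ 3 ≤ 8 * V := by exact_mod_cast hV
  have hm3 : (0 : ℝ) < (m : ℝ) ^ 3 := by positivity
  have hV0' : (0 : ℝ) < V := by linarith
  have hV0 : 0 < V := by exact_mod_cast hV0'
  have hs : 0 < √(V : ℝ) := Real.sqrt_pos.2 hV0'
  rw [mean_coinSum _ _ (isBdd_payoff (by norm_num))]
  simp only [payoff_eq]
  have hmain := sum_mul_natAbs_le (f := binWeight (headProb ε) V) (V := V)
    (binWeight_nonneg (by linarith) (by linarith) V) (sum_binWeight _ V)
    (binWeight_le_div_sqrt h0 h1 hV0) (h := fun j => (1 + (j : ℝ) ^ 2) ^ (-1 : ℝ))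
    (fun j => by positivity) (M := V) (B := 0) le_rfl
    (fun j hj hj' => by omega)
  have hq : 0 ≤ 2 * (48 / √(V : ℝ)) := by positivity
  have h4 : ∑ k ∈ Finset.range (V + 1), binWeight (headProb ε) V k *
      (1 + ((2 * (k : ℤ) - V).natAbs : ℝ) ^ 2) ^ (-1 : ℝ) ≤ 384 / √V := by
    refine hmain.trans ?_
    have := mul_le_mul_of_nonneg_left (sum_rpow_neg_one_le V) hq
    refine (show _ ≤ 2 * (48 / √(V : ℝ)) * 4 by linarith).trans_eq ?_
    ring
  refine (mul_le_mul_of_nonneg_left h4 (Real.sqrt_nonneg _)).trans ?_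
  rw [← mul_div_assoc, div_le_div_iff₀ hs hm']
  have h5 : √(m : ℝ) * m ≤ 3 * √V := by
    refine abs_le_of_sq_le_sq' ?_ (by positivity) |>.2
    rw [mul_pow, mul_pow, Real.sq_sqrt hm'.le, Real.sq_sqrt hV0'.le]
    nlinarith
  nlinarith

end Expectation

/-! ### One round, early in the game -/

theorem sum_weight_window_le {p : ℝ} (h0 : 0 ≤ p) (h1 : p ≤ 1) {l : ℕ} (hl : 0 < l) {Λ : ℝ}
    (hΛ : 0 ≤ Λ) :
    ∑ k ∈ Finset.range (l + 1), binWeight p l k *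
      (if |2 * ((k : ℝ) - l * p)| < 16 * √(l * Λ) then 0 else 1) ≤ 2 * Real.exp (-(16 * Λ)) := by
  have hl' : (0 : ℝ) < l := by exact_mod_cast hl
  have := sum_binWeight_tail_le h0 h1 hl' le_rfl (t := 16 * √(l * Λ)) (by positivity)
  rw [mul_pow, Real.sq_sqrt (by positivity),
    show (16 : ℝ) ^ 2 * (l * Λ) / (16 * l) = 16 * Λ by field_simp] at this
  refine (Finset.sum_le_sum fun k _ => ?_).trans this
  refine mul_le_mul_of_nonneg_left ?_ (binWeight_nonneg h0 h1 l k)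
  by_cases h : 16 * √(l * Λ) ≤ |2 * ((k : ℝ) - l * p)|
  · rw [if_neg (not_lt.2 h), if_pos h]
  · rw [if_pos (not_le.1 h), if_neg h]

/-- The scales of an early round: T = 8√(nΛ) is the range of thresholds, ω = 16√(r²Λ) the window of
the coin sum, and J, of order √(n/Λ), the inverse hazard rate. The requirement 8ω ≤ J amounts to √r
being large compared with Λ, hence the lower bound on r. -/
theorem early_parameters {n r : ℕ} {Λ : ℝ} (hn0 : 0 < n) (hΛ : 1 ≤ Λ) (hrn : r ^ 3 ≤ 8 * n)
    (hr : 10 ^ 12 * Λ ^ 2 ≤ r) :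
    ∃ J : ℕ, 0 < J ∧ √n / (2432 * √Λ) ≤ J ∧
      32 * (2 * (8 * (√n * √Λ)) + J + 2) * J ≤ (n : ℝ) / 2 ∧ 4 ≤ 8 * (√(n : ℝ) * √Λ) ∧
      16 * √((r ^ 2 : ℕ) * Λ) ≤ 8 * (√n * √Λ) ∧ 8 * (16 * √((r ^ 2 : ℕ) * Λ)) ≤ J ∧
      2 * (16 * √((r ^ 2 : ℕ) * Λ)) ≤ √n := by
  have hn' : (0 : ℝ) < n := by exact_mod_cast hn0
  have hr1 : (1 : ℝ) ≤ r := by nlinarith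
  set a := √(n : ℝ) with ha
  set L := √Λ with hL
  set ρ := √(r : ℝ) with hρ
  have ha0 : 0 < a := Real.sqrt_pos.2 hn'
  have ha2 : a ^ 2 = n := Real.sq_sqrt hn'.le
  have hL2 : L ^ 2 = Λ := Real.sq_sqrt (by linarith)
  have hL1 : 1 ≤ L := Real.one_le_sqrt.2 hΛ
  have hL0 : 0 < L := by linarith
  have hLL : L ≤ L ^ 2 := by nlinarith
  have hρ2 : ρ ^ 2 = r := Real.sq_sqrt (by linarith)
  have hρ0 : 0 ≤ ρ := Real.sqrt_nonneg _
  have hρL : 10 ^ 6 * L ^ 2 ≤ ρ := by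
    refine (abs_le_of_sq_le_sq' ?_ hρ0).2
    rw [mul_pow, hρ2, hL2]
    linarith
  have haρ : ρ ^ 3 / 3 ≤ a := by
    refine (abs_le_of_sq_le_sq' ?_ ha0.le).2
    have : (r : ℝ) ^ 3 ≤ 8 * n := by exact_mod_cast hrn
    rw [ha2, div_pow, ← pow_mul, show 3 * 2 = 2 * 3 from rfl, pow_mul, hρ2]
    linarith [show (0 : ℝ) < (r : ℝ) ^ 3 by positivity]
  have hρ21 : 1 ≤ ρ ^ 2 := by rw [hρ2]; exact hr1
  have haρL : 10 ^ 6 * L ^ 2 * ρ ^ 2 ≤ 3 * a := by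
    have := mul_le_mul_of_nonneg_right hρL (sq_nonneg ρ)
    linarith [show ρ ^ 3 = ρ * ρ ^ 2 by ring]
  have hLρ : L * ρ ^ 2 ≤ L ^ 2 * ρ ^ 2 := mul_le_mul_of_nonneg_right hLL (sq_nonneg ρ)
  have hL1ρ : ρ ^ 2 ≤ L * ρ ^ 2 := le_mul_of_one_le_left (sq_nonneg ρ) hL1
  have hLLρ : L ^ 2 ≤ L ^ 2 * ρ ^ 2 := le_mul_of_one_le_right (sq_nonneg L) hρ21
  have haL : 10 ^ 5 * L ≤ a := by linarith
  have haaL : a ≤ a * L := le_mul_of_one_le_right ha0.le hL1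
  have hωr : 16 * √((r ^ 2 : ℕ) * Λ) = 16 * (L * ρ ^ 2) := by
    rw [Nat.cast_pow, Real.sqrt_mul (by positivity), Real.sqrt_sq (by linarith), hρ2]
    ring
  -- Bounding 16aL + J + 2 by 18aL, the hazard condition asks for J ≤ a/(1152L); the constant 1216
  -- satisfies it, and rounding down loses at most a further factor 2.
  set J := ⌊a / (1216 * L)⌋₊ with hJ
  have hJ1 : (J : ℝ) ≤ a / (1216 * L) := Nat.floor_le (by positivity)
  have hJ2 : a / (1216 * L) < J + 1 := Nat.lt_floor_add_one _
  have hJ3 : a / (2432 * L) ≤ J := by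
    have e : a / (1216 * L) = 2 * (a / (2432 * L)) := by field_simp; norm_num
    have : 1 ≤ a / (2432 * L) := by
      rw [le_div_iff₀ (by positivity)]
      linarith
    linarith
  have hJpos : (0 : ℝ) < J := lt_of_lt_of_le (by positivity) hJ3
  have hJL : J * (1216 * L) ≤ a := (le_div_iff₀ (by positivity)).1 hJ1
  rw [hωr]
  refine ⟨J, by exact_mod_cast hJpos, hJ3, ?_, by linarith, ?_, ?_, by linarith⟩
  · rw [← ha2]
    have e0 : (J : ℝ) ≤ J * L := le_mul_of_one_le_right hJpos.le hL1
    have e3 : 32 * (2 * (8 * (a * L)) + J + 2) * J ≤ 32 * (18 * (a * L)) * J := by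
      gcongr
      linarith
    have e4 : a * (J * (1216 * L)) ≤ a * a := mul_le_mul_of_nonneg_left hJL ha0.le
    have e5 : 32 * (18 * (a * L)) * J = 576 / 1216 * (a * (J * (1216 * L))) := by ring
    have e6 : 0 ≤ a * a := by positivity
    rw [sq]
    linarith
  · have e1 : 2 * ρ ^ 2 ≤ a := by linarith
    have := mul_le_mul_of_nonneg_left e1 hL0.le
    linarith
  · refine le_trans ?_ hJ3
    rw [le_div_iff₀ (by positivity)]
    have e1 : 8 * (16 * (L * ρ ^ 2)) * (2432 * L) = 311296 * (L ^ 2 * ρ ^ 2) := by ring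
    rw [e1]
    linarith

/-- The tail error and the window error together stay below exp(-2Λ), the smallest hint probability
considered, even after the union over n + 1 atoms. -/
theorem early_exp_lt {n Λ : ℝ} (hΛ : 1 ≤ Λ) (hn : n + 1 ≤ Real.exp (3 * Λ)) :
    2 * Real.exp (-(16 * Λ)) ≤ 1 / 2 ∧
      (n + 1) * Real.exp (-(8 * Λ)) + 2 * Real.exp (-(16 * Λ)) < Real.exp (-(2 * Λ)) := by
  have h1 : Real.exp (-1) ≤ 1 / 2 := by
    have h2 : (2 : ℝ) ≤ Real.exp 1 := by linarith [Real.add_one_le_exp 1]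
    rw [Real.exp_neg, inv_eq_one_div]
    exact one_div_le_one_div_of_le (by norm_num) h2
  have h3 : Real.exp (-3) ≤ 1 / 8 := by
    have : Real.exp (-3) = Real.exp (-1) ^ 3 := by rw [← Real.exp_nat_mul]; norm_num
    rw [this]
    exact (pow_le_pow_left₀ (Real.exp_nonneg _) h1 3).trans (by norm_num)
  have hx := Real.exp_pos (-(2 * Λ))
  have h4 : (n + 1) * Real.exp (-(8 * Λ)) ≤ Real.exp (-(2 * Λ)) * (1 / 8) := by
    calc _ ≤ Real.exp (3 * Λ) * Real.exp (-(8 * Λ)) := by gcongr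
      _ = Real.exp (-(2 * Λ)) * Real.exp (-(3 * Λ)) := by
        rw [← Real.exp_add, ← Real.exp_add]; congr 1; ring
      _ ≤ Real.exp (-(2 * Λ)) * Real.exp (-3) := by gcongr; linarith
      _ ≤ _ := by gcongr
  have h5 : Real.exp (-(16 * Λ)) ≤ Real.exp (-(2 * Λ)) * (1 / 8) := by
    calc _ = Real.exp (-(2 * Λ)) * Real.exp (-(14 * Λ)) := by
          rw [← Real.exp_add]; congr 1; ring
      _ ≤ Real.exp (-(2 * Λ)) * Real.exp (-3) := by gcongr; linarith
      _ ≤ _ := by gcongr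
  have h6 : Real.exp (-(2 * Λ)) ≤ 1 := Real.exp_le_one_iff.2 (by linarith)
  constructor <;> linarith

/-- The covariance bound with two Lipschitz constants, that of the hint being proportional to η, so
that η cancels in the main term. In the error term, division by η ≥ exp(-2Λ) turns exp(-16Λ) into
exp(-14Λ). The sign σ and the shift y₀ cover both values of the hint; the constant is 96 · 8 · 2432.
-/
theorem abs_round_early_le {p : ℝ} (h0 : 1 / 4 ≤ p) (h1 : p ≤ 3 / 4) {f : ℕ → ℝ} {n r : ℕ}
    {k₀ Λ : ℝ} (hf : Bell f n k₀ 32) (hΛ : 1 ≤ Λ) (hrn : r ^ 3 ≤ 8 * n)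
    (hr : 10 ^ 12 * Λ ^ 2 ≤ r) (hnΛ : (n : ℝ) + 1 ≤ Real.exp (3 * Λ)) {σ : ℤ} (hσ : |σ| = 1)
    (y₀ b : ℤ) {μ η : ℝ} (hμ : μ = b + (2 * p - 1) * (r ^ 2 : ℕ) + (2 * p - 1) * n)
    (hη : η = ∑ k ∈ Finset.range (r ^ 2 + 1), binWeight p (r ^ 2) k
      * tailSum f n (σ * (2 * k - (r ^ 2 : ℕ)) + y₀))
    (hηΛ : Real.exp (-(2 * Λ)) ≤ η) :
    |(∑ k ∈ Finset.range (r ^ 2 + 1), binWeight p (r ^ 2) k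
        * (tailSum f n (σ * (2 * k - (r ^ 2 : ℕ)) + y₀)
          * tailSum (binWeight p n) n (-(b + (2 * k - (r ^ 2 : ℕ)))))) / η
      - ∑ k ∈ Finset.range (r ^ 2 + 1), binWeight p (r ^ 2) k
        * tailSum (binWeight p n) n (-(b + (2 * k - (r ^ 2 : ℕ))))|
      ≤ 1867776 * √Λ * (r ^ 2 / (√n * √(1 + μ ^ 2 + n))) + 2 * Real.exp (-(14 * Λ)) := by
  have hp0 : 0 ≤ p := by linarith
  have hp1 : p ≤ 1 := by linarith
  have hn0 : 0 < n := hf.pos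
  have hn' : (0 : ℝ) < n := by exact_mod_cast hn0
  have hBb := bell_binWeight h0 h1 hn0
  set l := r ^ 2 with hl
  have hlr : (l : ℝ) = (r : ℝ) ^ 2 := by rw [hl]; push_cast; rfl
  have hr0 : (0 : ℝ) < r := by nlinarith
  have hl0' : (0 : ℝ) < l := by rw [hlr]; positivity
  have hl0 : 0 < l := by exact_mod_cast hl0'
  obtain ⟨J, hJ0, hJ3, hJcond, hT4, hωT, hωJ, hωa⟩ := early_parameters hn0 hΛ hrn hr
  obtain ⟨hτ', hexp⟩ := early_exp_lt hΛ hnΛ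
  have hJpos : (0 : ℝ) < J := by exact_mod_cast hJ0
  have hL0 : 0 < √Λ := Real.sqrt_pos.2 (by linarith)
  have ha0 : 0 < √(n : ℝ) := Real.sqrt_pos.2 hn'
  rw [← hl] at hωT hωJ hωa
  set ω := 16 * √((l : ℝ) * Λ) with hω
  have hT2 : (8 * (√n * √Λ)) ^ 2 / (8 * n) = 8 * Λ := by
    rw [mul_pow, mul_pow, Real.sq_sqrt hn'.le, Real.sq_sqrt (by linarith)]
    field_simp
  have hη0 : 0 < η := (Real.exp_pos _).trans_le hηΛ
  have hw0 := binWeight_nonneg (n := l) hp0 hp1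
  have hw1 := sum_binWeight p l
  have hτ := sum_weight_window_le hp0 hp1 hl0 (show 0 ≤ Λ by linarith)
  set X : ℕ → ℝ := fun k => 2 * k - l with hX
  set y₁ : ℝ := (2 * p - 1) * l with hy₁
  have hXc : ∀ k : ℕ, X k - y₁ = 2 * ((k : ℝ) - l * p) := fun k => by rw [hX, hy₁]; ring
  have hσR : |(σ : ℝ)| = 1 := by exact_mod_cast congrArg (Int.cast : ℤ → ℝ) hσ
  have hFW : ∀ i j : ℕ, |2 * ((i : ℝ) - l * p)| < ω → |2 * ((j : ℝ) - l * p)| < ω →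
      |tailSum f n (σ * (2 * i - (l : ℕ)) + y₀) - tailSum f n (σ * (2 * j - (l : ℕ)) + y₀)|
        ≤ 8 * η / J * |X i - X j| := fun i j hi hj => by
    have := hf.abs_tailSum_sub_le_mul (s := Finset.range (l + 1)) hw0 hw1
      (Y := fun k : ℕ => σ * (2 * k - (l : ℕ)) + y₀)
      (W := fun k : ℕ => |2 * ((k : ℝ) - l * p)| < ω) (T := 8 * (√n * √Λ)) (ω := ω)
      (τ := 2 * Real.exp (-(16 * Λ))) (y₁ := σ * y₁ + y₀) (J := J) hT4 hJ0 hJcond hωT hωJ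
      (fun k hk => by
        push_cast
        rw [show (σ : ℝ) * (2 * k - l) + y₀ - (σ * y₁ + y₀) = σ * (X k - y₁) by rw [hX]; ring,
          abs_mul, hσR, one_mul, hXc]
        exact hk.le) hτ hτ' (by rw [← hη, hT2]; exact hexp.trans_le hηΛ) hi hj
    rw [← hη] at this
    refine this.trans_eq ?_
    congr 1
    push_cast
    rw [show (σ : ℝ) * (2 * i - l) + y₀ - (σ * (2 * j - l) + y₀) = σ * (X i - X j) by rw [hX]; ring,
      abs_mul, hσR, one_mul]
  have hgW : ∀ i j : ℕ, |2 * ((i : ℝ) - l * p)| < ω → |2 * ((j : ℝ) - l * p)| < ω →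
      |tailSum (binWeight p n) n (-(b + (2 * i - (l : ℕ))))
        - tailSum (binWeight p n) n (-(b + (2 * j - (l : ℕ))))|
        ≤ 96 / √(1 + μ ^ 2 + n) * |X i - X j| := fun i j hi hj => by
    have hy : ∀ k : ℕ, |2 * ((k : ℝ) - l * p)| < ω →
        |((-(b + (2 * k - (l : ℕ))) : ℤ) : ℝ) - -(b + y₁)| ≤ ω := fun k hk => by
      push_cast
      rw [show -((b : ℝ) + (2 * k - l)) - -(b + y₁) = -(X k - y₁) by rw [hX]; ring, abs_neg, hXc]
      exact hk.le
    refine (abs_binTail_sub_le (μ := μ) h0 h1 hn0 hωa (by rw [hμ]; ring) (hy i hi) (hy j hj)).trans_eq ?_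
    congr 1
    push_cast
    rw [show -((b : ℝ) + (2 * i - l)) - -(b + (2 * j - l)) = -(X i - X j) by rw [hX]; ring,
      abs_neg]
  have hv : ∑ k ∈ Finset.range (l + 1), binWeight p l k * (X k - y₁) ^ 2 ≤ l := by
    have := sum_binWeight_mul_shift_sq (p := p) l (-y₁)
    have e : ∀ k : ℕ, X k - y₁ = -y₁ + (2 * k - l) := fun k => by rw [hX]; ring
    simp only [e]
    rw [this, hy₁]
    nlinarith [mul_nonneg hl0'.le (sq_nonneg (2 * p - 1))]
  have hcov := abs_covariance_le (s := Finset.range (l + 1)) hw0 hw1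
    (F := fun k : ℕ => tailSum f n (σ * (2 * k - (l : ℕ)) + y₀))
    (g := fun k : ℕ => tailSum (binWeight p n) n (-(b + (2 * k - (l : ℕ)))))
    (fun k => ⟨tailSum_nonneg hf.nonneg _, tailSum_le_one hf.nonneg hf.sum_one _⟩)
    (fun k => ⟨tailSum_nonneg hBb.nonneg _, tailSum_le_one hBb.nonneg hBb.sum_one _⟩)
    (X := X) (W := fun k : ℕ => |2 * ((k : ℝ) - l * p)| < ω)
    (A := 96 / √(1 + μ ^ 2 + n)) (B := 8 * η / J) (by positivity) (by positivity) hFW hgW hv hτ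
  rw [← hη] at hcov
  set Z := √(1 + μ ^ 2 + n) with hZ
  have hZ0 : 0 < Z := Real.sqrt_pos.2 (by positivity)
  rw [div_sub' hη0.ne', abs_div, abs_of_pos hη0, div_le_iff₀ hη0]
  refine hcov.trans ?_
  rw [add_mul]
  refine add_le_add ?_ ?_
  · have hJinv : 1 / (J : ℝ) ≤ 2432 * √Λ / √n := by
      rw [div_le_div_iff₀ hJpos ha0, one_mul]
      have := (div_le_iff₀ (by positivity)).1 hJ3
      linarith
    calc 96 / Z * (8 * η / J) * l = 96 / Z * 8 * η * l * (1 / J) := by ring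
      _ ≤ 96 / Z * 8 * η * l * (2432 * √Λ / √n) := by gcongr
      _ = 1867776 * √Λ * (r ^ 2 / (√n * Z)) * η := by
        rw [hlr]
        field_simp
        norm_num
  · have : Real.exp (-(16 * Λ)) = Real.exp (-(14 * Λ)) * Real.exp (-(2 * Λ)) := by
      rw [← Real.exp_add]; congr 1; ring
    rw [this, ← mul_assoc]
    gcongr

/-- With r² ≤ 4n^(2/3) the left side is O(n^(1/6)) times the power -1/2 of 1+μ²+n, hence O of its
power -1/3. Replacing μ by y costs a constant, because they differ by at most √n. -/
theorem div_sqrt_mul_sqrt_le_rpow {n r : ℕ} {μ y : ℝ} (hn : 0 < n) (hrn : r ^ 3 ≤ 8 * n)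
    (hy : (y - μ) ^ 2 ≤ n) :
    (r : ℝ) ^ 2 / (√n * √(1 + μ ^ 2 + n)) ≤ 6 * (1 + y ^ 2 + n) ^ (-(1 / 3) : ℝ) := by
  have hn' : (0 : ℝ) < n := by exact_mod_cast hn
  set a := √(n : ℝ) with ha
  have ha0 : 0 < a := Real.sqrt_pos.2 hn'
  have ha2 : a ^ 2 = n := Real.sq_sqrt hn'.le
  set Z := √(1 + μ ^ 2 + n) with hZ
  have hZ0 : 0 < Z := Real.sqrt_pos.2 (by positivity)
  have hZ2 : Z ^ 2 = 1 + μ ^ 2 + n := Real.sq_sqrt (by positivity)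
  have haZ : a ≤ Z := Real.sqrt_le_sqrt (by nlinarith [sq_nonneg μ])
  set x := 1 + y ^ 2 + (n : ℝ) with hx
  have hx0 : 0 < x := by positivity
  have hxZ : x ≤ 3 * Z ^ 2 := by
    rw [hx, hZ2]
    nlinarith [sq_nonneg (y - 2 * μ)]
  have hu3 : (x ^ (-(1 / 3) : ℝ)) ^ 3 = 1 / x := by
    rw [← Real.rpow_natCast, ← Real.rpow_mul hx0.le,
      show (-(1 / 3) : ℝ) * ((3 : ℕ) : ℝ) = -1 by norm_num, Real.rpow_neg_one, one_div]
  refine le_of_pow_le_pow_left₀ (n := 3) (by norm_num) (by positivity) ?_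
  rw [mul_pow, hu3, div_pow, mul_pow, mul_one_div, div_le_div_iff₀ (by positivity) hx0]
  have hr : (r : ℝ) ^ 3 ≤ 8 * a ^ 2 := by
    rw [ha2]; exact_mod_cast hrn
  have hr6 : ((r : ℝ) ^ 2) ^ 3 ≤ 64 * a ^ 4 := by
    have := pow_le_pow_left₀ (by positivity) hr 2
    nlinarith
  calc ((r : ℝ) ^ 2) ^ 3 * x ≤ 64 * a ^ 4 * (3 * Z ^ 2) := by gcongr
    _ = 192 * (a ^ 3 * Z ^ 2) * a := by ring
    _ ≤ 192 * (a ^ 3 * Z ^ 2) * Z := by gcongr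
    _ ≤ 6 ^ 3 * (a ^ 3 * Z ^ 3) := by
      have : 0 < a ^ 3 * Z ^ 3 := by positivity
      nlinarith

/-! ### The hypergeometric game -/

theorem mean_coinSum_tail_le (ε : Set.Icc (-1 : ℝ) 1) {n : ℕ} {V t : ℝ} (hV : 0 < V) (hn : n ≤ V)
    (ht : 0 ≤ t) :
    mean (coinSum ε n) (fun c => if t ≤ |(c : ℝ) - (2 * headProb ε - 1) * n| then 1 else 0)
      ≤ 2 * Real.exp (-(t ^ 2 / (16 * V))) := by
  rw [mean_coinSum _ _ (IsBdd.ite _)]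
  have h : ∀ k : ℕ, (((2 * (k : ℤ) - n : ℤ) : ℝ) - (2 * headProb ε - 1) * n)
      = 2 * ((k : ℝ) - n * headProb ε) := fun k => by push_cast; ring
  simp only [h]
  exact sum_binWeight_tail_le (headProb_nonneg ε) (headProb_le_one ε) hV hn ht

theorem sq_div_sixteen {V Λ : ℝ} (hV : 0 < V) (hΛ : 0 ≤ Λ) :
    (16 * √(V * Λ)) ^ 2 / (16 * V) = 16 * Λ := by
  rw [mul_pow, Real.sq_sqrt (by positivity)]
  field_simp

/-! ### Rare hints, decided games and late rounds -/

namespace Game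

variable {m : ℕ} {H : Type} (G : Game m H)

/-- The probability that the hint of round `i` is `h`, given that the sum of the coins before the
round is `b`. -/
def hintProb (i : ℕ) (b : ℤ) (h : H) : ℝ :=
  mean (coinSum G.eps (roundCoins m i)) fun c => (G.hint i b c h).toReal

theorem isBdd_hint (i : ℕ) (b : ℤ) (h : H) : IsBdd fun c => (G.hint i b c h).toReal :=
  IsBdd.of_mem_Icc fun c => ⟨ENNReal.toReal_nonneg,
    ENNReal.toReal_le_of_le_ofReal zero_le_one (by simpa using (G.hint i b c).coe_le_one h)⟩

theorem hint_toReal_le_one (i : ℕ) (b c : ℤ) (h : H) : (G.hint i b c h).toReal ≤ 1 :=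
  ENNReal.toReal_le_of_le_ofReal zero_le_one (by simpa using (G.hint i b c).coe_le_one h)

/-- A hint that is unlikely given the sum before the round is unlikely. -/
theorem mean_rare_le [Fintype H] (i : ℕ) (b : ℤ) {θ : ℝ} (hθ : 0 ≤ θ) (A : ℤ → Prop)
    [DecidablePred A] [∀ h, Decidable (G.hintProb i b h < θ)] :
    mean (coinSum G.eps (roundCoins m i)) (fun c => mean (G.hint i b c) fun h =>
      if G.hintProb i b h < θ ∨ A c then 1 else 0)
      ≤ Fintype.card H * θ
        + mean (coinSum G.eps (roundCoins m i)) fun c => if A c then 1 else 0 := by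
  have h1 : ∀ c, mean (G.hint i b c) (fun h => if G.hintProb i b h < θ ∨ A c then 1 else 0)
      ≤ (∑ h, (G.hint i b c h).toReal * (if G.hintProb i b h < θ then 1 else 0))
        + if A c then 1 else 0 := fun c => by
    rw [← mean_fintype, ← mean_const (G.hint i b c) (if A c then (1 : ℝ) else 0),
      ← mean_add _ (IsBdd.ite _) (IsBdd.const _)]
    refine mean_mono _ (IsBdd.ite _) ((IsBdd.ite _).add (IsBdd.const _)) fun h => ?_
    by_cases h3 : G.hintProb i b h < θ <;> by_cases h4 : A c <;> simp [h3, h4]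
  have hb : ∀ h, IsBdd fun c => (G.hint i b c h).toReal
      * (if G.hintProb i b h < θ then (1 : ℝ) else 0) := fun h =>
    (G.isBdd_hint i b h).mul (IsBdd.const _)
  have hsb : IsBdd fun c => ∑ h, (G.hint i b c h).toReal
      * (if G.hintProb i b h < θ then (1 : ℝ) else 0) :=
    IsBdd.sum Finset.univ fun h _ => hb h
  refine (mean_mono _ ?_ (hsb.add (IsBdd.ite A)) h1).trans ?_
  · refine IsBdd.mean ⟨1, fun c h => ?_⟩
    split_ifs <;> simp
  rw [mean_add _ hsb (IsBdd.ite A), mean_sum _ _ fun h _ => hb h]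
  refine add_le_add_left ?_ _
  have : ∀ h ∈ (Finset.univ : Finset H), mean (coinSum G.eps (roundCoins m i)) (fun c =>
      (G.hint i b c h).toReal * (if G.hintProb i b h < θ then (1 : ℝ) else 0)) ≤ θ := fun h _ => by
    rw [mean_mul_const]
    change G.hintProb i b h * _ ≤ θ
    split_ifs with hlt
    · rw [mul_one]; exact hlt.le
    · rw [mul_zero]; exact hθ
  refine (Finset.sum_le_card_nsmul _ _ _ this).trans_eq ?_
  rw [nsmul_eq_mul, Finset.card_univ]

theorem future_win_eq (i : ℕ) (s : ℤ) : G.future win i s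
    = tailSum (binWeight (headProb G.eps) (coinsFrom m (i + 1))) (coinsFrom m (i + 1)) (-s) := by
  rw [future, mean_coinSum _ _ (isBdd_win.comp fun x => s + x), tailSum]
  refine Finset.sum_congr rfl fun k _ => ?_
  rw [win]
  split_ifs <;> first | omega | simp

/-- Jensen's inequality: a bound in terms of the present sum is converted into a payoff at the final
sum, which optional stopping can handle. -/
theorem rpow_le_future {β : ℝ} (hβ : 0 ≤ β) (i : ℕ) (s : ℤ) :
    (1 + ((s : ℝ) + (2 * headProb G.eps - 1) * coinsFrom m (i + 1)) ^ 2 + coinsFrom m (i + 1)) ^ (-β)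
      ≤ G.future (payoff β) i s := by
  rw [future, mean_coinSum _ _ ((isBdd_payoff hβ).comp fun x => s + x)]
  refine (rpow_le_sum_binWeight (headProb_nonneg _) (headProb_le_one _) hβ _ _).trans_eq ?_
  refine Finset.sum_congr rfl fun k _ => ?_
  rw [payoff]
  push_cast
  rfl

/-- The change of the value by a hint, as a finite sum. -/
theorem abs_valueHint_sub_value_le_sum [DecidableEq H] (i : Fin m) (b : ℤ) (h : H) {l : ℕ}
    (hl : l = roundCoins m (i + 1)) :
    |G.valueHint i b h - G.value i b|
      ≤ |(∑ k ∈ Finset.range (l + 1), binWeight (headProb G.eps) l k *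
            ((G.hint (i + 1) b (2 * k - l) h).toReal * G.future win (i + 1) (b + (2 * k - l))))
          / (∑ k ∈ Finset.range (l + 1), binWeight (headProb G.eps) l k *
            (G.hint (i + 1) b (2 * k - l) h).toReal)
        - ∑ k ∈ Finset.range (l + 1), binWeight (headProb G.eps) l k *
            G.future win (i + 1) (b + (2 * k - l))| := by
  subst hl
  have h1 := G.isBdd_hint (i + 1) b h
  have h2 := (isBdd_future (G := G) isBdd_win (i + 1)).comp fun c => b + c
  have := G.abs_valueHint_sub_value_le i b h
  rw [mean_coinSum _ _ h1, mean_coinSum _ _ h2, mean_coinSum _ _ (h1.mul h2)] at this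
  exact this

theorem hintProb_eq_sum (i : ℕ) (b : ℤ) (h : H) {l : ℕ} (hl : l = roundCoins m i) :
    G.hintProb i b h = ∑ k ∈ Finset.range (l + 1), binWeight (headProb G.eps) l k *
      (G.hint i b (2 * k - l) h).toReal := by
  subst hl
  rw [hintProb, mean_coinSum _ _ (G.isBdd_hint i b h)]

theorem future_win_mem (i : ℕ) (s : ℤ) : G.future win i s ∈ Set.Icc (0 : ℝ) 1 := by
  have h : ∀ y, 0 ≤ win y ∧ win y ≤ 1 := fun y => by unfold win; split_ifs <;> norm_num
  exact ⟨mean_nonneg _ fun x => (h _).1,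
    mean_le_const _ (isBdd_win.comp fun x => s + x) fun x => (h _).2⟩

/-- If the sum before the round is far from the threshold, then the outcome is almost decided. -/
theorem future_win_decided {i : ℕ} {b : ℤ} {V t : ℝ} (hV : 0 < V) (hN : coinsFrom m (i + 1) ≤ V)
    (ht : 0 ≤ t)
    (hμ : t ≤ |(b : ℝ) + (2 * headProb G.eps - 1) * coinsFrom m (i + 1)|) :
    G.future win i b ≤ 2 * Real.exp (-(t ^ 2 / (16 * V))) ∨
      1 - G.future win i b ≤ 2 * Real.exp (-(t ^ 2 / (16 * V))) := by
  have htail := mean_coinSum_tail_le G.eps hV hN ht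
  have hb : IsBdd fun x => win (b + x) := isBdd_win.comp fun x => b + x
  set q := (2 * headProb G.eps - 1) * (coinsFrom m (i + 1) : ℝ)
  rcases le_abs.1 hμ with h | h
  · right
    refine le_trans ?_ htail
    have e : 1 - G.future win i b
        = mean (coinSum G.eps (coinsFrom m (i + 1))) fun x => 1 + -1 * win (b + x) := by
      rw [mean_add _ (IsBdd.const _) (hb.const_mul _), mean_const, mean_const_mul, future]
      ring
    rw [e]
    refine mean_mono _ ((IsBdd.const _).add (hb.const_mul _)) (IsBdd.ite _) fun x => ?_
    rw [win]
    split_ifs with h1 h2 h3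
    · norm_num
    · norm_num
    · norm_num
    · exfalso
      refine h3 (le_abs.2 (Or.inr ?_))
      have : ((b + x : ℤ) : ℝ) ≤ 0 := by exact_mod_cast (not_le.1 h1).le
      push_cast at this
      linarith
  · left
    refine le_trans ?_ htail
    refine mean_mono _ hb (IsBdd.ite _) fun x => ?_
    rw [win]
    split_ifs with h1 h2 h3
    · norm_num
    · exfalso
      refine h2 (le_abs.2 (Or.inl ?_))
      have : (0 : ℝ) ≤ ((b + x : ℤ) : ℝ) := by exact_mod_cast h1
      push_cast at this
      linarith
    · norm_num
    · norm_num

/-- The less likely outcome has probability at most 2exp(-16Λ), and conditioning on an event of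
probability at least exp(-2Λ) raises it by at most a factor exp(2Λ). -/
theorem abs_valueHint_sub_value_le_decided [DecidableEq H] (i : Fin m) (b : ℤ) (h : H) {V Λ : ℝ}
    (hV : 0 < V) (hN : coinsFrom m (i + 1) ≤ V) (hΛ : 0 ≤ Λ)
    (hμ : 16 * √(V * Λ) ≤ |(b : ℝ) + (2 * headProb G.eps - 1) * coinsFrom m (i + 1)|)
    (hη : Real.exp (-(2 * Λ)) ≤ G.hintProb (i + 1) b h) :
    |G.valueHint i b h - G.value i b| ≤ 2 * Real.exp (-(14 * Λ)) := by
  have hη0 : 0 < G.hintProb (i + 1) b h := (Real.exp_pos _).trans_le hη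
  have hdec := G.future_win_decided hV hN (by positivity) hμ
  rw [sq_div_sixteen hV hΛ, G.future_succ isBdd_win i.2,
    mean_coinSum _ _ ((isBdd_future isBdd_win (i + 1)).comp fun c => b + c)] at hdec
  refine (G.abs_valueHint_sub_value_le_sum i b h rfl).trans ?_
  rw [G.hintProb_eq_sum _ _ _ rfl] at hη hη0
  refine (abs_sub_le_of_decided
    (binWeight_nonneg (headProb_nonneg G.eps) (headProb_le_one G.eps) _)
    (sum_binWeight _ _) (fun k => ⟨ENNReal.toReal_nonneg, G.hint_toReal_le_one _ _ _ _⟩)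
    (fun k => G.future_win_mem _ _) hη0 hdec).trans ?_
  rw [div_le_iff₀ hη0]
  have : Real.exp (-(16 * Λ)) = Real.exp (-(14 * Λ)) * Real.exp (-(2 * Λ)) := by
    rw [← Real.exp_add]; congr 1; ring
  rw [this, ← mul_assoc]
  gcongr

/-- Either the game is practically decided, or the expected final sum y after the round is at most
32√(NΛ). Then 1+y²+n ≤ √m, so by Jensen √m times the conditional payoff is at least 1 and pays for
the trivial bound. -/
theorem abs_valueHint_sub_value_le_late [DecidableEq H] (i : Fin m) (b c : ℤ) (h : H) {Λ : ℝ}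
    (hΛ : 1 ≤ Λ) (hN : 1026 * coinsFrom m (i + 1) * Λ ≤ √m)
    (hc : |(c : ℝ) - (2 * headProb G.eps - 1) * roundCoins m (i + 1)|
      < 16 * √(roundCoins m (i + 1) * Λ))
    (hη : Real.exp (-(2 * Λ)) ≤ G.hintProb (i + 1) b h) :
    |G.valueHint i b h - G.value i b|
      ≤ √m * G.future (payoff 1) (i + 1) (b + c) + 2 * Real.exp (-(14 * Λ)) := by
  have hsplit := coinsFrom_eq_add i.2
  have hl : 1 ≤ roundCoins m (i + 1) := Nat.one_le_pow _ _ (by have := i.2; omega)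
  set l := roundCoins m (i + 1)
  set n := coinsFrom m (i + 1 + 1) with hn
  set N := coinsFrom m (i + 1) with hNdef
  have hl1 : (1 : ℝ) ≤ l := by exact_mod_cast hl
  have hn0 : (0 : ℝ) ≤ n := Nat.cast_nonneg n
  have hNR : (N : ℝ) = l + n := by rw [hsplit]; push_cast; rfl
  have hfut : 0 ≤ G.future (payoff 1) (i + 1) (b + c) :=
    mean_nonneg _ fun x => payoff_nonneg _ _
  rcases le_or_gt (16 * √(N * Λ)) |(b : ℝ) + (2 * headProb G.eps - 1) * N| with hμ | hμ
  · have := G.abs_valueHint_sub_value_le_decided i b h (V := N) (by linarith) le_rfl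
      (by linarith) hμ hη
    have h2 : 0 ≤ √m * G.future (payoff 1) (i + 1) (b + c) := by positivity
    linarith
  · have h1 := G.abs_valueHint_sub_value_le_one i b h
    have h2 := G.rpow_le_future (β := 1) zero_le_one (i + 1) (b + c)
    rw [← hn, Real.rpow_neg_one] at h2
    push_cast at h2
    set y := (b : ℝ) + c + (2 * headProb G.eps - 1) * n with hy
    have hlN : √((l : ℝ) * Λ) ≤ √(N * Λ) :=
      Real.sqrt_le_sqrt (mul_le_mul_of_nonneg_right (by linarith) (by linarith))
    have hyabs : |y| ≤ 32 * √(N * Λ) := by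
      have e : y = ((b : ℝ) + (2 * headProb G.eps - 1) * N)
          + ((c : ℝ) - (2 * headProb G.eps - 1) * l) := by rw [hy, hNR]; ring
      rw [e]
      refine (abs_add_le _ _).trans ?_
      linarith
    have hy2 : y ^ 2 ≤ 1024 * (N * Λ) := by
      have := pow_le_pow_left₀ (abs_nonneg y) hyabs 2
      rw [sq_abs, mul_pow, Real.sq_sqrt (mul_nonneg (Nat.cast_nonneg N) (by linarith))] at this
      linarith
    have hle : 1 + y ^ 2 + n ≤ √m := by
      have : (N : ℝ) ≤ N * Λ := le_mul_of_one_le_right (by linarith) hΛ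
      linarith
    have hpos : 0 < 1 + y ^ 2 + (n : ℝ) := by positivity
    have h3 : 1 ≤ √m * (1 + y ^ 2 + (n : ℝ))⁻¹ := by
      rw [← div_eq_mul_inv, le_div_iff₀ hpos]
      linarith
    have h4 := mul_le_mul_of_nonneg_left h2 (Real.sqrt_nonneg (m : ℝ))
    have := Real.exp_nonneg (-(14 * Λ))
    linarith

end Game

/-! ### The bias of the hypergeometric game -/

section HypGame

variable {m : ℕ} {v : Fin (2 * coinsFrom m 1) → ℤˣ}

theorem hypHint_one (i : ℕ) (b c : ℤ) : (hypHint m v i b c 1).toReal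
    = tailSum (hypWeight (plusCount v) (2 * coinsFrom m 1 - plusCount v) (coinsFrom m (i + 1)))
      (coinsFrom m (i + 1)) (-b - c) := by
  have hb : IsBdd fun a : ℤ => if (if -b - c ≤ a then (1 : ℤˣ) else -1) = 1 then (1 : ℝ) else 0 :=
    IsBdd.ite _
  rw [toReal_apply_eq_mean, hypHint, mean_map _ _ (IsBdd.ite _),
    mean_hypergeometric _ _ _ hb, tailSum]
  refine Finset.sum_congr rfl fun k _ => ?_
  split_ifs <;> simp_all

/-- The hint -1 means x < -b-c, that is -x ≥ b+c+1, and -x is hypergeometric with the colours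
exchanged. -/
theorem hypHint_neg_one (i : ℕ) (b c : ℤ) : (hypHint m v i b c (-1)).toReal
    = tailSum (hypWeight (2 * coinsFrom m 1 - plusCount v) (plusCount v) (coinsFrom m (i + 1)))
      (coinsFrom m (i + 1)) (b + c + 1) := by
  have hb : IsBdd fun a : ℤ => if (if -b - c ≤ a then (1 : ℤˣ) else -1) = -1 then (1 : ℝ) else 0 :=
    IsBdd.ite _
  rw [toReal_apply_eq_mean, hypHint, mean_map _ _ (IsBdd.ite _),
    mean_hypergeometric _ _ _ hb, tailSum, ← Finset.sum_range_reflect]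
  refine Finset.sum_congr rfl fun k hk => ?_
  have hk' : k ≤ coinsFrom m (i + 1) := by simpa [Nat.lt_succ_iff] using hk
  rw [show coinsFrom m (i + 1) + 1 - 1 - k = coinsFrom m (i + 1) - k by omega, hypWeight_sub hk',
    Nat.cast_sub hk']
  by_cases h : b + c + 1 ≤ 2 * (k : ℤ) - coinsFrom m (i + 1)
  · rw [if_neg (show ¬ -b - c ≤ 2 * ((coinsFrom m (i + 1) : ℤ) - k) - coinsFrom m (i + 1) by omega),
      if_pos rfl, if_pos h, mul_one]
  · rw [if_pos (show -b - c ≤ 2 * ((coinsFrom m (i + 1) : ℤ) - k) - coinsFrom m (i + 1) by omega),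
      if_neg (by decide), if_neg h, mul_zero]

/-- The probability of each hint is a tail probability of a bell-shaped distribution. -/
theorem exists_bell_hypHint {i : ℕ} (hn : 0 < coinsFrom m (i + 1))
    (hp : |(weight v : ℝ)| ≤ coinsFrom m 1) (b : ℤ) (h : ℤˣ) :
    ∃ (f : ℕ → ℝ) (k₀ : ℝ) (σ y₀ : ℤ), Bell f (coinsFrom m (i + 1)) k₀ 32 ∧ |σ| = 1 ∧
      ∀ c, (hypHint m v i b c h).toReal = tailSum f (coinsFrom m (i + 1)) (σ * c + y₀) := by
  have hle := coinsFrom_succ_le m i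
  have hle' : coinsFrom m (i + 1) ≤ coinsFrom m 1 :=
    Finset.sum_le_sum_of_subset (Finset.Icc_subset_Icc_left (by omega))
  have hpc := plusCount_le v
  have hw := weight_eq v
  -- A weight of at most half the length leaves each sign on at least a quarter of the coordinates,
  -- and the sample takes at most half of them.
  have hwZ : |weight v| ≤ (coinsFrom m 1 : ℤ) := by exact_mod_cast hp
  obtain ⟨h1, h2⟩ := abs_le.1 hwZ
  rw [hw] at h1 h2
  push_cast at h1 h2
  rcases Int.units_eq_one_or h with rfl | rfl
  · exact ⟨_, _, -1, -b, bell_hypWeight (a := plusCount v)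
      (b := 2 * coinsFrom m 1 - plusCount v) hn (by omega) (by omega) (by omega), by norm_num,
      fun c => by rw [hypHint_one]; congr 1; ring⟩
  · exact ⟨_, _, 1, b + 1, bell_hypWeight (a := 2 * coinsFrom m 1 - plusCount v)
      (b := plusCount v) hn (by omega) (by omega) (by omega), by norm_num,
      fun c => by rw [hypHint_neg_one]; congr 1; ring⟩

/-- The one-round covariance bound followed by Jensen's inequality for the power -1/3; the constant
is 6 · 1867776. Rounds are indexed from zero, so r = m - i counts the current one. -/
theorem abs_valueHint_sub_value_le_early {ε : Set.Icc (-1 : ℝ) 1} (h0 : 1 / 4 ≤ headProb ε)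
    (h1 : headProb ε ≤ 3 / 4) (hp : |(weight v : ℝ)| ≤ coinsFrom m 1) (i : Fin m) (b c : ℤ)
    (h : ℤˣ) (hm : 1 ≤ Real.log m) (hr : 10 ^ 12 * Real.log m ^ 2 ≤ ((m - i : ℕ) : ℝ))
    (hc : |(c : ℝ) - (2 * headProb ε - 1) * roundCoins m (i + 1)|
      < 16 * √(roundCoins m (i + 1) * Real.log m))
    (hη : Real.exp (-(2 * Real.log m)) ≤ (hypGame m ε v).hintProb (i + 1) b h) :
    |(hypGame m ε v).valueHint i b h - (hypGame m ε v).value i b|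
      ≤ 11206656 * √(Real.log m) * (hypGame m ε v).future (payoff (1 / 3)) (i + 1) (b + c)
        + 2 * Real.exp (-(14 * Real.log m)) := by
  set G := hypGame m ε v with hG
  set Λ := Real.log m with hΛ
  set r := m - (i : ℕ) with hrdef
  have hrm : r ≤ m := Nat.sub_le _ _
  have hr2 : 2 ≤ r := by
    have : (2 : ℝ) ≤ r := by nlinarith
    exact_mod_cast this
  have hl : roundCoins m (i + 1) = r ^ 2 := by
    rw [roundCoins, show m + 1 - ((i : ℕ) + 1) = r by omega]
  have hn6 := six_mul_coinsFrom (m := m) (i := i + 1) (r := r - 1) (by omega)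
  set n := coinsFrom m (i + 1 + 1) with hn
  obtain ⟨q, hq⟩ : ∃ q, r = q + 2 := ⟨r - 2, by omega⟩
  rw [hq, show q + 2 - 1 = q + 1 by omega] at hn6
  have hn0 : 0 < n := by
    by_contra hc0
    have : n = 0 := by omega
    rw [this] at hn6
    have : 0 < (q + 1) * (q + 1 + 1) * (2 * (q + 1) + 1) := by positivity
    omega
  have hrn : r ^ 3 ≤ 8 * n := by rw [hq]; nlinarith
  have hnm : n + 1 ≤ m ^ 3 := by
    refine le_trans ?_ (Nat.pow_le_pow_left hrm 3)
    rw [hq]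
    nlinarith
  have hm0 : (0 : ℝ) < m := by
    have : 0 < m := by have := i.2; omega
    exact_mod_cast this
  have hnΛ : (n : ℝ) + 1 ≤ Real.exp (3 * Λ) := by
    have e : Real.exp (3 * Λ) = (m : ℝ) ^ 3 := by
      rw [hΛ, ← Real.exp_log hm0, ← Real.exp_nat_mul, Real.log_exp]
      norm_num
    rw [e]
    exact_mod_cast hnm
  obtain ⟨f, k₀, σ, y₀, hf, hσ, hhint⟩ := exists_bell_hypHint hn0 hp b h
  have heps : G.eps = ε := rfl
  have hint_eq : ∀ c, (G.hint (i + 1) b c h).toReal = tailSum f n (σ * c + y₀) := hhint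
  have hsum := G.abs_valueHint_sub_value_le_sum i b h hl.symm
  have hηs := G.hintProb_eq_sum (i + 1) b h hl.symm
  simp only [hint_eq, G.future_win_eq, heps] at hsum hηs
  rw [← hηs] at hsum
  set μ := (b : ℝ) + (2 * headProb ε - 1) * (r ^ 2 : ℕ) + (2 * headProb ε - 1) * n with hμ
  have hE := abs_round_early_le h0 h1 hf hm hrn hr hnΛ hσ y₀ b hμ hηs hη
  refine (hsum.trans hE).trans (add_le_add_left ?_ _)
  obtain ⟨-, -, -, -, -, -, -, hω⟩ := early_parameters hn0 hm hrn hr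
  rw [hl] at hc
  have hy : (((b + c : ℤ) : ℝ) + (2 * headProb ε - 1) * n - μ) ^ 2 ≤ n := by
    have e : ((b + c : ℤ) : ℝ) + (2 * headProb ε - 1) * n - μ
        = c - (2 * headProb ε - 1) * (r ^ 2 : ℕ) := by rw [hμ]; push_cast; ring
    rw [e, ← sq_abs]
    have h3 : |(c : ℝ) - (2 * headProb ε - 1) * (r ^ 2 : ℕ)| ≤ √n := by
      have := Real.sqrt_nonneg (((r ^ 2 : ℕ) : ℝ) * Λ)
      linarith
    have := pow_le_pow_left₀ (abs_nonneg _) h3 2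
    rwa [Real.sq_sqrt (Nat.cast_nonneg n)] at this
  have h4 := (div_sqrt_mul_sqrt_le_rpow hn0 hrn hy).trans
    (mul_le_mul_of_nonneg_left (G.rpow_le_future (β := 1 / 3) (by norm_num) (i + 1) (b + c))
      (by norm_num))
  have h5 := mul_le_mul_of_nonneg_left h4 (show 0 ≤ 1867776 * √Λ by positivity)
  refine h5.trans_eq ?_
  ring

-- Optional stopping with one payoff for the early rounds and one for the late rounds; their sum
-- dominates the effect of every round.
open Classical in
theorem bias_hypGame_le_of_small {ε : Set.Icc (-1 : ℝ) 1} (h0 : 1 / 4 ≤ headProb ε)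
    (h1 : headProb ε ≤ 3 / 4) (hp : |(weight v : ℝ)| ≤ coinsFrom m 1) (hm : 1 ≤ Real.log m)
    (hlarge : 10 ^ 80 * Real.log m ^ 14 ≤ m) :
    (hypGame m ε v).bias ≤ 10 ^ 10 * (√(Real.log m) / m) := by
  have hm0' : (0 : ℝ) < m := by
    rcases Nat.eq_zero_or_pos m with h | h
    · rw [h] at hm; norm_num at hm
    · exact_mod_cast h
  have hm0 : 0 < m := by exact_mod_cast hm0'
  set G := hypGame m ε v with hG
  set Λ := Real.log m with hΛ
  have hL1 : 1 ≤ √Λ := Real.one_le_sqrt.2 hm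
  set Φ : ℤ → ℝ := fun y => 11206656 * √Λ * payoff (1 / 3) y + √m * payoff 1 y with hΦ
  have hb3 : IsBdd (payoff (1 / 3)) := isBdd_payoff (by norm_num)
  have hb1 : IsBdd (payoff 1) := isBdd_payoff (by norm_num)
  have hΦb : IsBdd Φ := (hb3.const_mul _).add (hb1.const_mul _)
  have hΦ0 : ∀ y, 0 ≤ Φ y := fun y => by
    have := payoff_nonneg (1 / 3) y
    have := payoff_nonneg 1 y
    positivity
  have hfutΦ : ∀ i s, G.future Φ i s
      = 11206656 * √Λ * G.future (payoff (1 / 3)) i s + √m * G.future (payoff 1) i s := by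
    intro i s
    rw [Game.future, mean_add _ ((hb3.const_mul _).comp fun x => s + x)
      ((hb1.const_mul _).comp fun x => s + x), mean_const_mul, mean_const_mul]
    rfl
  have hfut0 : ∀ β i s, 0 ≤ G.future (payoff β) i s := fun β i s =>
    mean_nonneg _ fun x => payoff_nonneg _ _
  have hbias := G.bias_le hΦb hΦ0 (τ := 2 * Real.exp (-(14 * Λ)))
    (τ' := 2 * Real.exp (-(2 * Λ)) + 2 * Real.exp (-(16 * Λ))) (by positivity)
    (fun i b c h => G.hintProb (i + 1) b h < Real.exp (-(2 * Λ)) ∨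
      16 * √(roundCoins m (i + 1) * Λ) ≤ |(c : ℝ) - (2 * headProb ε - 1) * roundCoins m (i + 1)|)
    (fun i b c h hgood => by
      push Not at hgood
      obtain ⟨hη, hc⟩ := hgood
      rw [hfutΦ]
      have e3 := mul_nonneg (show 0 ≤ 11206656 * √Λ by positivity)
        (hfut0 (1 / 3) (i + 1) (b + c))
      have e1 := mul_nonneg (Real.sqrt_nonneg (m : ℝ)) (hfut0 1 (i + 1) (b + c))
      rcases le_or_gt (10 ^ 12 * Λ ^ 2) ((m - i : ℕ) : ℝ) with hr | hr
      · have := abs_valueHint_sub_value_le_early h0 h1 hp i b c h hm hr hc hη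
        linarith
      · have hN : 1026 * coinsFrom m (i + 1) * Λ ≤ √m := by
          have hi := i.2
          have h6 := six_mul_coinsFrom (m := m) (i := i) (r := m - i) (by omega)
          have hr1 : 1 ≤ m - (i : ℕ) := by omega
          set r := m - (i : ℕ)
          have hNr : coinsFrom m (i + 1) ≤ r ^ 3 := by
            have : r ≤ r ^ 3 := Nat.le_self_pow (by norm_num) r
            have : r ^ 2 ≤ r ^ 3 := Nat.pow_le_pow_right hr1 (by norm_num)
            nlinarith
          have hNr' : (coinsFrom m (i + 1) : ℝ) ≤ (r : ℝ) ^ 3 := by exact_mod_cast hNr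
          have hr3 : (r : ℝ) ^ 3 ≤ (10 ^ 12 * Λ ^ 2) ^ 3 :=
            pow_le_pow_left₀ (Nat.cast_nonneg r) hr.le 3
          have hΛ0 : 0 ≤ Λ := by linarith
          -- Fewer than 10^12 Λ² rounds remain, so the remaining coins number at most the cube of
          -- this. The square of this bound is the size required of m.
          have hb : 1026 * (coinsFrom m (i + 1) : ℝ) * Λ ≤ 10 ^ 40 * Λ ^ 7 := by
            calc 1026 * (coinsFrom m (i + 1) : ℝ) * Λ ≤ 1026 * (10 ^ 12 * Λ ^ 2) ^ 3 * Λ := by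
                  gcongr
                  exact hNr'.trans hr3
              _ = 1026 * 10 ^ 36 * Λ ^ 7 := by ring
              _ ≤ 10 ^ 40 * Λ ^ 7 := by gcongr; norm_num
          refine hb.trans (Real.le_sqrt_of_sq_le (le_trans (le_of_eq ?_) hlarge))
          rw [mul_pow, ← pow_mul, ← pow_mul]
        have := G.abs_valueHint_sub_value_le_late i b c h hm hN hc hη
        linarith)
    (fun i => by
      refine mean_le_const _ (IsBdd.mean ⟨1, fun ω c => ?_⟩) fun ω => ?_
      · refine (abs_mean_le _ (IsBdd.ite _)).trans (mean_le_const _ (IsBdd.ite _).abs fun h => ?_)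
        split_ifs <;> simp
      · refine (G.mean_rare_le (i + 1) (Game.total ω) (Real.exp_nonneg _) fun c =>
          16 * √(roundCoins m (i + 1) * Λ)
            ≤ |(c : ℝ) - (2 * headProb ε - 1) * roundCoins m (i + 1)|).trans ?_
        have hl : (0 : ℝ) < roundCoins m (i + 1) := by
          have : 1 ≤ roundCoins m (i + 1) := Nat.one_le_pow _ _ (by have := i.2; omega)
          exact_mod_cast this
        have htail := mean_coinSum_tail_le ε hl le_rfl
          (t := 16 * √(roundCoins m (i + 1) * Λ)) (by positivity)
        rw [sq_div_sixteen hl (by linarith)] at htail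
        refine add_le_add (le_of_eq ?_) htail
        norm_num [Fintype.card_units_int])
  refine hbias.trans ?_
  have hV6 := six_mul_coinsFrom (m := m) (i := 0) (r := m) (by omega)
  have hV : m ^ 3 ≤ 8 * coinsFrom m 1 := by
    rw [zero_add] at hV6
    nlinarith
  have hE3 := mean_payoff_third_le (ε := ε) h0 h1 hm0 hV
  have hE1 := mean_payoff_one_le (ε := ε) h0 h1 hm0 hV
  have hmeanΦ : mean (coinSum G.eps (coinsFrom m 1)) Φ
      ≤ 11206656 * √Λ * (770 / m) + 1152 / m := by
    rw [mean_add _ (hb3.const_mul _) (hb1.const_mul _), mean_const_mul, mean_const_mul]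
    exact add_le_add (mul_le_mul_of_nonneg_left hE3 (by positivity)) hE1
  have hexp2 : Real.exp (-(2 * Λ)) = 1 / (m : ℝ) ^ 2 := by
    rw [Real.exp_neg, one_div, show 2 * Λ = ((2 : ℕ) : ℝ) * Λ by norm_num, Real.exp_nat_mul, hΛ,
      Real.exp_log hm0']
  have hexp14 : Real.exp (-(14 * Λ)) ≤ Real.exp (-(2 * Λ)) := Real.exp_le_exp.2 (by linarith)
  have hexp16 : Real.exp (-(16 * Λ)) ≤ Real.exp (-(2 * Λ)) := Real.exp_le_exp.2 (by linarith)
  -- Each of the m rounds loses O(m⁻²), mainly from the two hint values of probability below m⁻².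
  have herr : (m : ℝ) * (2 * Real.exp (-(14 * Λ))
      + (2 * Real.exp (-(2 * Λ)) + 2 * Real.exp (-(16 * Λ)))) ≤ 6 / m := by
    calc _ ≤ (m : ℝ) * (6 * (1 / (m : ℝ) ^ 2)) := by
          refine mul_le_mul_of_nonneg_left ?_ hm0'.le
          rw [← hexp2]
          linarith
      _ = 6 / m := by field_simp
  calc _ ≤ 11206656 * √Λ * (770 / m) + 1152 / m + 6 / m := add_le_add hmeanΦ herr
    _ = (11206656 * 770 * √Λ + 1158) / m := by ring
    _ ≤ 10 ^ 10 * √Λ / m := by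
      gcongr
      linarith
    _ = 10 ^ 10 * (√Λ / m) := by ring

-- The drift of the whole game exceeds twice the typical deviation 16√(VΛ). Hence whenever the sum
-- so far is typical the expected final sum is at least 16√(VΛ) away from zero, every round is
-- practically decided, and the zero payoff suffices.
open Classical in
theorem bias_hypGame_le_of_large {ε : Set.Icc (-1 : ℝ) 1} (hm : 1 ≤ Real.log m)
    (hε : 32 * √(coinsFrom m 1 * Real.log m) ≤ |2 * headProb ε - 1| * coinsFrom m 1) :
    (hypGame m ε v).bias ≤ 6 / m := by
  have hm0' : (0 : ℝ) < m := by
    rcases Nat.eq_zero_or_pos m with h | h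
    · rw [h] at hm; norm_num at hm
    · exact_mod_cast h
  have hm0 : 0 < m := by exact_mod_cast hm0'
  set G := hypGame m ε v with hG
  set Λ := Real.log m with hΛ
  set V := coinsFrom m 1 with hVdef
  have hV6 := six_mul_coinsFrom (m := m) (i := 0) (r := m) (by omega)
  have hV0 : 0 < V := by
    rw [zero_add] at hV6
    by_contra hc
    have h0 : V = 0 := by omega
    rw [← hVdef, h0] at hV6
    have : 0 < m * (m + 1) * (2 * m + 1) := by positivity
    omega
  have hV : (0 : ℝ) < V := by exact_mod_cast hV0
  set δ := 2 * headProb ε - 1 with hδ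
  set Q : ℕ → ℕ := fun i => ∑ j ∈ Finset.Icc 1 i, roundCoins m j with hQ
  have hQV : ∀ i : Fin m, (Q i : ℝ) + coinsFrom m (i + 1) = V := fun i => by
    have : Q i + coinsFrom m (i + 1) = V := by
      have hIcc : ∀ a b : ℕ, Finset.Icc (a + 1) b = Finset.Ioc a b := fun a b => by
        ext j
        simp only [Finset.mem_Icc, Finset.mem_Ioc]
        omega
      have h1 := Finset.sum_Ioc_consecutive (roundCoins m) (Nat.zero_le (i : ℕ)) i.2.le
      simp only [← hIcc] at h1
      exact h1
    exact_mod_cast this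
  have hΛ0 : 0 ≤ Λ := by linarith
  have hbias := G.bias_le (Φ := fun _ => 0) (IsBdd.const 0) (fun _ => le_rfl)
    (τ := 2 * Real.exp (-(14 * Λ)))
    (τ' := 2 * Real.exp (-(2 * Λ)) + 2 * Real.exp (-(16 * Λ))) (by positivity)
    (fun i b c h => G.hintProb (i + 1) b h < Real.exp (-(2 * Λ)) ∨
      16 * √(V * Λ) ≤ |(b : ℝ) - δ * Q i|)
    (fun i b c h hgood => by
      push Not at hgood
      obtain ⟨hη, hb⟩ := hgood
      have hN : (coinsFrom m (i + 1) : ℝ) ≤ V := by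
        have := hQV i
        have : (0 : ℝ) ≤ Q i := Nat.cast_nonneg _
        linarith
      refine (G.abs_valueHint_sub_value_le_decided i b h hV hN hΛ0 ?_ hη).trans
        (le_add_of_nonneg_left (mean_nonneg _ fun _ => le_rfl))
      change 16 * √(V * Λ) ≤ |(b : ℝ) + δ * coinsFrom m (i + 1)|
      -- The total drift is the expected final sum minus the deviation so far.
      have e : δ * V = ((b : ℝ) + δ * coinsFrom m (i + 1)) - (b - δ * Q i) := by
        rw [← hQV i]; ring
      have h2 := abs_sub ((b : ℝ) + δ * coinsFrom m (i + 1)) (b - δ * Q i)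
      rw [← e, abs_mul, Nat.abs_cast] at h2
      linarith)
    (fun i => by
      have hrow : ∀ b : ℤ, mean (coinSum G.eps (roundCoins m (i + 1))) (fun c =>
          mean (G.hint (i + 1) b c) fun h =>
            if G.hintProb (i + 1) b h < Real.exp (-(2 * Λ)) ∨ 16 * √(V * Λ) ≤ |(b : ℝ) - δ * Q i|
              then 1 else 0) ≤ 2 * Real.exp (-(2 * Λ))
            + if 16 * √(V * Λ) ≤ |(b : ℝ) - δ * Q i| then 1 else 0 := fun b => by
        refine (G.mean_rare_le (i + 1) b (Real.exp_nonneg _)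
          fun _ => 16 * √(V * Λ) ≤ |(b : ℝ) - δ * Q i|).trans ?_
        rw [mean_const]
        norm_num [Fintype.card_units_int]
      have hbd : IsBdd fun b : ℤ => if 16 * √(V * Λ) ≤ |(b : ℝ) - δ * Q i| then (1 : ℝ) else 0 :=
        IsBdd.ite _
      have htot : mean (G.lawUpTo i) (fun ω =>
          if 16 * √(V * Λ) ≤ |(Game.total ω : ℝ) - δ * Q i| then (1 : ℝ) else 0)
          ≤ 2 * Real.exp (-(16 * Λ)) := by
        have h1 := G.mean_lawUpTo_restrictTo (Nat.zero_le (i : ℕ)) (IsBdd.const 1) hbd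
        simp only [one_mul] at h1
        rw [h1, Game.lawUpTo, mean_pure]
        have hQi : (Q i : ℝ) ≤ V := by
          have := hQV i
          have : (0 : ℝ) ≤ coinsFrom m (i + 1) := Nat.cast_nonneg _
          linarith
        have h2 := mean_coinSum_tail_le ε hV hQi (t := 16 * √(V * Λ)) (by positivity)
        rw [sq_div_sixteen hV hΛ0] at h2
        simp only [Game.total, Finset.univ_eq_empty, Finset.sum_empty, zero_add]
        exact h2
      have htb : IsBdd fun ω : Fin i → ℤ × ℤˣ =>
          if 16 * √(V * Λ) ≤ |(Game.total ω : ℝ) - δ * Q i| then (1 : ℝ) else 0 := IsBdd.ite _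
      refine (mean_mono _ (IsBdd.mean ⟨1, fun ω c => ?_⟩) ((IsBdd.const _).add htb)
        fun ω => hrow _).trans ?_
      · refine (abs_mean_le _ (IsBdd.ite _)).trans (mean_le_const _ (IsBdd.ite _).abs fun h => ?_)
        split_ifs <;> simp
      · rw [mean_add _ (IsBdd.const _) htb, mean_const]
        linarith)
  rw [mean_const, zero_add] at hbias
  refine hbias.trans ?_
  have hexp2 : Real.exp (-(2 * Λ)) = 1 / (m : ℝ) ^ 2 := by
    rw [Real.exp_neg, one_div, show 2 * Λ = ((2 : ℕ) : ℝ) * Λ by norm_num, Real.exp_nat_mul, hΛ,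
      Real.exp_log hm0']
  have hexp14 : Real.exp (-(14 * Λ)) ≤ Real.exp (-(2 * Λ)) := Real.exp_le_exp.2 (by linarith)
  have hexp16 : Real.exp (-(16 * Λ)) ≤ Real.exp (-(2 * Λ)) := Real.exp_le_exp.2 (by linarith)
  calc _ ≤ (m : ℝ) * (6 * (1 / (m : ℝ) ^ 2)) := by
        refine mul_le_mul_of_nonneg_left ?_ hm0'.le
        rw [← hexp2]
        linarith
    _ = 6 / m := by field_simp

/-- If the drift is below 32√(VΛ), then, V being much larger than Λ, it is below V/2, so the head
probability lies between 1/4 and 3/4. -/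
theorem bias_hypGame_le {ε : Set.Icc (-1 : ℝ) 1} (hp : |(weight v : ℝ)| ≤ coinsFrom m 1)
    (hm : 1 ≤ Real.log m) (hlarge : 10 ^ 80 * Real.log m ^ 14 ≤ m) :
    (hypGame m ε v).bias ≤ 10 ^ 10 * (√(Real.log m) / m) := by
  have hm0' : (0 : ℝ) < m := by
    rcases Nat.eq_zero_or_pos m with h | h
    · rw [h] at hm; norm_num at hm
    · exact_mod_cast h
  rcases le_or_gt (32 * √(coinsFrom m 1 * Real.log m)) (|2 * headProb ε - 1| * coinsFrom m 1)
    with hε | hε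
  · refine (bias_hypGame_le_of_large hm hε).trans ?_
    rw [← mul_div_assoc]
    gcongr
    have := Real.one_le_sqrt.2 hm
    linarith
  · have hV6 := six_mul_coinsFrom (m := m) (i := 0) (r := m) (by omega)
    have hmV : m ≤ coinsFrom m 1 := by
      have : 1 ≤ m := by exact_mod_cast hm0'
      rw [zero_add] at hV6
      nlinarith [Nat.zero_le (m * m)]
    have hmV' : (m : ℝ) ≤ coinsFrom m 1 := by exact_mod_cast hmV
    set V := (coinsFrom m 1 : ℝ)
    have hV : 0 < V := hm0'.trans_le hmV'
    have hlog : 4096 * Real.log m ≤ V := by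
      have h1 : Real.log m ≤ Real.log m ^ 14 := le_self_pow₀ hm (by norm_num)
      linarith
    have hs : √(V * Real.log m) ≤ V / 64 := by
      refine Real.sqrt_le_iff.2 ⟨by positivity, ?_⟩
      nlinarith
    have hε2 : |2 * headProb ε - 1| < 1 / 2 := by
      refine lt_of_mul_lt_mul_right ?_ hV.le
      linarith
    obtain ⟨h1, h2⟩ := abs_lt.1 hε2
    exact bias_hypGame_le_of_small (by linarith) (by linarith) hp hm hlarge

end HypGame

/-! ### Choice of the constant and conclusion -/

theorem eventually_log_pow_le (D : ℝ) (k : ℕ) :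
    ∃ M : ℕ, ∀ m : ℕ, M ≤ m → 1 ≤ Real.log m ∧ D * Real.log m ^ k ≤ m := by
  have h1 : ∀ᶠ m : ℕ in Filter.atTop, 1 ≤ Real.log m :=
    (Real.tendsto_log_atTop.comp tendsto_natCast_atTop_atTop).eventually_ge_atTop 1
  have h2 : ∀ᶠ m : ℕ in Filter.atTop, D * Real.log m ^ k ≤ m := by
    have h3 : (fun x : ℝ => D * Real.log x ^ k) =o[Filter.atTop] (id : ℝ → ℝ) :=
      Real.isLittleO_pow_log_id_atTop.const_mul_left D
    have h4 := (h3.bound one_pos)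
    have h5 := tendsto_natCast_atTop_atTop (R := ℝ) |>.eventually h4
    filter_upwards [h5] with m hm
    have := (le_abs_self _).trans hm
    simpa using this
  obtain ⟨M, hM⟩ := Filter.eventually_atTop.1 (h1.and h2)
  exact ⟨M, hM⟩

end

end OnlineBinomial

/-- Parity and range of p are carried by v: the weights of sign vectors of length 2V are exactly the
even integers in [-2V, 2V]. -/
theorem mainTheorem4 (c : ℝ) :
    ∃ C : ℝ, ∀ m : ℕ, 2 ≤ m → ∀ (ε : Set.Icc (-1 : ℝ) 1) (p : ℤ)
      (v : Fin (2 * OnlineBinomial.coinsFrom m 1) → ℤˣ), OnlineBinomial.weight v = p →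
      |(p : ℝ)| ≤ c * √(Real.logb 2 m * OnlineBinomial.coinsFrom m 1) →
      (OnlineBinomial.hypGame m ε v).bias ≤ C * (√(Real.logb 2 m) / m) := by
  -- The summand 2c² yields c² log₂ m ≤ m ≤ V, hence |p| ≤ V as the bell-shape lemma requires.
  obtain ⟨M, hM⟩ := OnlineBinomial.eventually_log_pow_le (10 ^ 80 + 2 * c ^ 2) 14
  -- For m < M the bound exceeds one, and the bias is at most one.
  refine ⟨10 ^ 10 + M, fun m hm ε p v hv hp => ?_⟩
  have hm2 : (2 : ℝ) ≤ m := by exact_mod_cast hm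
  have hm0 : (0 : ℝ) < m := by linarith
  have hlog2 : 0 < Real.log 2 := Real.log_pos (by norm_num)
  have hlog2' : 1 / 2 ≤ Real.log 2 := by linarith [Real.log_two_gt_d9]
  have hlog2'' : Real.log 2 ≤ 1 := by linarith [Real.log_two_lt_d9]
  have hlogm : 0 ≤ Real.log m := Real.log_nonneg (by linarith)
  have hb1 : 1 ≤ Real.logb 2 m := by
    rw [Real.logb, one_le_div hlog2]
    exact Real.log_le_log (by norm_num) hm2
  have hb2 : Real.log m ≤ Real.logb 2 m := by
    rw [Real.logb, le_div_iff₀ hlog2]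
    nlinarith
  have hb3 : Real.logb 2 m ≤ 2 * Real.log m := by
    rw [Real.logb, div_le_iff₀ hlog2]
    nlinarith
  have hs1 : 1 ≤ √(Real.logb 2 m) := Real.one_le_sqrt.2 hb1
  have hM0 : (0 : ℝ) ≤ M := Nat.cast_nonneg M
  rw [← mul_div_assoc, le_div_iff₀ hm0]
  rcases lt_or_ge m M with hmM | hmM
  · have hle : (OnlineBinomial.hypGame m ε v).bias ≤ 1 := by
      have : Nonempty (OnlineBinomial.Algorithm ℤˣ) := ⟨fun _ => PMF.pure true⟩
      exact ciSup_le fun B => OnlineBinomial.Game.biasOf_le_one _ B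
    have hmM' : (m : ℝ) ≤ M := by exact_mod_cast hmM.le
    nlinarith
  · obtain ⟨h1, h2⟩ := hM m hmM
    have h14 : Real.log m ≤ Real.log m ^ 14 := le_self_pow₀ h1 (by norm_num)
    have hc0 := sq_nonneg c
    have hlarge : 10 ^ 80 * Real.log m ^ 14 ≤ m := by
      have : 0 ≤ 2 * c ^ 2 * Real.log m ^ 14 := by positivity
      linarith
    have hV6 := OnlineBinomial.six_mul_coinsFrom (m := m) (i := 0) (r := m) (by omega)
    have hmV : m ≤ OnlineBinomial.coinsFrom m 1 := by
      rw [zero_add] at hV6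
      nlinarith [Nat.zero_le (m * m)]
    have hmV' : (m : ℝ) ≤ OnlineBinomial.coinsFrom m 1 := by exact_mod_cast hmV
    have hweight : |(OnlineBinomial.weight v : ℝ)| ≤ OnlineBinomial.coinsFrom m 1 := by
      rw [hv]
      set V := (OnlineBinomial.coinsFrom m 1 : ℝ)
      have hV : 0 < V := by linarith
      have hcb : c ^ 2 * Real.logb 2 m ≤ V := by
        have e1 := mul_le_mul_of_nonneg_left hb3 hc0
        have e2 := mul_le_mul_of_nonneg_left h14 hc0
        have e3 : 0 ≤ 10 ^ 80 * Real.log m ^ 14 := by positivity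
        linarith
      refine abs_le_of_sq_le_sq' ?_ hV.le |> abs_le.2
      rw [← sq_abs]
      have := pow_le_pow_left₀ (abs_nonneg _) hp 2
      rw [mul_pow, Real.sq_sqrt (by positivity)] at this
      nlinarith
    have hbias := OnlineBinomial.bias_hypGame_le (ε := ε) hweight h1 hlarge
    rw [← mul_div_assoc, le_div_iff₀ hm0] at hbias
    have := Real.sqrt_le_sqrt hb2
    nlinarith
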